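/- Let $e_1,\dots,e_4$ be the canonical basis of $\mathbb R^4$, let $L_b$ denote translation by $b\in\mathbb R^4$, and put $$B_1=\operatorname{diag}(1,1,-1,-1),\quad B_2=\operatorname{diag}(1,-1,1,-1),$$ $$b_1=\tfrac{e_2+e_4}{2},\quad b_2=\tfrac{e_3}{2},\quad b_1'=\tfrac{e_2}{2},\quad b_2'=\tfrac{e_1}{2}.$$ Let $\Gamma=\langle B_1L_{b_1},\,B_2L_{b_2},\,L_\lambda : \lambda\in\mathbb Z^4\rangle$ and $\Gamma'=\langle B_1L_{b_1'},\,B_2L_{b_2'},\,L_\lambda : \lambda\in\mathbb Z^4\rangle$, subgroups of the isometry group $I(\mathbb R^4)$. Then: 1. $\Gamma$ and $\Gamma'$ are Bieberbach groups, i.e. discrete, cocompact, torsion-free subgroups of $I(\mathbb R^4)$, and $M_\Gamma=\Gamma\backslash\mathbb R^4$ and $M_{\Gamma'}=\Gamma'\backslash\mathbb R^4$, with the metrics induced from $\mathbb R^4$, are compact connected flat Riemannian manifolds of dimension $4$ whose holonomy groups are isomorphic to $\mathbb Z_2^2$. 2. $M_\Gamma$ and $M_{\Gamma'}$ are $p$-isospectral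 for all $p$: for every $p$, each real number has the same multiplicity (possibly $0$) as an eigenvalue of the Hodge Laplacian on smooth $p$-forms of $M_\Gamma$ and of $M_{\Gamma'}$. 3. $H_1(M_\Gamma,\mathbb Z)\simeq\Gamma/[\Gamma,\Gamma]\simeq\mathbb Z\oplus\mathbb Z_4^2$ and $H_1(M_{\Gamma'},\mathbb Z)\simeq\Gamma'/[\Gamma',\Gamma']\simeq\mathbb Z\oplus\mathbb Z_2^3$. In particular these homology groups are not isomorphic, and $M_\Gamma$, $M_{\Gamma'}$ are not homeomorphic. 4. The Betti numbers (dimensions of the real de Rham cohomology spaces) of both $M_\Gamma$ and $M_{\Gamma'}$ are $\beta_j=1$ for $j\in\{0,1,3,4\}$ and $\beta_2=0$. -/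

import Mathlib

open Set Filter Topology
open scoped Manifold ContDiff

noncomputable section

namespace FlatMfd

/-! ### Bieberbach groups and their quotients -/

/-- Euclidean space `ℝⁿ`. -/
abbrev E (n : ℕ) : Type := EuclideanSpace ℝ (Fin n)

/-- The isometry group `I(ℝⁿ)`: every isometry of `ℝⁿ` is affine. The group law is composition. -/
abbrev Isom (n : ℕ) : Type := E n ≃ᵃⁱ[ℝ] E n

/-- The tautological action of `I(ℝⁿ)` on `ℝⁿ`. -/
instance isomAction (n : ℕ) : MulAction (Isom n) (E n) where
  smul γ x := γ x
  one_smul _ := rfl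
  mul_smul _ _ _ := rfl

theorem isom_smul_def {n : ℕ} (γ : Isom n) (x : E n) : γ • x = γ x := rfl

/-- The topology of pointwise convergence on `I(ℝⁿ)` (which is its usual Lie group topology). -/
instance isomTopology (n : ℕ) : TopologicalSpace (Isom n) :=
  TopologicalSpace.induced (fun (γ : Isom n) (x : E n) => γ x) inferInstance

/-- The orbit space `Γ \ ℝⁿ`, with the quotient topology. -/
abbrev OrbitSpace {n : ℕ} (Γ : Subgroup (Isom n)) : Type := MulAction.orbitRel.Quotient Γ (E n)

/-- A Bieberbach group: a discrete, cocompact, torsion-free subgroup of `I(ℝⁿ)`. -/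
class IsBieberbach {n : ℕ} (Γ : Subgroup (Isom n)) : Prop where
  discrete : DiscreteTopology Γ
  cocompact : CompactSpace (OrbitSpace Γ)
  torsionFree : ∀ γ ∈ Γ, IsOfFinOrder γ → γ = 1

instance continuousConstSMul {n : ℕ} (Γ : Subgroup (Isom n)) : ContinuousConstSMul Γ (E n) where
  continuous_const_smul γ := (γ : Isom n).continuous

/-- In a discrete group of isometries the identity is isolated by its values at finitely many
points. -/
theorem exists_isolating {n : ℕ} (Γ : Subgroup (Isom n)) [DiscreteTopology Γ] :
    ∃ (F : Finset (E n)) (ε : ℝ), 0 < ε ∧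
      ∀ γ ∈ Γ, (∀ x ∈ F, dist (γ x) x < ε) → γ = 1 := by
  have h1 : ({1} : Set Γ) ∈ 𝓝 (1 : Γ) := (isOpen_discrete _).mem_nhds rfl
  rw [nhds_induced, nhds_induced, Filter.comap_comap, Filter.mem_comap] at h1
  obtain ⟨U, hU, hU1⟩ := h1
  rw [nhds_pi, Filter.mem_pi] at hU
  obtain ⟨I, hI, t, ht, htU⟩ := hU
  have : ∀ x : E n, ∃ ε > 0, Metric.ball x ε ⊆ t x := fun x => Metric.mem_nhds_iff.1 (ht x)
  choose ε hε hεt using this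
  obtain ⟨δ, hδ, hδε⟩ : ∃ δ > 0, ∀ x ∈ hI.toFinset, δ ≤ ε x := by
    rcases hI.toFinset.eq_empty_or_nonempty with h | h
    · exact ⟨1, one_pos, by simp [h]⟩
    · exact ⟨hI.toFinset.inf' h ε, (Finset.lt_inf'_iff h).2 fun x _ => hε x,
        fun x hx => Finset.inf'_le _ hx⟩
  refine ⟨hI.toFinset, δ, hδ, fun γ hγ h => ?_⟩
  have : (⟨γ, hγ⟩ : Γ) ∈ ({1} : Set Γ) := by
    apply hU1
    apply htU
    intro x hx
    apply hεt
    have hx' : x ∈ hI.toFinset := by simpa using hx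
    exact Metric.mem_ball.2 ((h x hx').trans_le (hδε x hx'))
  simpa using congrArg Subtype.val (Set.mem_singleton_iff.1 this)

/-- In a discrete group of isometries only finitely many elements displace the origin by a bounded
amount. -/
theorem finite_bounded {n : ℕ} (Γ : Subgroup (Isom n)) [DiscreteTopology Γ] (R : ℝ) :
    {γ : Γ | ‖(γ : Isom n) 0‖ ≤ R}.Finite := by
  obtain ⟨F, ε, hε, h⟩ := exists_isolating Γ
  let f : Γ → (F → E n) := fun γ x => (γ : Isom n) x
  have hb : TotallyBounded (f '' {γ : Γ | ‖(γ : Isom n) 0‖ ≤ R}) := by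
    refine TotallyBounded.subset subset_closure (Bornology.IsBounded.isCompact_closure ?_).totallyBounded
    rw [← Bornology.forall_isBounded_image_eval_iff]
    intro x
    refine (Metric.isBounded_closedBall (x := (0 : E n)) (r := R + ‖(x : E n)‖)).subset ?_
    rintro _ ⟨_, ⟨γ, hγ, rfl⟩, rfl⟩
    have h1 : dist ((γ : Isom n) x) ((γ : Isom n) 0) = ‖(x : E n)‖ := by simp
    have h2 : dist ((γ : Isom n) 0) 0 ≤ R := by simpa using hγ
    exact (dist_triangle _ ((γ : Isom n) 0) _).trans (by linarith)
  obtain ⟨t, htf, ht⟩ := Metric.totallyBounded_iff.1 hb (ε / 2) (half_pos hε)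
  have key : ∀ γ : {γ : Γ | ‖(γ : Isom n) 0‖ ≤ R}, ∃ y : t, dist (f γ.1) y.1 < ε / 2 := by
    intro γ
    obtain ⟨y, hy, hy'⟩ := Set.mem_iUnion₂.1 (ht ⟨γ.1, γ.2, rfl⟩)
    exact ⟨⟨y, hy⟩, hy'⟩
  choose g hg using key
  have := htf.to_subtype
  refine Set.finite_coe_iff.1 (Finite.of_injective g ?_)
  intro γ γ' hgg
  have hd : dist (f γ.1) (f γ'.1) < ε := by
    have h1 := hg γ
    have h2 := hg γ'
    rw [← hgg] at h2
    have := dist_triangle_right (f γ.1) (f γ'.1) (g γ).1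
    linarith
  have h1 := h ((γ'.1 : Isom n)⁻¹ * (γ.1 : Isom n)) (Γ.mul_mem (Γ.inv_mem γ'.1.2) γ.1.2) (by
    intro x hx
    have h3 : dist (f γ.1 ⟨x, hx⟩) (f γ'.1 ⟨x, hx⟩) < ε := (dist_le_pi_dist _ _ _).trans_lt hd
    have h4 : ((γ'.1 : Isom n)⁻¹ * (γ.1 : Isom n)) x
        = (γ'.1 : Isom n).symm ((γ.1 : Isom n) x) := rfl
    rw [h4, ← (γ'.1 : Isom n).dist_map, AffineIsometryEquiv.apply_symm_apply]
    exact h3)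
  exact Subtype.ext (Subtype.ext (inv_mul_eq_one.1 h1).symm)

/-- A discrete group of isometries acts properly discontinuously. -/
instance properlyDiscontinuous {n : ℕ} (Γ : Subgroup (Isom n)) [hΓ : IsBieberbach Γ] :
    ProperlyDiscontinuousSMul Γ (E n) where
  finite_disjoint_inter_image := by
    intro K L hK hL
    have := hΓ.discrete
    obtain ⟨r, hr⟩ := hK.isBounded.subset_closedBall 0
    obtain ⟨s, hs⟩ := hL.isBounded.subset_closedBall 0
    refine (finite_bounded Γ (s + r)).subset ?_
    rintro γ ⟨_, ⟨x, hx, rfl⟩, hy⟩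
    have h1 : ‖x‖ ≤ r := by simpa using hr hx
    have hy' : (γ : Isom n) x ∈ L := hy
    have h2 : ‖(γ : Isom n) x‖ ≤ s := by simpa using hs hy'
    have h3 : dist ((γ : Isom n) 0) ((γ : Isom n) x) = ‖x‖ := by simp
    have h4 := dist_triangle ((γ : Isom n) 0) ((γ : Isom n) x) 0
    rw [dist_zero_right, dist_zero_right] at h4
    change ‖(γ : Isom n) 0‖ ≤ s + r
    linarith

/-- A torsion-free discrete group of isometries acts freely. -/
instance isCancelSMul {n : ℕ} (Γ : Subgroup (Isom n)) [hΓ : IsBieberbach Γ] :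
    IsCancelSMul Γ (E n) := by
  rw [isCancelSMul_iff_eq_one_of_smul_eq]
  intro γ x hx
  have hfin := ProperlyDiscontinuousSMul.finite_stabilizer' (Γ := Γ) x
  have hmem : ∀ k : ℕ, γ ^ k ∈ {γ : Γ | γ • x = x} := by
    intro k
    induction k with
    | zero => simp
    | succ k ih => 
      change γ ^ (k + 1) • x = x
      rw [pow_succ, mul_smul, hx]; exact ih
  have hord : IsOfFinOrder γ := by
    by_contra h
    exact Set.infinite_of_injective_forall_mem (injective_pow_iff_not_isOfFinOrder.2 h) hmem hfin
  exact Subtype.ext (hΓ.torsionFree γ γ.2 (Submonoid.isOfFinOrder_coe.2 hord))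

/-! For a Bieberbach group `Γ`, Mathlib's `MulAction.instChartedSpaceQuotient` now makes
`M_Γ = Γ \ ℝⁿ` a manifold whose charts are local inverses of the projection `ℝⁿ → Γ \ ℝⁿ`.
The Riemannian metric on `M_Γ` induced by the one of `ℝⁿ` is the metric for which these charts are
isometries onto open subsets of `ℝⁿ`. -/

/-! ### Flat manifolds

A flat Riemannian `n`-manifold is given by charts in `ℝⁿ` whose transition maps are locally
restrictions of isometries of `ℝⁿ`; its metric is the one making all charts isometries. -/

/-- `M` is a compact connected flat Riemannian manifold of dimension `n`: its charts are isometries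
onto open subsets of `ℝⁿ`, that is, the transition maps are locally Euclidean isometries. -/
structure IsCompactFlatManifold (n : ℕ) (M : Type) [TopologicalSpace M] [ChartedSpace (E n) M] :
    Prop where
  compact : CompactSpace M
  connected : ConnectedSpace M
  hausdorff : T2Space M
  secondCountable : SecondCountableTopology M
  flat : ∀ e ∈ atlas (E n) M, ∀ e' ∈ atlas (E n) M, ∀ y ∈ (e.symm.trans e').source,
    ∃ φ : Isom n, e.symm.trans e' =ᶠ[𝓝 y] φ

section Holonomy

variable (n : ℕ) {M : Type} [TopologicalSpace M] [ChartedSpace (E n) M]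

/-- A vector field `V` along a (continuous) curve in a flat manifold is parallel if its expression
in each flat chart is locally constant. The curve is `t ↦ (V t).proj`. -/
def IsParallel (V : unitInterval → TangentBundle 𝓘(ℝ, E n) M) : Prop :=
  Continuous (fun t => (V t).proj) ∧
    ∀ e ∈ atlas (E n) M, ∀ t, (V t).proj ∈ e.source → ∀ᶠ s in 𝓝 t,
      (mfderiv 𝓘(ℝ, E n) 𝓘(ℝ, E n) e (V s).proj (V s).2 : E n)
        = mfderiv 𝓘(ℝ, E n) 𝓘(ℝ, E n) e (V t).proj (V t).2

/-- `A : T_x M → T_x M` is the parallel transport around the loop `c` based at `x`. -/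
def IsParallelTransport {x : M} (c : Path x x)
    (A : TangentSpace 𝓘(ℝ, E n) x ≃ₗ[ℝ] TangentSpace 𝓘(ℝ, E n) x) : Prop :=
  ∀ v : TangentSpace 𝓘(ℝ, E n) x, ∃ V : unitInterval → TangentBundle 𝓘(ℝ, E n) M,
    IsParallel n V ∧ (∀ t, (V t).proj = c t) ∧ V 0 = ⟨x, v⟩ ∧ V 1 = ⟨x, A v⟩

/-- The holonomy group at `x`: the group of parallel transports around loops based at `x`. -/
def holonomyGroup (x : M) :
    Subgroup (TangentSpace 𝓘(ℝ, E n) x ≃ₗ[ℝ] TangentSpace 𝓘(ℝ, E n) x) :=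
  Subgroup.closure {A | ∃ c : Path x x, IsParallelTransport n c A}

end Holonomy

/-! ### Differential forms on `ℝⁿ`; the exterior derivative is Mathlib's `extDeriv` -/

section Euclidean

variable {n : ℕ}

/-- The codifferential on `ℝⁿ`, the formal adjoint of the exterior derivative:
`δα = - ∑ i, ι(e_i) (∂α / ∂x_i)`. -/
def codiff {p : ℕ} (α : E n → E n [⋀^Fin (p + 1)]→L[ℝ] ℝ) (y : E n) : E n [⋀^Fin p]→L[ℝ] ℝ :=
  -∑ i : Fin n, (fderiv ℝ α y (EuclideanSpace.single i 1)).curryLeft (EuclideanSpace.single i 1)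

/-- The Hodge Laplacian `dδ + δd` on `p`-forms on `ℝⁿ` (with `δ = 0` on functions). -/
def hodgeLaplacian : (p : ℕ) → (E n → E n [⋀^Fin p]→L[ℝ] ℝ) → E n → E n [⋀^Fin p]→L[ℝ] ℝ
  | 0, α => codiff (extDeriv α)
  | _ + 1, α => fun y => extDeriv (codiff α) y + codiff (extDeriv α) y

theorem contDiffOn_extDeriv {p : ℕ} {α : E n → E n [⋀^Fin p]→L[ℝ] ℝ} {U : Set (E n)}
    (hU : IsOpen U) (h : ContDiffOn ℝ ∞ α U) : ContDiffOn ℝ ∞ (extDeriv α) U :=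
  (ContinuousAlternatingMap.alternatizeUncurryFinCLM ℝ (E n) ℝ).contDiff.comp_contDiffOn
    (h.fderiv_of_isOpen hU (by simp))

theorem contDiffOn_codiff {p : ℕ} {α : E n → E n [⋀^Fin (p + 1)]→L[ℝ] ℝ} {U : Set (E n)}
    (hU : IsOpen U) (h : ContDiffOn ℝ ∞ α U) : ContDiffOn ℝ ∞ (codiff α) U := by
  refine (ContDiffOn.sum fun i _ => ?_).neg
  have h1 : ContDiffOn ℝ ∞ (fun y => fderiv ℝ α y (EuclideanSpace.single i 1)) U :=
    (h.fderiv_of_isOpen hU (by simp)).clm_apply contDiffOn_const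
  have h0 : ContDiff ℝ ∞ (fun f : E n [⋀^Fin (p + 1)]→L[ℝ] ℝ => f.curryLeft) :=
    IsBoundedLinearMap.contDiff ⟨⟨fun f g => f.curryLeft_add g, fun c f => f.curryLeft_smul c⟩,
      1, one_pos, fun f => by rw [one_mul, f.norm_curryLeft]⟩
  have h2 := h0.comp_contDiffOn h1
  exact h2.clm_apply contDiffOn_const

theorem codiff_add {p : ℕ} {α η : E n → E n [⋀^Fin (p + 1)]→L[ℝ] ℝ} {y : E n}
    (hα : DifferentiableAt ℝ α y) (hη : DifferentiableAt ℝ η y) :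
    codiff (α + η) y = codiff α y + codiff η y := by
  simp only [codiff, fderiv_add hα hη, add_apply,
    ContinuousAlternatingMap.curryLeft_add, Finset.sum_add_distrib, neg_add]

theorem codiff_smul {p : ℕ} (c : ℝ) {α : E n → E n [⋀^Fin (p + 1)]→L[ℝ] ℝ} {y : E n} :
    codiff (c • α) y = c • codiff α y := by
  have h : fderiv ℝ (c • α) y = c • fderiv ℝ α y := by
    simpa using congrFun (fderiv_const_smul_field (𝕜 := ℝ) (f := α) c) y
  simp only [codiff, h, smul_apply, ContinuousAlternatingMap.curryLeft_smul, smul_neg,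
    Finset.smul_sum]

theorem codiff_congr {p : ℕ} {α η : E n → E n [⋀^Fin (p + 1)]→L[ℝ] ℝ} {y : E n}
    (h : α =ᶠ[𝓝 y] η) : codiff α y = codiff η y := by
  simp only [codiff, h.fderiv_eq]

theorem hodgeLaplacian_add {p : ℕ} {α η : E n → E n [⋀^Fin p]→L[ℝ] ℝ} {U : Set (E n)}
    (hU : IsOpen U) (hα : ContDiffOn ℝ ∞ α U) (hη : ContDiffOn ℝ ∞ η U) {y : E n} (hy : y ∈ U) :
    hodgeLaplacian p (α + η) y = hodgeLaplacian p α y + hodgeLaplacian p η y := by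
  have D : ∀ {q : ℕ} {f : E n → E n [⋀^Fin q]→L[ℝ] ℝ}, ContDiffOn ℝ ∞ f U → ∀ z ∈ U,
      DifferentiableAt ℝ f z := fun h z hz =>
    (h.differentiableOn (by simp)).differentiableAt (hU.mem_nhds hz)
  have e1 : extDeriv (α + η) =ᶠ[𝓝 y] extDeriv α + extDeriv η := by
    filter_upwards [hU.mem_nhds hy] with z hz
    exact extDeriv_add (D hα z hz) (D hη z hz)
  have e2 : codiff (extDeriv (α + η)) y = codiff (extDeriv α) y + codiff (extDeriv η) y := by
    rw [codiff_congr e1]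
    exact codiff_add (D (contDiffOn_extDeriv hU hα) y hy) (D (contDiffOn_extDeriv hU hη) y hy)
  cases p with
  | zero => exact e2
  | succ p =>
    have e3 : codiff (α + η) =ᶠ[𝓝 y] codiff α + codiff η := by
      filter_upwards [hU.mem_nhds hy] with z hz
      exact codiff_add (D hα z hz) (D hη z hz)
    have e4 : extDeriv (codiff (α + η)) y = extDeriv (codiff α) y + extDeriv (codiff η) y := by
      rw [e3.extDeriv_eq]
      exact extDeriv_add (D (contDiffOn_codiff hU hα) y hy) (D (contDiffOn_codiff hU hη) y hy)
    simp only [hodgeLaplacian, e2, e4]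
    abel

theorem hodgeLaplacian_smul {p : ℕ} (c : ℝ) (α : E n → E n [⋀^Fin p]→L[ℝ] ℝ) (y : E n) :
    hodgeLaplacian p (c • α) y = c • hodgeLaplacian p α y := by
  have e1 : extDeriv (c • α) = c • extDeriv α := funext fun z => extDeriv_smul c α
  cases p with
  | zero => simp only [hodgeLaplacian, e1, codiff_smul]
  | succ p =>
    have e3 : codiff (c • α) = c • codiff α := funext fun z => codiff_smul c
    simp only [hodgeLaplacian, e1, e3, codiff_smul, extDeriv_smul, smul_add]

end Euclidean

/-! ### Differential forms, Hodge Laplacian and de Rham cohomology on a flat manifold -/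

section Forms

variable (n : ℕ) (M : Type) [TopologicalSpace M] [ChartedSpace (E n) M] (p : ℕ)

/-- A (not necessarily continuous) `p`-form on `M`: an alternating `p`-linear form on each tangent
space. -/
def Form : Type := ∀ x : M, TangentSpace 𝓘(ℝ, E n) x [⋀^Fin p]→L[ℝ] ℝ

instance formAddCommGroup : AddCommGroup (Form n M p) :=
  inferInstanceAs (AddCommGroup (∀ x : M, TangentSpace 𝓘(ℝ, E n) x [⋀^Fin p]→L[ℝ] ℝ))

instance formModule : Module ℝ (Form n M p) :=
  inferInstanceAs (Module ℝ (∀ x : M, TangentSpace 𝓘(ℝ, E n) x [⋀^Fin p]→L[ℝ] ℝ))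

variable {M p}

/-- The expression of a `p`-form in a chart `e`: the pull-back of `α` by `e⁻¹` (meaningful on
`e.target`). -/
def Form.inChart (α : Form n M p) (e : OpenPartialHomeomorph M (E n)) :
    E n → E n [⋀^Fin p]→L[ℝ] ℝ := fun y =>
  (α (e.symm y)).compContinuousLinearMap (mfderiv 𝓘(ℝ, E n) 𝓘(ℝ, E n) e.symm y)

/-- The value at `x` of the pull-back by the chart at `x` of a form `η` on `ℝⁿ`. -/
def pullAt (η : E n → E n [⋀^Fin p]→L[ℝ] ℝ) (x : M) :
    TangentSpace 𝓘(ℝ, E n) x [⋀^Fin p]→L[ℝ] ℝ :=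
  ContinuousAlternatingMap.compContinuousLinearMap (M := TangentSpace 𝓘(ℝ, E n) x)
    (M' := E n) (η (chartAt (E n) x x))
    (mfderiv 𝓘(ℝ, E n) 𝓘(ℝ, E n) (chartAt (E n) x) x)

/-- The exterior derivative on `M`, computed in charts. -/
def Form.d (α : Form n M p) : Form n M (p + 1) := fun x =>
  pullAt n (extDeriv (α.inChart n (chartAt (E n) x))) x

/-- The Hodge Laplacian `dδ + δd` of the flat manifold `M`, computed in (isometric) charts. -/
def Form.laplacian (α : Form n M p) : Form n M p := fun x =>
  pullAt n (hodgeLaplacian p (α.inChart n (chartAt (E n) x))) x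

theorem inChart_add (α η : Form n M p) (e : OpenPartialHomeomorph M (E n)) :
    (α + η).inChart n e = α.inChart n e + η.inChart n e := rfl

theorem inChart_smul (c : ℝ) (α : Form n M p) (e : OpenPartialHomeomorph M (E n)) :
    (c • α).inChart n e = c • α.inChart n e := rfl

variable (M p)

/-- The space `Ω^p(M)` of smooth `p`-forms. -/
def smoothForms : Submodule ℝ (Form n M p) where
  carrier := {α | ∀ e ∈ atlas (E n) M, ContDiffOn ℝ ∞ (α.inChart n e) e.target}
  zero_mem' := fun e _ => (contDiffOn_const (c := 0)).congr fun y _ => rfl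
  add_mem' := fun {α η} hα hη e he => by
    rw [inChart_add]; exact (hα e he).add (hη e he)
  smul_mem' := fun c α hα e he => by
    rw [inChart_smul]; exact (hα e he).const_smul c

variable {M p}

theorem d_add {α η : Form n M p} (hα : α ∈ smoothForms n M p) (hη : η ∈ smoothForms n M p) :
    (α + η).d n = α.d n + η.d n := by
  funext x
  have D : ∀ {f : Form n M p}, f ∈ smoothForms n M p →
      DifferentiableAt ℝ (f.inChart n (chartAt (E n) x)) (chartAt (E n) x x) := fun hf =>
    ((hf _ (chart_mem_atlas _ x)).differentiableOn (by simp)).differentiableAt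
      ((chartAt (E n) x).open_target.mem_nhds (mem_chart_target _ x))
  simp only [Form.d, pullAt, inChart_add, extDeriv_add (D hα) (D hη)]
  rfl

theorem d_smul (c : ℝ) (α : Form n M p) : (c • α).d n = c • α.d n := by
  funext x
  simp only [Form.d, pullAt, inChart_smul, extDeriv_smul]
  rfl

theorem laplacian_add {α η : Form n M p} (hα : α ∈ smoothForms n M p)
    (hη : η ∈ smoothForms n M p) : (α + η).laplacian n = α.laplacian n + η.laplacian n := by
  funext x
  simp only [Form.laplacian, pullAt, inChart_add,
    hodgeLaplacian_add (chartAt (E n) x).open_target (hα _ (chart_mem_atlas _ x))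
      (hη _ (chart_mem_atlas _ x)) (mem_chart_target _ x)]
  rfl

theorem laplacian_smul (c : ℝ) (α : Form n M p) : (c • α).laplacian n = c • α.laplacian n := by
  funext x
  simp only [Form.laplacian, pullAt, inChart_smul, hodgeLaplacian_smul]
  rfl

variable (M p)

/-- The space of smooth `p`-forms `α` on `M` with `Δα = lam • α`. -/
def eigenforms (lam : ℝ) : Submodule ℝ (Form n M p) where
  carrier := {α | α ∈ smoothForms n M p ∧ α.laplacian n = lam • α}
  zero_mem' := by
    refine ⟨zero_mem _, ?_⟩
    simpa using laplacian_smul n (0 : ℝ) (0 : Form n M p)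
  add_mem' := fun {α η} hα hη => by
    refine ⟨add_mem hα.1 hη.1, ?_⟩
    rw [laplacian_add n hα.1 hη.1, hα.2, hη.2, smul_add]
  smul_mem' := fun c α hα => by
    refine ⟨Submodule.smul_mem _ c hα.1, ?_⟩
    rw [laplacian_smul, hα.2, smul_comm]

/-- The `p`-spectrum of `M`: the function sending a real number to its multiplicity (possibly zero)
as an eigenvalue of the Hodge Laplacian on smooth `p`-forms. -/
def pSpectrum (lam : ℝ) : Cardinal := Module.rank ℝ (eigenforms n M p lam)

/-- The closed smooth `p`-forms on `M`. -/
def closedForms : Submodule ℝ (Form n M p) where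
  carrier := {α | α ∈ smoothForms n M p ∧ α.d n = 0}
  zero_mem' := by
    refine ⟨zero_mem _, ?_⟩
    simpa using d_smul n (0 : ℝ) (0 : Form n M p)
  add_mem' := fun {α η} hα hη => by
    refine ⟨add_mem hα.1 hη.1, ?_⟩
    rw [d_add n hα.1 hη.1, hα.2, hη.2, add_zero]
  smul_mem' := fun c α hα => by
    refine ⟨Submodule.smul_mem _ c hα.1, ?_⟩
    rw [d_smul, hα.2, smul_zero]

/-- The exact `p`-forms on `M`: the forms `dη` with `η` a smooth `(p - 1)`-form. -/
def exactForms : (p : ℕ) → Submodule ℝ (Form n M p)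
  | 0 => ⊥
  | p + 1 =>
    { carrier := {α | ∃ η ∈ smoothForms n M p, η.d n = α}
      zero_mem' := ⟨0, zero_mem _, by simpa using d_smul n (0 : ℝ) (0 : Form n M p)⟩
      add_mem' := by
        rintro _ _ ⟨η, hη, rfl⟩ ⟨η', hη', rfl⟩
        exact ⟨η + η', add_mem hη hη', d_add n hη hη'⟩
      smul_mem' := by
        rintro c _ ⟨η, hη, rfl⟩
        exact ⟨c • η, Submodule.smul_mem _ c hη, d_smul n c η⟩ }

/-- The de Rham cohomology of `M` in degree `p`: closed smooth `p`-forms modulo exact ones. -/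
abbrev DeRham : Type := closedForms n M p ⧸ (exactForms n M p).submoduleOf (closedForms n M p)

/-- The `p`-th Betti number of `M`: the dimension of the real de Rham cohomology. -/
def bettiNumber : Cardinal := Module.rank ℝ (DeRham n M p)

end Forms

/-- Two flat `n`-manifolds are `p`-isospectral if they have the same `p`-spectrum. -/
def PIsospectral (n p : ℕ) (M M' : Type) [TopologicalSpace M] [ChartedSpace (E n) M]
    [TopologicalSpace M'] [ChartedSpace (E n) M'] : Prop :=
  pSpectrum n M p = pSpectrum n M' p

/-- The first singular homology group `H₁(X, ℤ)`. -/
abbrev H1 (X : Type) [TopologicalSpace X] : Type :=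
  ((AlgebraicTopology.singularHomologyFunctor (ModuleCat.{0} ℤ) 1).obj (ModuleCat.of ℤ ℤ)).obj
    (TopCat.of X)

/-! ### The two groups -/

/-- The diagonal matrix with entries `-1` at the indices in `S` and `1` elsewhere. -/
def diagSign {n : ℕ} (S : Finset (Fin n)) : E n ≃ₗᵢ[ℝ] E n :=
  LinearIsometryEquiv.piLpCongrRight 2 fun i =>
    if i ∈ S then LinearIsometryEquiv.neg ℝ else LinearIsometryEquiv.refl ℝ ℝ

/-- The isometry `B L_b : x ↦ B (x + b)`. -/
def affineIsom {n : ℕ} (B : E n ≃ₗᵢ[ℝ] E n) (b : E n) : Isom n :=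
  (AffineIsometryEquiv.constVAdd ℝ (E n) b).trans B.toAffineIsometryEquiv

theorem affineIsom_apply {n : ℕ} (B : E n ≃ₗᵢ[ℝ] E n) (b x : E n) :
    affineIsom B b x = B (x + b) := by
  change B (b + x) = _
  rw [add_comm]

/-- The translations `L_v` with `v ∈ ℤⁿ`. -/
def integerTranslations (n : ℕ) : Set (Isom n) :=
  range fun k : Fin n → ℤ => AffineIsometryEquiv.constVAdd ℝ (E n) (WithLp.toLp 2 fun i => (k i : ℝ))

/-- `B₁ = diag(1, 1, -1, -1)`. -/
def B₁ : E 4 ≃ₗᵢ[ℝ] E 4 := diagSign {2, 3}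

/-- `B₂ = diag(1, -1, 1, -1)`. -/
def B₂ : E 4 ≃ₗᵢ[ℝ] E 4 := diagSign {1, 3}

/-- `Γ = ⟨B₁ L_{b₁}, B₂ L_{b₂}, ℤ⁴⟩` with `b₁ = (e₂ + e₄)/2` and `b₂ = e₃/2`. -/
def Γ₁ : Subgroup (Isom 4) :=
  Subgroup.closure ({affineIsom B₁ !₂[0, 1/2, 0, 1/2], affineIsom B₂ !₂[0, 0, 1/2, 0]}
    ∪ integerTranslations 4)

/-- `Γ' = ⟨B₁ L_{b₁'}, B₂ L_{b₂'}, ℤ⁴⟩` with `b₁' = e₂/2` and `b₂' = e₁/2`. -/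
def Γ₂ : Subgroup (Isom 4) :=
  Subgroup.closure ({affineIsom B₁ !₂[0, 1/2, 0, 0], affineIsom B₂ !₂[1/2, 0, 0, 0]}
    ∪ integerTranslations 4)

end FlatMfd

end

open FlatMfd

/-! Everything is lifted to the universal covering. The inverse charts of `Γ \ ℝⁿ` are the
projection itself, and a chart composed with the projection is locally an element of `Γ`. Hence
forms on the quotient are the `Γ`-invariant forms on `ℝⁿ`, parallel fields are projections of
constant vectors along lifted curves, and the holonomy group is the group of linear parts
(`holonomyGroup_eq_range`).

Every element of either group has the form `x ↦ Dx + w/2` with `w` integral and `D` diagonal with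
entries `±1`; the parities of two entries of `w` determine `D`. So `w` determines the element,
relations in the groups are finite computations with integer vectors, and torsion-freeness is a
parity check: an element of finite order must have `w i = 0` in each unreflected coordinate.

Isospectrality. On flat space the Hodge Laplacian acts coefficientwise (`hodgeLaplacian_eq`). The
lattice-periodic `p`-eigenforms for a given eigenvalue form a finite-dimensional space, by Fourier
expansion. On it the generators act as commuting involutions, and the invariant eigenforms are their
common fixed space, whose dimension is the average of four traces (`rank_invEigenforms`). The traces
agree in pairs: corresponding elements of the two groups have the same linear part, and as maps of
the domain they are conjugate by a coordinate permutation followed by a translation. That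
conjugation acts on the argument of the coefficients and not on the values of the form, and it
differs from pair to pair, so it does not relate the two groups as a whole.

Homology. `H₁` is the abelianization of the group: a `1`-simplex lifts to `ℝⁿ`, its endpoints differ
by a group element relative to a chosen section, and modulo boundaries an edge in the contractible
`ℝⁿ` depends only on its endpoints (`nonempty_H1_addEquiv`). Each abelianization is found by giving
generators, relations bounding their orders, and an explicit homomorphism showing that there are no
others. An element of order `4` in `ℤ × ℤ₄²` distinguishes the results.

Betti numbers. Averaging a closed invariant form over the periods changes it by an exact invariant
form and makes it constant, while an exact constant form is zero, since its primitive can be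
averaged too (`bettiNumber_eq`). It remains to count the products of basis covectors fixed by all
sign changes. -/

noncomputable section

namespace FlatMfd

/-! ### The covering of the orbit space, its flat charts and its derivative -/

section Quotient

variable {n : ℕ} {Γ : Subgroup (Isom n)}

/-- The projection `ℝⁿ → Γ \ ℝⁿ`. -/
def proj (Γ : Subgroup (Isom n)) : E n → OrbitSpace Γ := Quotient.mk _

theorem proj_surjective : Function.Surjective (proj Γ) := Quotient.mk_surjective

theorem continuous_proj : Continuous (proj Γ) := continuous_quotient_mk'

theorem proj_eq_proj_iff {x y : E n} : proj Γ x = proj Γ y ↔ ∃ γ ∈ Γ, γ y = x := by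
  refine Quotient.eq''.trans ⟨?_, ?_⟩
  · rintro ⟨γ, h⟩
    exact ⟨γ, γ.2, h⟩
  · rintro ⟨γ, hγ, h⟩
    exact ⟨⟨γ, hγ⟩, h⟩

theorem proj_apply {γ : Isom n} (hγ : γ ∈ Γ) (x : E n) : proj Γ (γ x) = proj Γ x :=
  proj_eq_proj_iff.2 ⟨γ, hγ, rfl⟩

variable [hΓ : IsBieberbach Γ]

theorem isQuotientCoveringMap_proj : IsQuotientCoveringMap (proj Γ) Γ :=
  isQuotientCoveringMap_quotientMk_of_properlyDiscontinuousSMul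

theorem isCoveringMap_proj : IsCoveringMap (proj Γ) :=
  isQuotientCoveringMap_proj.isCoveringMap

/-- Charts are local inverses of the covering, and their inverses are the projection as total
functions. Later chart expressions therefore need no restriction to the target. -/
theorem coe_symm_of_mem_atlas {e : OpenPartialHomeomorph (OrbitSpace Γ) (E n)}
    (he : e ∈ atlas (E n) (OrbitSpace Γ)) : ⇑e.symm = proj Γ := by
  obtain ⟨q, rfl⟩ := he
  rw [chartAt_self_eq, OpenPartialHomeomorph.trans_refl]
  exact (isCoveringMap_proj (Γ := Γ)).isLocalHomeomorph.localInverseAt_symm _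

theorem proj_apply_of_mem_source {e : OpenPartialHomeomorph (OrbitSpace Γ) (E n)}
    (he : e ∈ atlas (E n) (OrbitSpace Γ)) {m : OrbitSpace Γ} (hm : m ∈ e.source) :
    proj Γ (e m) = m := by
  rw [← coe_symm_of_mem_atlas he, e.left_inv hm]

/-- In every chart, the projection is locally given by an element of the group. -/
theorem exists_chart_comp_proj {e : OpenPartialHomeomorph (OrbitSpace Γ) (E n)}
    (he : e ∈ atlas (E n) (OrbitSpace Γ)) {x : E n} (hx : proj Γ x ∈ e.source) :
    ∃ γ ∈ Γ, (fun z => e (proj Γ z)) =ᶠ[𝓝 x] γ := by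
  -- The points `e (proj x)` and `x` lie in one orbit; the element relating them is the local
  -- expression.
  obtain ⟨γ, hγ, h⟩ := proj_eq_proj_iff.1 (proj_apply_of_mem_source he hx)
  refine ⟨γ, hγ, ?_⟩
  have h1 : ∀ᶠ z in 𝓝 x, γ z ∈ e.target := by
    refine γ.continuous.continuousAt.eventually (e.open_target.mem_nhds ?_)
    rw [h]
    exact e.map_source hx
  filter_upwards [h1] with z hz
  rw [← proj_apply hγ, ← coe_symm_of_mem_atlas he, e.right_inv hz]

theorem isCompactFlatManifold_orbitSpace : IsCompactFlatManifold n (OrbitSpace Γ) where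
  compact := hΓ.cocompact
  connected := proj_surjective.connectedSpace continuous_proj
  hausdorff := inferInstance
  secondCountable := ContinuousConstSMul.secondCountableTopology
  flat := by
    intro e he e' he' y hy
    rw [OpenPartialHomeomorph.trans_source, mem_inter_iff, mem_preimage,
      coe_symm_of_mem_atlas he] at hy
    obtain ⟨γ, -, h⟩ := exists_chart_comp_proj he' hy.2
    refine ⟨γ, ?_⟩
    rw [OpenPartialHomeomorph.coe_trans, coe_symm_of_mem_atlas he]
    exact h

/-! ### The derivative of the projection -/

/-- The linear part of an isometry. -/
def lin (γ : Isom n) : E n ≃L[ℝ] E n := γ.linearIsometryEquiv.toContinuousLinearEquiv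

omit hΓ in
theorem hasFDerivAt_isom (γ : Isom n) (x : E n) : HasFDerivAt γ (lin γ : E n →L[ℝ] E n) x := by
  have h : ⇑γ = fun z => lin γ z + γ 0 := by
    funext z
    have := γ.map_vadd 0 z
    simpa [lin] using this
  rw [h]
  exact ((lin γ).hasFDerivAt).add_const _

theorem mdifferentiableAt_proj (x : E n) :
    MDifferentiableAt 𝓘(ℝ, E n) 𝓘(ℝ, E n) (proj Γ) x := by
  obtain ⟨γ, -, h⟩ := exists_chart_comp_proj (chart_mem_atlas (E n) (proj Γ x))
    (mem_chart_source (E n) (proj Γ x))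
  rw [mdifferentiableAt_iff]
  refine ⟨continuous_proj.continuousAt, ?_⟩
  simp only [writtenInExtChartAt, extChartAt, mfld_simps, Function.comp_def]
  rw [differentiableWithinAt_univ]
  exact ((hasFDerivAt_isom γ x).congr_of_eventuallyEq h).differentiableAt

theorem mdifferentiableAt_chart {e : OpenPartialHomeomorph (OrbitSpace Γ) (E n)}
    (he : e ∈ atlas (E n) (OrbitSpace Γ)) {m : OrbitSpace Γ} (hm : m ∈ e.source) :
    MDifferentiableAt 𝓘(ℝ, E n) 𝓘(ℝ, E n) e m := by
  have hx : proj Γ (chartAt (E n) m m) = m :=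
    proj_apply_of_mem_source (chart_mem_atlas _ m) (mem_chart_source _ m)
  obtain ⟨γ, -, h⟩ := exists_chart_comp_proj he (x := chartAt (E n) m m) (by rwa [hx])
  rw [mdifferentiableAt_iff]
  refine ⟨e.continuousAt hm, ?_⟩
  simp only [writtenInExtChartAt, extChartAt, mfld_simps, Function.comp_def]
  rw [differentiableWithinAt_univ, coe_symm_of_mem_atlas (chart_mem_atlas _ m)]
  exact ((hasFDerivAt_isom γ _).congr_of_eventuallyEq h).differentiableAt

/-- The derivative of the projection. -/
def dproj (Γ : Subgroup (Isom n)) [IsBieberbach Γ] (x : E n) :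
    E n →L[ℝ] TangentSpace 𝓘(ℝ, E n) (proj Γ x) :=
  mfderiv 𝓘(ℝ, E n) 𝓘(ℝ, E n) (proj Γ) x

theorem mfderiv_chart_dproj {e : OpenPartialHomeomorph (OrbitSpace Γ) (E n)}
    (he : e ∈ atlas (E n) (OrbitSpace Γ)) {x : E n} (hx : proj Γ x ∈ e.source) {γ : Isom n}
    (hγ : (fun z => e (proj Γ z)) =ᶠ[𝓝 x] γ) (v : E n) :
    mfderiv 𝓘(ℝ, E n) 𝓘(ℝ, E n) e (proj Γ x) (dproj Γ x v) = lin γ v := by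
  have h := mfderiv_comp x (mdifferentiableAt_chart he hx) (mdifferentiableAt_proj x)
  rw [mfderiv_eq_fderiv] at h
  have h2 : fderiv ℝ (e ∘ proj Γ) x = lin γ :=
    ((hasFDerivAt_isom γ x).congr_of_eventuallyEq hγ).fderiv
  rw [h2] at h
  exact (DFunLike.congr_fun h v).symm

/-- The chain rule for `proj ∘ γ = proj`. The two sides belong to tangent spaces at points that are
equal only propositionally, so they are compared in the model space `E n`. -/
theorem dproj_lin {γ : Isom n} (hγ : γ ∈ Γ) (x v : E n) :
    (dproj Γ (γ x) (lin γ v) : E n) = dproj Γ x v := by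
  have hf := (hasFDerivAt_isom γ x)
  have h := mfderiv_comp x (mdifferentiableAt_proj (Γ := Γ) (γ x))
    hf.hasMFDerivAt.mdifferentiableAt
  have h1 : proj Γ ∘ γ = proj Γ := funext fun z => proj_apply hγ z
  rw [h1, mfderiv_eq_fderiv, hf.fderiv] at h
  exact (DFunLike.congr_fun h v).symm

theorem dproj_injective (x : E n) : Function.Injective (dproj Γ x) := by
  obtain ⟨γ, -, h⟩ := exists_chart_comp_proj (chart_mem_atlas (E n) (proj Γ x))
    (mem_chart_source (E n) (proj Γ x))
  intro v w hvw
  apply (lin γ).injective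
  rw [← mfderiv_chart_dproj (chart_mem_atlas _ _) (mem_chart_source _ _) h, hvw,
    mfderiv_chart_dproj (chart_mem_atlas _ _) (mem_chart_source _ _) h]

/-- The derivative of the projection, as a linear isomorphism. -/
def dprojEquiv (Γ : Subgroup (Isom n)) [IsBieberbach Γ] (x : E n) :
    E n ≃L[ℝ] TangentSpace 𝓘(ℝ, E n) (proj Γ x) :=
  let f : E n →ₗ[ℝ] E n := (show E n →L[ℝ] E n from dproj Γ x).toLinearMap
  (LinearEquiv.ofInjectiveEndo f (dproj_injective x)).toContinuousLinearEquiv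

end Quotient

/-! ### The Hodge Laplacian on flat space acts on coefficients -/

section Euclidean

variable {n p : ℕ} {F G : Type*} [NormedAddCommGroup F] [NormedSpace ℝ F]
  [NormedAddCommGroup G] [NormedSpace ℝ G]

/-- The `i`-th canonical basis vector. -/
def basisVec (i : Fin n) : E n := EuclideanSpace.single i 1

/-- The `i`-th partial derivative. -/
def pderiv (i : Fin n) (f : E n → F) : E n → F := fun x => fderiv ℝ f x (basisVec i)

/-- The sum of the second pure partial derivatives. -/
def coordLaplacian (f : E n → F) : E n → F := fun x => ∑ i, pderiv i (pderiv i f) x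

theorem contDiff_pderiv {f : E n → F} (hf : ContDiff ℝ ∞ f) (i : Fin n) :
    ContDiff ℝ ∞ (pderiv i f) :=
  (hf.fderiv_right (m := ∞) (by simp)).clm_apply contDiff_const

theorem ContDiff.differentiableAt_infty {f : G → F} (hf : ContDiff ℝ ∞ f) (x : G) :
    DifferentiableAt ℝ f x :=
  (hf.differentiable (by simp)) x

theorem two_le_infty : (2 : WithTop ℕ∞) ≤ ∞ := by
  exact WithTop.coe_le_coe.2 (le_top (a := (2 : ℕ∞)))

theorem hasFDerivAt_clm_comp {H : Type*} [NormedAddCommGroup H] [NormedSpace ℝ H] (L : F →L[ℝ] G)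
    {f : H → F} {f' : H →L[ℝ] F} {x : H} (h : HasFDerivAt f f' x) :
    HasFDerivAt (fun z => L (f z)) (L.comp f') x :=
  L.hasFDerivAt.comp x h

theorem pderiv_clm_comp (L : F →L[ℝ] G) {f : E n → F} (hf : ContDiff ℝ ∞ f) (i : Fin n) :
    pderiv i (fun x => L (f x)) = fun x => L (pderiv i f x) := by
  funext x
  have := (L.hasFDerivAt.comp x (hf.differentiableAt_infty x).hasFDerivAt).fderiv
  simp only [pderiv]
  rw [show (fun x => L (f x)) = L ∘ f from rfl, this]
  rfl

theorem coordLaplacian_clm_comp (L : F →L[ℝ] G) {f : E n → F} (hf : ContDiff ℝ ∞ f) :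
    coordLaplacian (fun x => L (f x)) = fun x => L (coordLaplacian f x) := by
  funext x
  simp only [coordLaplacian, map_sum, pderiv_clm_comp L hf,
    pderiv_clm_comp L (contDiff_pderiv hf _)]

theorem pderiv_add {f g : E n → F} (hf : ContDiff ℝ ∞ f) (hg : ContDiff ℝ ∞ g) (i : Fin n) :
    pderiv i (f + g) = pderiv i f + pderiv i g := by
  funext x
  simp [pderiv, fderiv_add (hf.differentiableAt_infty x) (hg.differentiableAt_infty x)]

theorem pderiv_smul (c : ℝ) {f : E n → F} (hf : ContDiff ℝ ∞ f) (i : Fin n) :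
    pderiv i (c • f) = c • pderiv i f := by
  funext x
  simp [pderiv, fderiv_const_smul (hf.differentiableAt_infty x)]

theorem coordLaplacian_add {f g : E n → F} (hf : ContDiff ℝ ∞ f) (hg : ContDiff ℝ ∞ g) :
    coordLaplacian (f + g) = coordLaplacian f + coordLaplacian g := by
  funext x
  simp [coordLaplacian, pderiv_add hf hg, pderiv_add (contDiff_pderiv hf _) (contDiff_pderiv hg _),
    Finset.sum_add_distrib]

theorem coordLaplacian_smul (c : ℝ) {f : E n → F} (hf : ContDiff ℝ ∞ f) :
    coordLaplacian (c • f) = c • coordLaplacian f := by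
  funext x
  simp [coordLaplacian, pderiv_smul c hf, pderiv_smul c (contDiff_pderiv hf _), Finset.smul_sum]

/-- The contraction of an alternating map with a vector. -/
def contract (e : E n) : (E n [⋀^Fin (p + 1)]→L[ℝ] ℝ) →L[ℝ] E n [⋀^Fin p]→L[ℝ] ℝ :=
  LinearMap.mkContinuous
    { toFun := fun f => f.curryLeft e
      map_add' := fun _ _ => rfl
      map_smul' := fun _ _ => rfl } ‖e‖ fun f => by
    rw [mul_comm, ← f.norm_curryLeft]
    exact f.curryLeft.le_opNorm e

theorem contract_apply (e : E n) (f : E n [⋀^Fin (p + 1)]→L[ℝ] ℝ) (v : Fin p → E n) :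
    contract e f v = f (Matrix.vecCons e v) := rfl

open ContinuousAlternatingMap in
/-- The algebraic form of Cartan's formula for constant vector fields. -/
theorem contract_alternatizeUncurryFin (e : E n) (f : E n →L[ℝ] E n [⋀^Fin (p + 1)]→L[ℝ] ℝ) :
    contract e (alternatizeUncurryFin f) = f e - alternatizeUncurryFin ((contract e).comp f) := by
  ext v
  rw [contract_apply, alternatizeUncurryFin_apply, Fin.sum_univ_succ,
    ContinuousAlternatingMap.sub_apply, alternatizeUncurryFin_apply, sub_eq_add_neg,
    ← Finset.sum_neg_distrib]
  -- Summand `0` feeds `e` to `f`. In every later summand the index is shifted by one, which costs a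
  -- sign, and `e` stays in the first slot.
  congr 1
  · simp
  · refine Finset.sum_congr rfl fun i _ => ?_
    simp only [Fin.val_succ, pow_succ, mul_neg, mul_one, neg_smul, Matrix.cons_val_succ,
      ContinuousLinearMap.comp_apply, contract_apply]
    congr 3
    funext j
    refine Fin.cases ?_ (fun j => ?_) j <;> simp [Fin.removeNth]

open ContinuousAlternatingMap in
theorem contract_alternatizeUncurryFin_zero (e : E n) (f : E n →L[ℝ] E n [⋀^Fin 0]→L[ℝ] ℝ) :
    contract e (alternatizeUncurryFin f) = f e := by
  ext v
  rw [contract_apply, alternatizeUncurryFin_apply]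
  simp

theorem codiff_eq {α : E n → E n [⋀^Fin (p + 1)]→L[ℝ] ℝ} (y : E n) :
    codiff α y = -∑ i, contract (basisVec i) (fderiv ℝ α y (basisVec i)) := rfl

open ContinuousAlternatingMap in
theorem fderiv_extDeriv {α : E n → E n [⋀^Fin p]→L[ℝ] ℝ} (hα : ContDiff ℝ ∞ α) (y v : E n) :
    fderiv ℝ (extDeriv α) y v = alternatizeUncurryFin (fderiv ℝ (fderiv ℝ α) y v) := by
  have h : DifferentiableAt ℝ (fderiv ℝ α) y :=
    (hα.fderiv_right (m := ∞) (by simp)).differentiableAt_infty y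
  have := (hasFDerivAt_clm_comp (F := E n →L[ℝ] E n [⋀^Fin p]→L[ℝ] ℝ)
    (alternatizeUncurryFinCLM ℝ (E n) ℝ) h.hasFDerivAt).fderiv
  rw [show extDeriv α = fun y => alternatizeUncurryFinCLM ℝ (E n) ℝ (fderiv ℝ α y) from rfl, this]
  rfl

theorem fderiv_codiff {α : E n → E n [⋀^Fin (p + 1)]→L[ℝ] ℝ} (hα : ContDiff ℝ ∞ α) (y v : E n) :
    fderiv ℝ (codiff α) y v
      = -∑ i, contract (basisVec i) (fderiv ℝ (fderiv ℝ α) y v (basisVec i)) := by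
  have h : DifferentiableAt ℝ (fderiv ℝ α) y :=
    (hα.fderiv_right (m := ∞) (by simp)).differentiableAt_infty y
  have h1 : HasFDerivAt (codiff α) (-∑ i : Fin n, (contract (basisVec i)).comp
      (((ContinuousLinearMap.apply ℝ _ (basisVec i))).comp (fderiv ℝ (fderiv ℝ α) y))) y := by
    refine HasFDerivAt.fun_neg (HasFDerivAt.fun_sum fun i _ => ?_)
    exact hasFDerivAt_clm_comp (contract (basisVec i)) (hasFDerivAt_clm_comp
      (F := E n →L[ℝ] E n [⋀^Fin (p + 1)]→L[ℝ] ℝ)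
      (ContinuousLinearMap.apply ℝ (E n [⋀^Fin (p + 1)]→L[ℝ] ℝ) (basisVec i)) h.hasFDerivAt)
  rw [h1.fderiv]
  simp

theorem fderiv_fderiv_basisVec {f : E n → F} (hf : ContDiff ℝ ∞ f) (y : E n) (i : Fin n) (v : E n) :
    fderiv ℝ (fderiv ℝ f) y v (basisVec i) = fderiv ℝ (pderiv i f) y v := by
  have h : DifferentiableAt ℝ (fderiv ℝ f) y :=
    (hf.fderiv_right (m := ∞) (by simp)).differentiableAt_infty y
  have := ((ContinuousLinearMap.apply ℝ _ (basisVec i)).hasFDerivAt.comp y h.hasFDerivAt).fderiv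
  rw [show pderiv i f = ContinuousLinearMap.apply ℝ _ (basisVec i) ∘ fderiv ℝ f from rfl, this]
  rfl

open ContinuousAlternatingMap in
/-- On flat space, the Hodge Laplacian acts on the coefficients of a form. -/
theorem hodgeLaplacian_eq {α : E n → E n [⋀^Fin p]→L[ℝ] ℝ} (hα : ContDiff ℝ ∞ α) :
    hodgeLaplacian p α = -coordLaplacian α := by
  -- `fderiv_codiff` produces the second derivative in the order `(v, e_i)`, whereas `d` of the
  -- contraction of `∂_i α` needs the order `(e_i, v)`.
  have hsymm : ∀ y u v, fderiv ℝ (fderiv ℝ α) y u v = fderiv ℝ (fderiv ℝ α) y v u := fun y u v =>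
    (hα.contDiffAt.isSymmSndFDerivAt (by simpa using two_le_infty)) u v
  funext y
  have hL : (-coordLaplacian α) y
      = -∑ i, fderiv ℝ (fderiv ℝ α) y (basisVec i) (basisVec i) := by
    simp only [Pi.neg_apply, coordLaplacian, fderiv_fderiv_basisVec hα]
    rfl
  rw [hL]
  cases p with
  | zero =>
    simp only [hodgeLaplacian, codiff_eq, fderiv_extDeriv hα,
      contract_alternatizeUncurryFin_zero]
  | succ p =>
    have h1 : extDeriv (codiff α) y = -∑ i, alternatizeUncurryFin
        ((contract (basisVec i)).comp (fderiv ℝ (fderiv ℝ α) y (basisVec i))) := by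
      have : fderiv ℝ (codiff α) y = -∑ i, (contract (basisVec i)).comp
          (fderiv ℝ (fderiv ℝ α) y (basisVec i)) := by
        ext1 v
        rw [fderiv_codiff hα]
        simp [hsymm y v]
      rw [extDeriv, this]
      simp only [← alternatizeUncurryFinCLM_apply, map_neg, _root_.map_sum]
    -- By Cartan, contracting `d ∂_i α` with `e_i` gives `∂_i ∂_i α` minus `d` of the contraction;
    -- the latter terms cancel against `dδα`.
    simp only [hodgeLaplacian, h1, codiff_eq, fderiv_extDeriv hα, contract_alternatizeUncurryFin,
      Finset.sum_sub_distrib]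
    abel

end Euclidean

/-! ### Forms on the quotient as invariant forms on `ℝⁿ` -/

section Pullback

variable {n p : ℕ} {F : Type*} [NormedAddCommGroup F] [NormedSpace ℝ F]

/-- Pull-back of alternating maps by a fixed linear map. -/
def altPull (L : E n →L[ℝ] E n) : (E n [⋀^Fin p]→L[ℝ] ℝ) →L[ℝ] E n [⋀^Fin p]→L[ℝ] ℝ :=
  ContinuousAlternatingMap.compContinuousLinearMapCLM L

/-- Pull-back of forms on `ℝⁿ` by an isometry. -/
def pullIsom (γ : Isom n) (η : E n → E n [⋀^Fin p]→L[ℝ] ℝ) : E n → E n [⋀^Fin p]→L[ℝ] ℝ :=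
  fun x => altPull (lin γ) (η (γ x))

/-- The linear part of the isometry is diagonal with entries `±1`. -/
def IsSignDiag (γ : Isom n) : Prop :=
  ∀ i, ∃ ε : ℝ, ε * ε = 1 ∧ lin γ (basisVec i) = ε • basisVec i

theorem contDiff_isom (γ : Isom n) : ContDiff ℝ ∞ γ := by
  have h : ⇑γ = fun z => lin γ z + γ 0 := by
    funext z
    have := γ.map_vadd 0 z
    simpa [lin] using this
  rw [h]
  exact (lin γ).contDiff.add contDiff_const

theorem pderiv_comp_isom {γ : Isom n} {i : Fin n} {ε : ℝ}
    (h : lin γ (basisVec i) = ε • basisVec i) {f : E n → F} (hf : ContDiff ℝ ∞ f) :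
    pderiv i (fun x => f (γ x)) = ε • (pderiv i f ∘ γ) := by
  funext x
  have := ((hf.differentiableAt_infty (γ x)).hasFDerivAt.comp x (hasFDerivAt_isom γ x)).fderiv
  simp only [pderiv, Pi.smul_apply, Function.comp_apply]
  rw [show (fun x => f (γ x)) = f ∘ γ from rfl, this, ContinuousLinearMap.comp_apply]
  change (fderiv ℝ f (γ x)) (lin γ (basisVec i)) = _
  rw [h, map_smul]

/-- Each sign enters twice in a pure second derivative and squares to `1`. -/
theorem coordLaplacian_comp_isom {γ : Isom n} (h : IsSignDiag γ) {f : E n → F}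
    (hf : ContDiff ℝ ∞ f) :
    coordLaplacian (fun x => f (γ x)) = fun x => coordLaplacian f (γ x) := by
  funext x
  refine Finset.sum_congr rfl fun i _ => ?_
  obtain ⟨ε, hε, h1⟩ := h i
  have h2 := contDiff_pderiv hf i
  rw [pderiv_comp_isom h1 hf, pderiv_smul ε (h2.comp (contDiff_isom γ)),
    show pderiv i f ∘ γ = fun x => pderiv i f (γ x) from rfl, pderiv_comp_isom h1 h2, smul_smul,
    hε, one_smul]
  rfl

theorem coordLaplacian_pullIsom {γ : Isom n} (h : IsSignDiag γ)
    {η : E n → E n [⋀^Fin p]→L[ℝ] ℝ} (hη : ContDiff ℝ ∞ η) :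
    coordLaplacian (pullIsom γ η) = pullIsom γ (coordLaplacian η) := by
  have h1 := coordLaplacian_clm_comp (altPull (lin γ : E n →L[ℝ] E n)) (hη.comp (contDiff_isom γ))
  have h2 := coordLaplacian_comp_isom h hη
  funext x
  exact (congrFun h1 x).trans (congrArg (altPull (lin γ : E n →L[ℝ] E n)) (congrFun h2 x))

theorem extDeriv_pullIsom (γ : Isom n) {η : E n → E n [⋀^Fin p]→L[ℝ] ℝ} (hη : ContDiff ℝ ∞ η) :
    extDeriv (pullIsom γ η) = pullIsom γ (extDeriv η) := by
  funext x
  have h := extDeriv_pullback (𝕜 := ℝ) (r := ∞) (x := x) (f := γ)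
    (hη.differentiableAt_infty _) (contDiff_isom γ).contDiffAt (by simpa using two_le_infty)
  simp only [(hasFDerivAt_isom γ _).fderiv] at h
  exact h

theorem contDiff_extDeriv {η : E n → E n [⋀^Fin p]→L[ℝ] ℝ} (hη : ContDiff ℝ ∞ η) :
    ContDiff ℝ ∞ (extDeriv η) := by
  rw [← contDiffOn_univ] at hη ⊢
  exact contDiffOn_extDeriv isOpen_univ hη

/-- The smooth `Γ`-invariant forms on `ℝⁿ`. -/
def invForms (Γ : Subgroup (Isom n)) (p : ℕ) : Submodule ℝ (E n → E n [⋀^Fin p]→L[ℝ] ℝ) where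
  carrier := {η | ContDiff ℝ ∞ η ∧ ∀ γ ∈ Γ, pullIsom γ η = η}
  zero_mem' := ⟨contDiff_const, fun γ _ => funext fun x => map_zero (altPull (lin γ : E n →L[ℝ] E n))⟩
  add_mem' := fun {a b} ha hb => ⟨ha.1.add hb.1, fun γ hγ => by
    have h1 := ha.2 γ hγ
    have h2 := hb.2 γ hγ
    conv_rhs => rw [← h1, ← h2]
    exact funext fun x => map_add (altPull (lin γ : E n →L[ℝ] E n)) _ _⟩
  smul_mem' := fun c a ha => ⟨ha.1.const_smul c, fun γ hγ => by
    conv_rhs => rw [← ha.2 γ hγ]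
    exact funext fun x => map_smul (altPull (lin γ : E n →L[ℝ] E n)) _ _⟩

/-- The smooth `Γ`-invariant forms on `ℝⁿ` that are eigenforms of the Laplacian. -/
def invEigenforms (Γ : Subgroup (Isom n)) (p : ℕ) (lam : ℝ) :
    Submodule ℝ (E n → E n [⋀^Fin p]→L[ℝ] ℝ) where
  carrier := {η | η ∈ invForms Γ p ∧ -coordLaplacian η = lam • η}
  zero_mem' := ⟨zero_mem _, by
    have := coordLaplacian_smul (0 : ℝ) (f := (0 : E n → E n [⋀^Fin p]→L[ℝ] ℝ)) contDiff_const
    simpa using this⟩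
  add_mem' := fun {a b} ha hb => ⟨add_mem ha.1 hb.1, by
    rw [coordLaplacian_add ha.1.1 hb.1.1, neg_add, ha.2, hb.2, smul_add]⟩
  smul_mem' := fun c a ha => ⟨Submodule.smul_mem _ c ha.1, by
    rw [coordLaplacian_smul c ha.1.1, smul_comm lam c a, ← ha.2]
    exact (smul_neg c _).symm⟩

variable {Γ : Subgroup (Isom n)} [IsBieberbach Γ]

/-- The pull-back of forms on `Γ \ ℝⁿ` to `ℝⁿ`. -/
def pullForm (Γ : Subgroup (Isom n)) [IsBieberbach Γ] (p : ℕ) : Form n (OrbitSpace Γ) p →ₗ[ℝ] E n → E n [⋀^Fin p]→L[ℝ] ℝ where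
  toFun α := fun x => (α (proj Γ x)).compContinuousLinearMap (dproj Γ x)
  map_add' _ _ := rfl
  map_smul' _ _ := rfl

/-- Since every inverse chart is the projection, all charts give the same global expression. -/
theorem inChart_eq {e : OpenPartialHomeomorph (OrbitSpace Γ) (E n)}
    (he : e ∈ atlas (E n) (OrbitSpace Γ)) (α : Form n (OrbitSpace Γ) p) :
    α.inChart n e = pullForm Γ p α := by
  have h := coe_symm_of_mem_atlas he
  unfold Form.inChart
  rw [h]
  rfl

theorem pullForm_injective : Function.Injective (pullForm Γ p) := by
  intro α β h
  funext m
  obtain ⟨x, rfl⟩ := proj_surjective m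
  ext v
  have key : (fun i => dproj Γ x ((dprojEquiv Γ x).symm (v i))) = v :=
    funext fun i => (dprojEquiv Γ x).apply_symm_apply (v i)
  have h1 : α (proj Γ x) (fun i => dproj Γ x ((dprojEquiv Γ x).symm (v i)))
      = β (proj Γ x) (fun i => dproj Γ x ((dprojEquiv Γ x).symm (v i))) :=
    DFunLike.congr_fun (congrFun h x) fun i => (dprojEquiv Γ x).symm (v i)
  rwa [key] at h1

theorem form_congr {q : ℕ} (α : Form n (OrbitSpace Γ) q) {m m' : OrbitSpace Γ} (h : m = m')
    (v : Fin q → TangentSpace 𝓘(ℝ, E n) m) (w : Fin q → TangentSpace 𝓘(ℝ, E n) m')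
    (hvw : ∀ i, (v i : E n) = w i) : α m v = α m' w := by
  subst h
  exact congrArg (α m) (funext hvw)

theorem pullIsom_pullForm {γ : Isom n} (hγ : γ ∈ Γ) (α : Form n (OrbitSpace Γ) p) :
    pullIsom γ (pullForm Γ p α) = pullForm Γ p α := by
  funext x
  ext v
  exact form_congr α (proj_apply hγ x) _ _ fun i => dproj_lin hγ x (v i)

/-- Descent of invariant forms: a chart after the projection is locally some `γ` in the group, and
pulling back by `γ` changes nothing. -/
theorem pullForm_pullAt {η : E n → E n [⋀^Fin p]→L[ℝ] ℝ} (h : ∀ γ ∈ Γ, pullIsom γ η = η) :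
    pullForm Γ p (fun m => pullAt n η m) = η := by
  funext x
  obtain ⟨γ, hγ, h1⟩ := exists_chart_comp_proj (chart_mem_atlas (E n) (proj Γ x))
    (mem_chart_source (E n) (proj Γ x))
  ext v
  conv_rhs => rw [← h γ hγ]
  have h2 : chartAt (E n) (proj Γ x) (proj Γ x) = γ x := h1.eq_of_nhds
  change η (chartAt (E n) (proj Γ x) (proj Γ x)) _ = η (γ x) fun i => lin γ (v i)
  rw [h2]
  congr 1
  funext i
  exact mfderiv_chart_dproj (chart_mem_atlas _ _) (mem_chart_source _ _) h1 (v i)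

/-- Charts give smoothness only on their targets; invariance carries it from `γ x`, which lies in a
target, to an arbitrary `x`. -/
theorem contDiff_pullForm_iff {α : Form n (OrbitSpace Γ) p} :
    α ∈ smoothForms n (OrbitSpace Γ) p ↔ ContDiff ℝ ∞ (pullForm Γ p α) := by
  constructor
  · intro h
    rw [contDiff_iff_contDiffAt]
    intro x
    obtain ⟨γ, hγ, h1⟩ := exists_chart_comp_proj (chart_mem_atlas (E n) (proj Γ x))
      (mem_chart_source (E n) (proj Γ x))
    have h2 : chartAt (E n) (proj Γ x) (proj Γ x) = γ x := h1.eq_of_nhds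
    have h3 := h _ (chart_mem_atlas (E n) (proj Γ x))
    rw [inChart_eq (chart_mem_atlas (E n) (proj Γ x))] at h3
    have h4 : ContDiffAt ℝ ∞ (pullForm Γ p α) (γ x) := by
      refine h3.contDiffAt ((chartAt (E n) (proj Γ x)).open_target.mem_nhds ?_)
      rw [← h2]
      exact mem_chart_target _ _
    rw [← pullIsom_pullForm hγ α]
    exact (altPull (lin γ : E n →L[ℝ] E n)).contDiff.contDiffAt.comp x
      (h4.comp x (contDiff_isom γ).contDiffAt)
  · intro h e he
    rw [inChart_eq he]
    exact h.contDiffOn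

theorem map_pullForm_smoothForms :
    (smoothForms n (OrbitSpace Γ) p).map (pullForm Γ p) = invForms Γ p := by
  ext η
  constructor
  · rintro ⟨α, hα, rfl⟩
    exact ⟨contDiff_pullForm_iff.1 hα, fun γ hγ => pullIsom_pullForm hγ α⟩
  · rintro ⟨h1, h2⟩
    have h3 := pullForm_pullAt h2
    exact ⟨_, contDiff_pullForm_iff.2 (by rwa [h3]), h3⟩

theorem pullForm_mem_invForms {α : Form n (OrbitSpace Γ) p}
    (hα : α ∈ smoothForms n (OrbitSpace Γ) p) : pullForm Γ p α ∈ invForms Γ p :=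
  map_pullForm_smoothForms (Γ := Γ) ▸ Submodule.mem_map_of_mem hα

theorem exists_pullForm_eq {η : E n → E n [⋀^Fin p]→L[ℝ] ℝ} (hη : η ∈ invForms Γ p) :
    ∃ α ∈ smoothForms n (OrbitSpace Γ) p, pullForm Γ p α = η := by
  rw [← map_pullForm_smoothForms] at hη
  exact hη

theorem pullForm_d {α : Form n (OrbitSpace Γ) p} (hα : α ∈ smoothForms n (OrbitSpace Γ) p) :
    pullForm Γ (p + 1) (α.d n) = extDeriv (pullForm Γ p α) := by
  have h := pullForm_mem_invForms hα
  have h1 : α.d n = fun m => pullAt n (extDeriv (pullForm Γ p α)) m := by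
    funext m
    rw [Form.d, inChart_eq (chart_mem_atlas (E n) m)]
  rw [h1, pullForm_pullAt]
  intro γ hγ
  rw [← extDeriv_pullIsom γ h.1, h.2 γ hγ]

theorem pullForm_laplacian (hΓ : ∀ γ ∈ Γ, IsSignDiag γ) {α : Form n (OrbitSpace Γ) p}
    (hα : α ∈ smoothForms n (OrbitSpace Γ) p) :
    pullForm Γ p (α.laplacian n) = -coordLaplacian (pullForm Γ p α) := by
  have h := pullForm_mem_invForms hα
  have h1 : α.laplacian n = fun m => pullAt n (-coordLaplacian (pullForm Γ p α)) m := by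
    funext m
    rw [Form.laplacian, inChart_eq (chart_mem_atlas (E n) m), hodgeLaplacian_eq h.1]
  rw [h1, pullForm_pullAt]
  intro γ hγ
  conv_rhs => rw [← h.2 γ hγ, coordLaplacian_pullIsom (hΓ γ hγ) h.1]
  exact funext fun x => map_neg (altPull (lin γ : E n →L[ℝ] E n)) _

theorem map_pullForm_eigenforms (hΓ : ∀ γ ∈ Γ, IsSignDiag γ) (lam : ℝ) :
    (eigenforms n (OrbitSpace Γ) p lam).map (pullForm Γ p) = invEigenforms Γ p lam := by
  ext η
  constructor
  · rintro ⟨α, hα, rfl⟩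
    refine ⟨pullForm_mem_invForms hα.1, ?_⟩
    rw [← pullForm_laplacian hΓ hα.1, hα.2, map_smul]
  · rintro ⟨h1, h2⟩
    obtain ⟨α, hα, rfl⟩ := exists_pullForm_eq h1
    refine ⟨α, ⟨hα, pullForm_injective ?_⟩, rfl⟩
    rw [pullForm_laplacian hΓ hα, h2, map_smul]

theorem pSpectrum_eq (hΓ : ∀ γ ∈ Γ, IsSignDiag γ) (lam : ℝ) :
    pSpectrum n (OrbitSpace Γ) p lam = Module.rank ℝ (invEigenforms Γ p lam) := by
  rw [← map_pullForm_eigenforms hΓ]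
  exact (Submodule.equivMapOfInjective _ pullForm_injective _).rank_eq

end Pullback

/-! ### Holonomy as the group of linear parts -/

section Holonomy

variable {n : ℕ} {Γ : Subgroup (Isom n)}

theorem lin_mul (γ γ' : Isom n) (v : E n) : lin (γ * γ') v = lin γ (lin γ' v) := rfl

theorem lin_one (v : E n) : lin (1 : Isom n) v = v := rfl

theorem lin_inv_apply_lin (γ : Isom n) (v : E n) : lin γ⁻¹ (lin γ v) = v := by
  rw [← lin_mul, inv_mul_cancel, lin_one]

theorem lin_apply_lin_inv (γ : Isom n) (v : E n) : lin γ (lin γ⁻¹ v) = v := by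
  rw [← lin_mul, mul_inv_cancel, lin_one]

variable [IsBieberbach Γ]

variable (Γ) in
/-- The linear parts of the group acting on the tangent space at `proj x`. -/
def holonomyHom (x : E n) : Γ →*
    (TangentSpace 𝓘(ℝ, E n) (proj Γ x) ≃ₗ[ℝ] TangentSpace 𝓘(ℝ, E n) (proj Γ x)) where
  toFun γ := ((dprojEquiv Γ x).symm.toLinearEquiv.trans (lin (γ : Isom n)).toLinearEquiv).trans
    (dprojEquiv Γ x).toLinearEquiv
  map_one' := by
    ext v
    exact (dprojEquiv Γ x).apply_symm_apply v
  map_mul' γ γ' := by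
    ext v
    change dprojEquiv Γ x (lin (γ : Isom n) (lin (γ' : Isom n) ((dprojEquiv Γ x).symm v))) =
      dprojEquiv Γ x (lin (γ : Isom n) ((dprojEquiv Γ x).symm
        (dprojEquiv Γ x (lin (γ' : Isom n) ((dprojEquiv Γ x).symm v)))))
    rw [ContinuousLinearEquiv.symm_apply_apply]

theorem holonomyHom_apply (x : E n) (γ : Γ) (v : TangentSpace 𝓘(ℝ, E n) (proj Γ x)) :
    holonomyHom Γ x γ v = dproj Γ x (lin (γ : Isom n) ((dprojEquiv Γ x).symm v)) := rfl

theorem holonomyHom_eq_iff (x : E n) (γ γ' : Γ) :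
    holonomyHom Γ x γ = holonomyHom Γ x γ' ↔ ∀ v, lin (γ : Isom n) v = lin (γ' : Isom n) v := by
  constructor
  · intro h v
    have h1 := LinearEquiv.congr_fun h (dprojEquiv Γ x v)
    rw [holonomyHom_apply, holonomyHom_apply, ContinuousLinearEquiv.symm_apply_apply] at h1
    exact dproj_injective x h1
  · intro h
    ext v
    rw [holonomyHom_apply, holonomyHom_apply, h]

/-- Near a given time a single `γ` expresses the chart along the lift, so the field reads as the
constant `lin γ w`. -/
theorem isParallel_of_lift {c : unitInterval → E n} (hc : Continuous c) (w : E n) :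
    IsParallel n (M := OrbitSpace Γ) fun t => ⟨proj Γ (c t), dproj Γ (c t) w⟩ := by
  refine ⟨continuous_proj.comp hc, fun e he t ht => ?_⟩
  obtain ⟨γ, -, h⟩ := exists_chart_comp_proj he (x := c t) ht
  have h1 : ∀ᶠ s in 𝓝 t, (fun z => e (proj Γ z)) =ᶠ[𝓝 (c s)] γ :=
    hc.continuousAt.eventually h.eventually_nhds
  have h2 : ∀ᶠ s in 𝓝 t, proj Γ (c s) ∈ e.source :=
    (continuous_proj.comp hc).continuousAt.eventually (e.open_source.mem_nhds ht)
  filter_upwards [h1, h2] with s hs1 hs2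
  exact (mfderiv_chart_dproj he hs2 hs1 w).trans (mfderiv_chart_dproj he ht h w).symm

theorem mfderiv_tangentBundle_congr {e : OpenPartialHomeomorph (OrbitSpace Γ) (E n)}
    (W : TangentBundle 𝓘(ℝ, E n) (OrbitSpace Γ)) {m : OrbitSpace Γ} (h : W.proj = m)
    (w : TangentSpace 𝓘(ℝ, E n) m) (hw : (W.2 : E n) = w) :
    (mfderiv 𝓘(ℝ, E n) 𝓘(ℝ, E n) e W.proj W.2 : E n)
      = mfderiv 𝓘(ℝ, E n) 𝓘(ℝ, E n) e m w := by
  obtain ⟨b, u⟩ := W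
  subst h
  exact congrArg _ hw

/-- Converse of `isParallel_of_lift`: the lifted vector is locally constant because `lin γ` is
injective, and the interval is connected. -/
theorem lift_constant_of_isParallel {c : C(unitInterval, E n)}
    {V : unitInterval → TangentBundle 𝓘(ℝ, E n) (OrbitSpace Γ)} (hV : IsParallel n V)
    (h : ∀ t, (V t).proj = proj Γ (c t)) :
    (dprojEquiv Γ (c 0)).symm (V 0).2 = (dprojEquiv Γ (c 1)).symm (V 1).2 := by
  let u : unitInterval → E n := fun t => (dprojEquiv Γ (c t)).symm (V t).2
  suffices H : IsLocallyConstant u from H.apply_eq_of_preconnectedSpace 0 1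
  rw [IsLocallyConstant.iff_eventually_eq]
  intro t
  have he := chart_mem_atlas (E n) (proj Γ (c t))
  have ht := mem_chart_source (E n) (proj Γ (c t))
  obtain ⟨γ, -, h0⟩ := exists_chart_comp_proj he ht
  have h1 : ∀ᶠ s in 𝓝 t, (fun z => chartAt (E n) (proj Γ (c t)) (proj Γ z)) =ᶠ[𝓝 (c s)] γ :=
    c.continuous.continuousAt.eventually h0.eventually_nhds
  have h2 : ∀ᶠ s in 𝓝 t, proj Γ (c s) ∈ (chartAt (E n) (proj Γ (c t))).source :=
    (continuous_proj.comp c.continuous).continuousAt.eventually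
      ((chartAt (E n) (proj Γ (c t))).open_source.mem_nhds ht)
  have h3 := hV.2 _ he t (by rw [h t]; exact ht)
  have key : ∀ s, (V s).2 = (dproj Γ (c s) (u s) : E n) := fun s =>
    ((dprojEquiv Γ (c s)).apply_symm_apply (V s).2).symm
  filter_upwards [h1, h2, h3] with s hs1 hs2 hs3
  apply (lin γ).injective
  rw [← mfderiv_chart_dproj he hs2 hs1, ← mfderiv_chart_dproj he ht h0,
    ← mfderiv_tangentBundle_congr (V s) (h s) _ (key s),
    ← mfderiv_tangentBundle_congr (V t) (h t) _ (key t)]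
  exact hs3

/-- Transport along the image of a path from `x` to `γ⁻¹ x` keeps the lifted vector `w` constant. By
`dproj_lin`, the vector `w` at `γ⁻¹ x` projects to the same tangent vector as `lin γ w` at `x`;
hence the inverse in the endpoint. -/
theorem holonomyHom_mem (x : E n) (γ : Γ) : holonomyHom Γ x γ ∈ holonomyGroup n (proj Γ x) := by
  apply Subgroup.subset_closure
  let c0 := (PathConnectedSpace.somePath x ((γ⁻¹ : Γ) • x))
  have hγ : ((γ⁻¹ : Γ) : Isom n) ∈ Γ := (γ⁻¹).2
  have hp : proj Γ ((γ⁻¹ : Γ) • x) = proj Γ x := proj_apply hγ x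
  refine ⟨(c0.map continuous_proj).cast rfl hp.symm, fun v => ?_⟩
  let w := (dprojEquiv Γ x).symm v
  have hw : dproj Γ x w = v := (dprojEquiv Γ x).apply_symm_apply v
  refine ⟨_, isParallel_of_lift c0.continuous w, fun t => rfl, ?_, ?_⟩
  · have : c0 0 = x := c0.source
    rw [this, hw]
  · have h1 : c0 1 = ((γ⁻¹ : Γ) : Isom n) x := c0.target
    rw [h1]
    have h2 := dproj_lin hγ x (lin (γ : Isom n) w)
    have h3 : lin ((γ⁻¹ : Γ) : Isom n) (lin (γ : Isom n) w) = w := lin_inv_apply_lin _ _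
    rw [h3] at h2
    rw [Bundle.TotalSpace.mk.injEq]
    exact ⟨hp, heq_of_eq h2⟩

theorem tangentBundle_snd_eq {W : TangentBundle 𝓘(ℝ, E n) (OrbitSpace Γ)} {m : OrbitSpace Γ}
    {v : TangentSpace 𝓘(ℝ, E n) m} (h : W = ⟨m, v⟩) : (W.2 : E n) = v := by
  subst h
  rfl

/-- The lift of the loop from `x` ends at some `γ x`, and the vector carried there returns to `x`
through the linear part of `γ⁻¹`. -/
theorem exists_holonomyHom_eq (x : E n) {c : Path (proj Γ x) (proj Γ x)}
    {A : TangentSpace 𝓘(ℝ, E n) (proj Γ x) ≃ₗ[ℝ] TangentSpace 𝓘(ℝ, E n) (proj Γ x)}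
    (hA : IsParallelTransport n c A) : ∃ γ : Γ, holonomyHom Γ x γ = A := by
  obtain ⟨c', hc', hc0⟩ := (isCoveringMap_proj (Γ := Γ)).exists_path_lifts c.toContinuousMap x
    c.source
  have hcc : ∀ t, proj Γ (c' t) = c t := fun t => congrFun hc' t
  have h1 : proj Γ (c' 1) = proj Γ x := (hcc 1).trans c.target
  obtain ⟨γ, hγ, hγx⟩ := proj_eq_proj_iff.1 h1
  refine ⟨⟨γ⁻¹, Γ.inv_mem hγ⟩, ?_⟩
  ext v
  obtain ⟨V, hV, hVc, hV0, hV1⟩ := hA v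
  have h2 := lift_constant_of_isParallel (c := c') hV fun t => (hVc t).trans (hcc t).symm
  rw [holonomyHom_apply]
  have e0 : (dprojEquiv Γ x).symm v = (dprojEquiv Γ (c' 0)).symm (V 0).2 := by
    rw [hc0]
    exact congrArg (dprojEquiv Γ x).symm (tangentBundle_snd_eq hV0).symm
  have e1 : (dproj Γ (c' 1) ((dprojEquiv Γ (c' 1)).symm (V 1).2) : E n) = A v :=
    ((dprojEquiv Γ (c' 1)).apply_symm_apply (V 1).2).trans (tangentBundle_snd_eq hV1)
  rw [← e1, ← h2, ← e0, ← hγx]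
  have h4 := dproj_lin hγ x (lin γ⁻¹ ((dprojEquiv Γ x).symm v))
  rw [lin_apply_lin_inv] at h4
  exact h4.symm

theorem holonomyGroup_eq_range (x : E n) :
    holonomyGroup n (proj Γ x) = (holonomyHom Γ x).range := by
  apply le_antisymm
  · refine (Subgroup.closure_le _).2 ?_
    rintro A ⟨c, hA⟩
    exact exists_holonomyHom_eq x hA
  · rintro _ ⟨γ, rfl⟩
    exact holonomyHom_mem x γ

/-- The holonomy group of `Γ \ ℝⁿ` is the group of linear parts of `Γ`. -/
theorem nonempty_holonomyGroup_mulEquiv {G : Type*} [Group G] (φ : Γ →* G)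
    (hφ : Function.Surjective φ)
    (h : ∀ γ, φ γ = 1 ↔ ∀ v, lin (γ : Isom n) v = v) (m : OrbitSpace Γ) :
    Nonempty (holonomyGroup n m ≃* G) := by
  obtain ⟨x, rfl⟩ := proj_surjective m
  rw [holonomyGroup_eq_range]
  have hker : (holonomyHom Γ x).ker = φ.ker := by
    ext γ
    rw [MonoidHom.mem_ker, MonoidHom.mem_ker, h, ← map_one (holonomyHom Γ x), holonomyHom_eq_iff]
    rfl
  exact ⟨((QuotientGroup.quotientKerEquivRange (holonomyHom Γ x)).symm.trans
    (QuotientGroup.quotientMulEquivOfEq hker)).trans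
    (QuotientGroup.quotientKerEquivOfSurjective φ hφ)⟩

end Holonomy

/-! ### Singular chains as free groups on simplices -/

section SingularChains

open CategoryTheory Limits Simplicial Opposite

/-- The homology of a short complex of abelian groups, computed from a map that kills boundaries,
is onto on cycles, and kills no cycle that is not a boundary. -/
theorem nonempty_homology_addEquiv {R : Type} [CommRing R] (S : ShortComplex (ModuleCat.{0} R))
    {A : Type} [AddCommGroup A] [Module R A] (φ : S.X₂ →ₗ[R] A) (h0 : ∀ x, φ (S.f.hom x) = 0)
    (hsurj : ∀ a, ∃ z, S.g.hom z = 0 ∧ φ z = a)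
    (hinj : ∀ z, S.g.hom z = 0 → φ z = 0 → ∃ x, S.f.hom x = z) :
    Nonempty (S.homology ≃+ A) := by
  let ψ : LinearMap.ker S.g.hom →ₗ[R] A := φ.comp (LinearMap.ker S.g.hom).subtype
  have hψ : Function.Surjective ψ := fun a => by
    obtain ⟨z, hz, hza⟩ := hsurj a
    exact ⟨⟨z, hz⟩, hza⟩
  have hker : LinearMap.range S.moduleCatToCycles = LinearMap.ker ψ := by
    ext z
    constructor
    · rintro ⟨x, rfl⟩
      exact h0 x
    · intro hz
      obtain ⟨x, hx⟩ := hinj z.1 z.2 hz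
      exact ⟨x, Subtype.ext hx⟩
  exact ⟨(S.moduleCatHomologyIso.toLinearEquiv.trans
    ((Submodule.quotEquivOfEq _ _ hker).trans (ψ.quotKerEquivOfSurjective hψ))).toAddEquiv⟩

variable {X : Type} [TopologicalSpace X] {k : ℕ}

variable (X) in
/-- The singular chain complex with integral coefficients. -/
abbrev SingChain : ChainComplex (ModuleCat.{0} ℤ) ℕ :=
  (TopCat.toSSet.obj (TopCat.of X)).chainComplex (ModuleCat.of ℤ ℤ)

/-- A singular simplex as an element of the singular simplicial set. -/
def singSimplex (f : C(stdSimplex ℝ (Fin (k + 1)), X)) :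
    (TopCat.toSSet.obj (TopCat.of X)) _⦋k⦌ :=
  (TopCat.toSSetObjEquiv (TopCat.of X) (op ⦋k⦌)).symm f

/-- The chain given by a singular simplex. -/
def singChain (f : C(stdSimplex ℝ (Fin (k + 1)), X)) : (SingChain X).X k :=
  ((TopCat.toSSet.obj (TopCat.of X)).ιChainComplex (R := ModuleCat.of ℤ ℤ) (singSimplex f)).hom
    (1 : ℤ)

/-- The inclusion of the `i`-th face of the standard simplex. -/
def faceMap (i : Fin (k + 2)) : C(stdSimplex ℝ (Fin (k + 1)), stdSimplex ℝ (Fin (k + 2))) :=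
  ⟨stdSimplex.map i.succAbove, stdSimplex.continuous_map _⟩

theorem δ_singSimplex (f : C(stdSimplex ℝ (Fin (k + 2)), X)) (i : Fin (k + 2)) :
    (TopCat.toSSet.obj (TopCat.of X)).δ i (singSimplex f) = singSimplex (f.comp (faceMap i)) :=
  rfl

theorem d_singChain (f : C(stdSimplex ℝ (Fin (k + 2)), X)) :
    ((SingChain X).d (k + 1) k).hom (singChain f)
      = ∑ i : Fin (k + 2), (-1 : ℤ) ^ (i : ℕ) • singChain (f.comp (faceMap i)) := by
  have h := (TopCat.toSSet.obj (TopCat.of X)).ιChainComplex_d (R := ModuleCat.of ℤ ℤ)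
    (singSimplex f)
  have h1 := congrArg (fun φ => φ.hom (1 : ℤ)) h
  refine h1.trans ?_
  simp [δ_singSimplex, singChain, ModuleCat.hom_sum]

theorem singChain_hom_ext {A : Type} [AddCommGroup A] {φ ψ : (SingChain X).X k →ₗ[ℤ] A}
    (h : ∀ f : C(stdSimplex ℝ (Fin (k + 1)), X), φ (singChain f) = ψ (singChain f)) : φ = ψ := by
  have key : ModuleCat.ofHom (Y := A) φ = ModuleCat.ofHom (Y := A) ψ := by
    refine SSet.chainComplex_hom_ext fun x => ?_
    obtain ⟨f, rfl⟩ := (TopCat.toSSetObjEquiv (TopCat.of X) (op ⦋k⦌)).symm.surjective x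
    ext
    exact h f
  exact congrArg ModuleCat.Hom.hom key

/-- The chain group is a coproduct of copies of `ℤ` indexed by the simplices, so a homomorphism may
be prescribed freely on them. -/
theorem exists_singChain_lift {A : Type} [AddCommGroup A]
    (u : C(stdSimplex ℝ (Fin (k + 1)), X) → A) :
    ∃ φ : (SingChain X).X k →ₗ[ℤ] A, ∀ f, φ (singChain f) = u f := by
  let T : ModuleCat.{0} ℤ := ModuleCat.of ℤ A
  let c : Cofan (fun _ : (TopCat.toSSet.obj (TopCat.of X)) _⦋k⦌ => ModuleCat.of ℤ ℤ) :=
    Cofan.mk T fun x => ModuleCat.ofHom (LinearMap.toSpanSingleton ℤ A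
      (u (TopCat.toSSetObjEquiv (TopCat.of X) (op ⦋k⦌) x)))
  let φ := ((TopCat.toSSet.obj (TopCat.of X)).isColimitChainComplexXCofan
    (ModuleCat.of ℤ ℤ) k).desc c
  refine ⟨φ.hom, fun f => ?_⟩
  have h := ((TopCat.toSSet.obj (TopCat.of X)).isColimitChainComplexXCofan
    (ModuleCat.of ℤ ℤ) k).fac c ⟨singSimplex f⟩
  have h1 := congrArg (fun φ => φ.hom (1 : ℤ)) h
  refine h1.trans ?_
  change (1 : ℤ) • u _ = u f
  rw [one_smul, singSimplex]
  exact congrArg u (Equiv.apply_symm_apply _ f)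

end SingularChains

/-! ### One-chains of the quotient modulo boundaries -/

section FirstHomology

open CategoryTheory

/-- Taking `v` to be a coordinate vector recovers the barycentric coordinates of an image point,
which is how faces are computed below. -/
theorem stdSimplex_sum_map {ι κ V : Type*} [Fintype ι] [Fintype κ] [AddCommGroup V] [Module ℝ V]
    (f : ι → κ) (s : stdSimplex ℝ ι) (v : κ → V) :
    ∑ y, stdSimplex.map f s y • v y = ∑ x, s x • v (f x) := by
  classical
  simp only [stdSimplex.map_coe, FunOnFinite.linearMap_apply_apply, Finset.sum_smul]
  rw [← Finset.sum_fiberwise (s := Finset.univ) (g := f)]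
  refine Finset.sum_congr rfl fun y _ => Finset.sum_congr (by ext; simp) fun x hx => ?_
  simp only [Finset.mem_filter] at hx
  rw [hx.2]

theorem faceMap_self {k : ℕ} (i : Fin (k + 2)) (t : stdSimplex ℝ (Fin (k + 1))) :
    faceMap i t i = 0 := by
  classical
  have := stdSimplex_sum_map i.succAbove t (V := ℝ) (Pi.single i 1)
  simp only [Pi.single_apply, Fin.succAbove_ne, smul_eq_mul, mul_ite, mul_one, mul_zero,
    Finset.sum_ite_eq', Finset.mem_univ, if_true, if_false, Finset.sum_const_zero] at this
  exact this

theorem faceMap_succAbove {k : ℕ} (i : Fin (k + 2)) (t : stdSimplex ℝ (Fin (k + 1)))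
    (j : Fin (k + 1)) : faceMap i t (i.succAbove j) = t j := by
  classical
  have := stdSimplex_sum_map i.succAbove t (V := ℝ) (Pi.single (i.succAbove j) 1)
  simp only [Pi.single_apply, smul_eq_mul, mul_ite, mul_one, mul_zero,
    Finset.sum_ite_eq', Finset.mem_univ, if_true, (Fin.succAbove_right_injective).eq_iff] at this
  exact this

theorem stdSimplex_map_const {ι κ : Type*} [Fintype ι] [Fintype κ] [DecidableEq κ] (b : κ)
    (t : stdSimplex ℝ ι) : stdSimplex.map (fun _ => b) t = stdSimplex.vertex b := by
  ext y
  have := stdSimplex_sum_map (fun _ : ι => b) t (V := ℝ) (Pi.single y 1)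
  rw [← Finset.sum_smul, stdSimplex.sum_eq_one] at this
  simpa [Pi.single_apply, eq_comm] using this

/-- Together with local path-connectedness, this lets simplices lift through the covering. -/
instance stdSimplex_simplyConnected (k : ℕ) :
    SimplyConnectedSpace (stdSimplex ℝ (Fin (k + 1))) := by
  have : ContractibleSpace (stdSimplex ℝ (Fin (k + 1))) :=
    (convex_stdSimplex ℝ _).contractibleSpace ⟨_, single_mem_stdSimplex ℝ 0⟩
  infer_instance

instance stdSimplex_locallyPathConnected (k : ℕ) :
    LocallyPathConnectedSpace (stdSimplex ℝ (Fin (k + 1))) :=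
  (convex_stdSimplex ℝ (Fin (k + 1))).locallyPathConnectedSpace

variable {n : ℕ} {Γ : Subgroup (Isom n)} {k : ℕ}

variable (Γ) in
/-- The projection as a continuous map. -/
def projC : C(E n, OrbitSpace Γ) := ⟨proj Γ, continuous_proj⟩

/-- The affine simplex with given vertices. -/
def affSimplex (v : Fin (k + 1) → E n) : C(stdSimplex ℝ (Fin (k + 1)), E n) :=
  ⟨fun t => ∑ i, t i • v i, by
    refine continuous_finsetSum _ fun i _ => ?_
    exact ((continuous_apply i).comp continuous_subtype_val).smul continuous_const⟩

theorem affSimplex_apply (v : Fin (k + 1) → E n) (t) : affSimplex v t = ∑ i, t i • v i := rfl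

theorem affSimplex_vertex (v : Fin (k + 1) → E n) (i) :
    affSimplex v (stdSimplex.vertex i) = v i := by
  simp [affSimplex_apply, Pi.single_apply]

theorem affSimplex_face (v : Fin (k + 2) → E n) (i : Fin (k + 2)) :
    (affSimplex v).comp (faceMap i) = affSimplex (v ∘ i.succAbove) := by
  ext1 t
  exact stdSimplex_sum_map i.succAbove t v

theorem isom_affSimplex (γ : Isom n) (v : Fin (k + 1) → E n) (t) :
    γ (affSimplex v t) = affSimplex (fun i => γ (v i)) t := by
  have h : ∀ z, γ z = lin γ z + γ 0 := by
    intro z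
    have := γ.map_vadd 0 z
    simpa [lin] using this
  have h1 : (fun i => γ (v i)) = fun i => lin γ (v i) + γ 0 := funext fun i => h (v i)
  rw [h1, h]
  simp only [affSimplex_apply, smul_add, Finset.sum_add_distrib, map_sum, map_smul,
    ← Finset.sum_smul, stdSimplex.sum_eq_one, one_smul]

variable [IsBieberbach Γ]

theorem exists_lift_simplex (σ : C(stdSimplex ℝ (Fin (k + 1)), OrbitSpace Γ)) :
    ∃ f : C(stdSimplex ℝ (Fin (k + 1)), E n), (projC Γ).comp f = σ := by
  obtain ⟨e, he⟩ := proj_surjective (σ (stdSimplex.vertex 0))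
  obtain ⟨f, hf, -⟩ := (isCoveringMap_proj (Γ := Γ)).existsUnique_continuousMap_lifts σ
    (stdSimplex.vertex 0) e he
  exact ⟨f, ContinuousMap.ext fun t => congrFun hf.2 t⟩

theorem lift_simplex_unique {f f' : C(stdSimplex ℝ (Fin (k + 1)), E n)}
    (h : (projC Γ).comp f = (projC Γ).comp f') : ∃ γ ∈ Γ, ∀ t, f t = γ (f' t) := by
  have h0 : ∀ t, proj Γ (f t) = proj Γ (f' t) := fun t => DFunLike.congr_fun h t
  obtain ⟨γ, hγ, h1⟩ := proj_eq_proj_iff.1 (h0 (stdSimplex.vertex 0))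
  refine ⟨γ, hγ, fun t => ?_⟩
  let f'' : C(stdSimplex ℝ (Fin (k + 1)), E n) := ⟨fun t => γ (f' t), γ.continuous.comp f'.continuous⟩
  obtain ⟨F, -, hF⟩ := (isCoveringMap_proj (Γ := Γ)).existsUnique_continuousMap_lifts
    ((projC Γ).comp f) (stdSimplex.vertex 0) (f (stdSimplex.vertex 0)) rfl
  have e1 := hF f ⟨rfl, rfl⟩
  have e2 := hF f'' ⟨h1, funext fun t => (proj_apply hγ _).trans (h0 t).symm⟩
  exact DFunLike.congr_fun (e1.trans e2.symm) t

variable (Γ) in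
/-- The class of a singular `1`-simplex of `ℝⁿ` in the `1`-chains of `Γ \ ℝⁿ` modulo boundaries. -/
def edgeClass (f : C(stdSimplex ℝ (Fin 2), E n)) :
    (SingChain (OrbitSpace Γ)).X 1 ⧸
      LinearMap.range ((SingChain (OrbitSpace Γ)).d 2 1).hom :=
  Submodule.Quotient.mk (singChain ((projC Γ).comp f))

omit [IsBieberbach Γ] in
theorem edgeClass_triangle (F : C(stdSimplex ℝ (Fin 3), E n)) :
    edgeClass Γ (F.comp (faceMap 0)) + edgeClass Γ (F.comp (faceMap 2))
      = edgeClass Γ (F.comp (faceMap 1)) := by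
  rw [← sub_eq_zero]
  refine (Submodule.Quotient.mk_eq_zero _).2 ⟨singChain ((projC Γ).comp F), ?_⟩
  refine (d_singChain _).trans ((Fin.sum_univ_three _).trans ?_)
  have e : ∀ w : (SingChain (OrbitSpace Γ)).X 1, (-1 : ℤ) • w = -w := fun w => neg_one_zsmul w
  simp only [Fin.val_zero, pow_zero, one_smul, Fin.val_one, pow_one, e, Fin.val_two,
    even_two, Even.neg_pow, one_pow]
  rw [← sub_eq_add_neg]
  exact sub_add_eq_add_sub _ _ _

omit [IsBieberbach Γ] in
-- The triangle relation for a constant triangle reads `c + c = c`.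
theorem edgeClass_const (a : E n) : edgeClass Γ (ContinuousMap.const _ a) = 0 := by
  have h := edgeClass_triangle (Γ := Γ) (ContinuousMap.const _ a)
  simpa using h

omit [IsBieberbach Γ] in
-- The straight-line homotopy between the two edges is a square with its two vertical sides
-- constant. Cutting it along a diagonal gives two triangles, and both edges become homologous to
-- that diagonal.
theorem edgeClass_congr {f g : C(stdSimplex ℝ (Fin 2), E n)}
    (h0 : f (stdSimplex.vertex 0) = g (stdSimplex.vertex 0))
    (h1 : f (stdSimplex.vertex 1) = g (stdSimplex.vertex 1)) : edgeClass Γ f = edgeClass Γ g := by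
  have hc : ∀ i : Fin 3, Continuous fun t : stdSimplex ℝ (Fin 3) => t i := fun i =>
    (continuous_apply i).comp continuous_subtype_val
  have hm : ∀ u : Fin 3 → Fin 2, Continuous (stdSimplex.map (S := ℝ) u) := fun u =>
    stdSimplex.continuous_map u
  -- `F₁` has faces constant, diagonal, `f`; `F₂` has faces `g`, diagonal, constant. The weights `t
  -- 2` and `1 - t 0` agree on face `1`.
  let F₁ : C(stdSimplex ℝ (Fin 3), E n) :=
    ⟨fun t => (1 - t 2) • f (stdSimplex.map ![0, 1, 1] t) + t 2 • g (stdSimplex.map ![0, 1, 1] t),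
      ((continuous_const.sub (hc 2)).smul (f.continuous.comp (hm _))).add
        ((hc 2).smul (g.continuous.comp (hm _)))⟩
  let F₂ : C(stdSimplex ℝ (Fin 3), E n) :=
    ⟨fun t => t 0 • f (stdSimplex.map ![0, 0, 1] t) + (1 - t 0) • g (stdSimplex.map ![0, 0, 1] t),
      ((hc 0).smul (f.continuous.comp (hm _))).add
        ((continuous_const.sub (hc 0)).smul (g.continuous.comp (hm _)))⟩
  have hcomp : ∀ (u : Fin 3 → Fin 2) (i : Fin 3) (t : stdSimplex ℝ (Fin 2)),
      stdSimplex.map u (faceMap i t) = stdSimplex.map (u ∘ i.succAbove) t := fun u i t =>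
    stdSimplex.map_comp_apply _ _ _
  have u10 : (![0, 1, 1] : Fin 3 → Fin 2) ∘ Fin.succAbove 0 = fun _ => 1 := by decide
  have u11 : (![0, 1, 1] : Fin 3 → Fin 2) ∘ Fin.succAbove 1 = id := by decide
  have u12 : (![0, 1, 1] : Fin 3 → Fin 2) ∘ Fin.succAbove 2 = id := by decide
  have u20 : (![0, 0, 1] : Fin 3 → Fin 2) ∘ Fin.succAbove 0 = id := by decide
  have u21 : (![0, 0, 1] : Fin 3 → Fin 2) ∘ Fin.succAbove 1 = id := by decide
  have u22 : (![0, 0, 1] : Fin 3 → Fin 2) ∘ Fin.succAbove 2 = fun _ => 0 := by decide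
  have c12 : ∀ t : stdSimplex ℝ (Fin 2), faceMap 1 t (2 : Fin 3) = t 1 := fun t =>
    faceMap_succAbove 1 t 1
  have c10 : ∀ t : stdSimplex ℝ (Fin 2), faceMap 1 t (0 : Fin 3) = t 0 := fun t =>
    faceMap_succAbove 1 t 0
  have hsum : ∀ t : stdSimplex ℝ (Fin 2), t 0 + t 1 = 1 := stdSimplex.add_eq_one
  have a0 : F₁.comp (faceMap 0) = ContinuousMap.const _ (g (stdSimplex.vertex 1)) := by
    ext1 t
    change (1 - faceMap 0 t 2) • f (stdSimplex.map _ (faceMap 0 t)) +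
      faceMap 0 t 2 • g (stdSimplex.map _ (faceMap 0 t)) = _
    rw [hcomp, u10, stdSimplex_map_const, h1, ← add_smul]
    simp
  have a1 : F₁.comp (faceMap 1) = F₂.comp (faceMap 1) := by
    ext1 t
    change (1 - faceMap 1 t 2) • f (stdSimplex.map _ (faceMap 1 t)) +
      faceMap 1 t 2 • g (stdSimplex.map _ (faceMap 1 t)) =
      faceMap 1 t 0 • f (stdSimplex.map _ (faceMap 1 t)) +
      (1 - faceMap 1 t 0) • g (stdSimplex.map _ (faceMap 1 t))
    rw [hcomp, hcomp, u11, u21, c12, c10, ← hsum t]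
    simp
  have a2 : F₁.comp (faceMap 2) = f := by
    ext1 t
    change (1 - faceMap 2 t 2) • f (stdSimplex.map _ (faceMap 2 t)) +
      faceMap 2 t 2 • g (stdSimplex.map _ (faceMap 2 t)) = _
    rw [hcomp, u12, faceMap_self]
    simp
  have b0 : F₂.comp (faceMap 0) = g := by
    ext1 t
    change faceMap 0 t 0 • f (stdSimplex.map _ (faceMap 0 t)) +
      (1 - faceMap 0 t 0) • g (stdSimplex.map _ (faceMap 0 t)) = _
    rw [hcomp, u20, faceMap_self]
    simp
  have b2 : F₂.comp (faceMap 2) = ContinuousMap.const _ (g (stdSimplex.vertex 0)) := by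
    ext1 t
    change faceMap 2 t 0 • f (stdSimplex.map _ (faceMap 2 t)) +
      (1 - faceMap 2 t 0) • g (stdSimplex.map _ (faceMap 2 t)) = _
    rw [hcomp, u22, stdSimplex_map_const, h0, ← add_smul]
    simp
  have t1 := edgeClass_triangle (Γ := Γ) F₁
  have t2 := edgeClass_triangle (Γ := Γ) F₂
  rw [a0, a1, a2, edgeClass_const, zero_add] at t1
  rw [b0, b2, edgeClass_const, add_zero] at t2
  rw [t1, t2]

variable (Γ) in
/-- The class of a straight edge. -/
def segClass (a b : E n) := edgeClass Γ (affSimplex ![a, b])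

omit [IsBieberbach Γ] in
theorem segClass_add (a b c : E n) : segClass Γ a b + segClass Γ b c = segClass Γ a c := by
  have h := edgeClass_triangle (Γ := Γ) (affSimplex ![a, b, c])
  simp only [affSimplex_face] at h
  have e0 : ![a, b, c] ∘ Fin.succAbove 0 = ![b, c] := by
    ext i : 1; fin_cases i <;> rfl
  have e1 : ![a, b, c] ∘ Fin.succAbove 1 = ![a, c] := by
    ext i : 1; fin_cases i <;> rfl
  have e2 : ![a, b, c] ∘ Fin.succAbove 2 = ![a, b] := by
    ext i : 1; fin_cases i <;> rfl
  rw [e0, e1, e2, add_comm] at h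
  exact h

omit [IsBieberbach Γ] in
theorem segClass_apply {γ : Isom n} (hγ : γ ∈ Γ) (a b : E n) :
    segClass Γ (γ a) (γ b) = segClass Γ a b := by
  have : (projC Γ).comp (affSimplex ![γ a, γ b]) = (projC Γ).comp (affSimplex ![a, b]) := by
    ext1 t
    have h := isom_affSimplex γ ![a, b] t
    have e : (fun i => γ (![a, b] i)) = ![γ a, γ b] := by
      ext i : 1; fin_cases i <;> rfl
    rw [e] at h
    change proj Γ _ = proj Γ _
    rw [← h, proj_apply hγ]
  rw [segClass, edgeClass, this]
  rfl

omit [IsBieberbach Γ] in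
theorem edgeClass_eq_segClass (f : C(stdSimplex ℝ (Fin 2), E n)) :
    edgeClass Γ f = segClass Γ (f (stdSimplex.vertex 0)) (f (stdSimplex.vertex 1)) := by
  apply edgeClass_congr
  · rw [affSimplex_vertex]; rfl
  · rw [affSimplex_vertex]; rfl

end FirstHomology

/-! ### The first homology as the abelianization -/

section FirstHomology

open CategoryTheory

theorem singChain_addHom_ext {X : Type} [TopologicalSpace X] {k : ℕ} {A : Type} [AddCommGroup A]
    {φ ψ : (SingChain X).X k →+ A}
    (h : ∀ f : C(stdSimplex ℝ (Fin (k + 1)), X), φ (singChain f) = ψ (singChain f)) : φ = ψ := by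
  let φ' : (SingChain X).X k →ₗ[ℤ] A :=
    { φ with map_smul' := fun c x => by simpa using map_intCast_smul φ ℤ ℤ c x }
  let ψ' : (SingChain X).X k →ₗ[ℤ] A :=
    { ψ with map_smul' := fun c x => by simpa using map_intCast_smul ψ ℤ ℤ c x }
  have : φ' = ψ' := singChain_hom_ext h
  exact AddMonoidHom.ext fun x => LinearMap.congr_fun this x

variable {n : ℕ} {Γ : Subgroup (Isom n)} [IsBieberbach Γ]

/-- A set-theoretic section of the projection. -/
def orbitRep (m : OrbitSpace Γ) : E n := Function.surjInv proj_surjective m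

omit [IsBieberbach Γ] in
theorem proj_orbitRep (m : OrbitSpace Γ) : proj Γ (orbitRep m) = m :=
  Function.surjInv_eq proj_surjective m

theorem eq_of_apply_eq {γ γ' : Γ} {x : E n} (h : (γ : Isom n) x = (γ' : Isom n) x) : γ = γ' :=
  IsCancelSMul.right_cancel γ γ' x h

omit [IsBieberbach Γ] in
theorem exists_orbitCoord (x : E n) : ∃ γ : Γ, (γ : Isom n) (orbitRep (proj Γ x)) = x := by
  obtain ⟨γ, hγ, h⟩ := proj_eq_proj_iff.1 (proj_orbitRep (proj Γ x)).symm
  exact ⟨⟨γ, hγ⟩, h⟩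

variable (Γ) in
/-- The group element carrying the chosen representative of the orbit of `x` to `x`. -/
def orbitCoord (x : E n) : Γ := (exists_orbitCoord x).choose

omit [IsBieberbach Γ] in
theorem orbitCoord_spec (x : E n) : (orbitCoord Γ x : Isom n) (orbitRep (proj Γ x)) = x :=
  (exists_orbitCoord x).choose_spec

/-- The action is free, so the element carrying the representative to a point is unique. -/
theorem orbitCoord_apply (γ : Γ) (x : E n) :
    orbitCoord Γ ((γ : Isom n) x) = γ * orbitCoord Γ x := by
  apply eq_of_apply_eq (x := orbitRep (proj Γ x))
  have h := orbitCoord_spec (Γ := Γ) ((γ : Isom n) x)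
  rw [proj_apply γ.2] at h
  rw [h]
  exact (congrArg (γ : Isom n) (orbitCoord_spec x)).symm

variable (Γ) in
/-- The group element by which a `1`-simplex moves the sheet of the covering. -/
def sheetShift (f : C(stdSimplex ℝ (Fin 2), E n)) : Γ :=
  (orbitCoord Γ (f (stdSimplex.vertex 0)))⁻¹ * orbitCoord Γ (f (stdSimplex.vertex 1))

variable (Γ) in
/-- The class of `sheetShift` in the abelianization. -/
def shiftClass (f : C(stdSimplex ℝ (Fin 2), E n)) : Additive (Abelianization Γ) :=
  Additive.ofMul (Abelianization.of (sheetShift Γ f))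

/-- Two lifts of one simplex differ by a group element on the left, which cancels in the quotient of
the two coordinates. This makes the shift a function of the simplex downstairs. -/
theorem shiftClass_congr {f f' : C(stdSimplex ℝ (Fin 2), E n)}
    (h : (projC Γ).comp f = (projC Γ).comp f') : shiftClass Γ f = shiftClass Γ f' := by
  obtain ⟨γ, hγ, h1⟩ := lift_simplex_unique h
  have h2 : ∀ t, orbitCoord Γ (f t) = ⟨γ, hγ⟩ * orbitCoord Γ (f' t) := fun t => by
    rw [h1 t]
    exact orbitCoord_apply ⟨γ, hγ⟩ (f' t)
  simp only [shiftClass, sheetShift, h2]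
  group

theorem faceMap_vertex {k : ℕ} (i : Fin (k + 2)) (j : Fin (k + 1)) :
    faceMap i (stdSimplex.vertex j) = stdSimplex.vertex (i.succAbove j) :=
  stdSimplex.map_vertex _ _

omit [IsBieberbach Γ] in
theorem shiftClass_triangle (F : C(stdSimplex ℝ (Fin 3), E n)) :
    shiftClass Γ (F.comp (faceMap 0)) + shiftClass Γ (F.comp (faceMap 2))
      = shiftClass Γ (F.comp (faceMap 1)) := by
  have key : ∀ a b c : Γ, Additive.ofMul (Abelianization.of (b⁻¹ * c))
      + Additive.ofMul (Abelianization.of (a⁻¹ * b))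
        = Additive.ofMul (Abelianization.of (a⁻¹ * c)) := by
    intro a b c
    rw [add_comm, ← ofMul_mul, ← map_mul]
    congr 2
    group
  simp only [shiftClass, sheetShift, ContinuousMap.comp_apply, faceMap_vertex]
  exact key _ _ _

variable (Γ) in
/-- The homomorphism sending `γ` to the class of the loop it determines. -/
def loopHom : Γ →* Multiplicative ((SingChain (OrbitSpace Γ)).X 1 ⧸
      LinearMap.range ((SingChain (OrbitSpace Γ)).d 2 1).hom) where
  toFun γ := Multiplicative.ofAdd (segClass Γ 0 ((γ : Isom n) 0))
  map_one' := by
    rw [← ofAdd_zero]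
    congr 1
    have h := segClass_add (Γ := Γ) 0 0 0
    rw [add_eq_left] at h
    exact h
  map_mul' γ γ' := by
    rw [← ofAdd_add, ← segClass_add 0 ((γ : Isom n) 0) (((γ * γ' : Γ) : Isom n) 0)]
    congr 2
    exact segClass_apply γ.2 0 ((γ' : Isom n) 0)

variable (Γ) in
/-- `loopHom` on the abelianization. -/
def loopClass : Additive (Abelianization Γ) →+ (SingChain (OrbitSpace Γ)).X 1 ⧸
      LinearMap.range ((SingChain (OrbitSpace Γ)).d 2 1).hom :=
  MonoidHom.toAdditiveLeft (Abelianization.lift (loopHom Γ))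

omit [IsBieberbach Γ] in
theorem loopClass_of (γ : Γ) :
    loopClass Γ (Additive.ofMul (Abelianization.of γ)) = segClass Γ 0 ((γ : Isom n) 0) := by
  change Multiplicative.toAdd (Abelianization.lift (loopHom Γ) (Abelianization.of γ)) = _
  rw [Abelianization.lift_apply_of]
  rfl

omit [IsBieberbach Γ] in
-- Move the edge by a group element so that it starts at the representative `a`; it then ends at `s
-- b`, where `s` is the shift. Going `a → 0 → s 0 → s b` splits off the loop of `s`. The two
-- remaining pieces depend only on the endpoints in the quotient.
theorem edgeClass_decomp (f : C(stdSimplex ℝ (Fin 2), E n)) :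
    edgeClass Γ f = loopClass Γ (shiftClass Γ f)
      + (segClass Γ 0 (orbitRep (proj Γ (f (stdSimplex.vertex 1))))
        - segClass Γ 0 (orbitRep (proj Γ (f (stdSimplex.vertex 0))))) := by
  rw [edgeClass_eq_segClass, shiftClass, loopClass_of]
  set x := f (stdSimplex.vertex 0)
  set y := f (stdSimplex.vertex 1)
  set a := orbitRep (proj Γ x)
  set b := orbitRep (proj Γ y)
  have hx : (orbitCoord Γ x : Isom n) a = x := orbitCoord_spec x
  have hy : (orbitCoord Γ y : Isom n) b = y := orbitCoord_spec y
  have h1 := segClass_apply (orbitCoord Γ x).2 a ((sheetShift Γ f : Isom n) b)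
  have h2 : (orbitCoord Γ x : Isom n) ((sheetShift Γ f : Isom n) b) = y := by
    have : orbitCoord Γ x * sheetShift Γ f = orbitCoord Γ y := by
      simp [sheetShift, x, y]
    rw [← hy, ← this]
    rfl
  rw [hx, h2] at h1
  rw [h1, ← segClass_add a 0, ← segClass_add 0 ((sheetShift Γ f : Isom n) 0)
    ((sheetShift Γ f : Isom n) b), segClass_apply (sheetShift Γ f).2]
  have h3 := segClass_add (Γ := Γ) a 0 a
  have h4 := segClass_add (Γ := Γ) a a a
  rw [add_eq_left] at h4
  rw [h4] at h3
  rw [eq_neg_of_add_eq_zero_left h3]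
  abel

theorem d_one_singChain {X : Type} [TopologicalSpace X] (f : C(stdSimplex ℝ (Fin 2), X)) :
    ((SingChain X).d 1 0).hom (singChain f)
      = singChain (f.comp (faceMap 0)) - singChain (f.comp (faceMap 1)) := by
  refine (d_singChain f).trans ((Fin.sum_univ_two _).trans ?_)
  have e : ∀ w : (SingChain X).X 0, (-1 : ℤ) • w = -w := fun w => neg_one_zsmul w
  simp only [Fin.val_zero, pow_zero, one_smul, Fin.val_one, pow_one, e]
  rw [← sub_eq_add_neg]

theorem d_two_singChain {X : Type} [TopologicalSpace X] (f : C(stdSimplex ℝ (Fin 3), X)) :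
    ((SingChain X).d 2 1).hom (singChain f)
      = singChain (f.comp (faceMap 0)) + singChain (f.comp (faceMap 2))
        - singChain (f.comp (faceMap 1)) := by
  refine (d_singChain f).trans ((Fin.sum_univ_three _).trans ?_)
  have e : ∀ w : (SingChain X).X 1, (-1 : ℤ) • w = -w := fun w => neg_one_zsmul w
  simp only [Fin.val_zero, pow_zero, one_smul, Fin.val_one, pow_one, e, Fin.val_two,
    even_two, Even.neg_pow, one_pow]
  rw [← sub_eq_add_neg]
  exact sub_add_eq_add_sub _ _ _

variable (Γ) in
/-- The first homology of `Γ \ ℝⁿ` is the abelianization of `Γ`. -/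
theorem nonempty_H1_addEquiv :
    Nonempty (H1 (OrbitSpace Γ) ≃+ Additive (Abelianization Γ)) := by
  let lift (σ : C(stdSimplex ℝ (Fin 2), OrbitSpace Γ)) := (exists_lift_simplex σ).choose
  have hlift : ∀ σ, (projC Γ).comp (lift σ) = σ := fun σ => (exists_lift_simplex σ).choose_spec
  obtain ⟨φ, hφ⟩ := exists_singChain_lift fun σ => shiftClass Γ (lift σ)
  have hφ' : ∀ f, φ (singChain ((projC Γ).comp f)) = shiftClass Γ f := fun f =>
    (hφ _).trans (shiftClass_congr (hlift _))
  -- `L` is chosen so that its value on the boundary of an edge is the endpoint term of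
  -- `edgeClass_decomp`.
  obtain ⟨L, hL⟩ := exists_singChain_lift fun τ : C(stdSimplex ℝ (Fin 1), OrbitSpace Γ) =>
    segClass Γ 0 (orbitRep (τ (stdSimplex.vertex 0)))
  have hd : φ.comp ((SingChain (OrbitSpace Γ)).d 2 1).hom = 0 := by
    refine singChain_hom_ext fun σ => ?_
    obtain ⟨F, rfl⟩ := exists_lift_simplex σ
    rw [LinearMap.comp_apply, d_two_singChain, map_sub, map_add, LinearMap.zero_apply, sub_eq_zero]
    exact ((congrArg₂ _ (hφ' _) (hφ' _)).trans (shiftClass_triangle F)).trans (hφ' _).symm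
  -- `edgeClass_decomp`, extended additively from simplices to all chains. For a cycle the second
  -- term vanishes, so a cycle killed by `φ` is a boundary.
  have hdecomp : ∀ z, (Submodule.Quotient.mk z : (SingChain (OrbitSpace Γ)).X 1 ⧸
      LinearMap.range ((SingChain (OrbitSpace Γ)).d 2 1).hom)
      = loopClass Γ (φ z) + L (((SingChain (OrbitSpace Γ)).d 1 0).hom z) := by
    have h := singChain_addHom_ext
      (φ := (LinearMap.range ((SingChain (OrbitSpace Γ)).d 2 1).hom).mkQ.toAddMonoidHom)
      (ψ := (loopClass Γ).comp φ.toAddMonoidHom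
        + L.toAddMonoidHom.comp ((SingChain (OrbitSpace Γ)).d 1 0).hom.toAddMonoidHom) (by
        intro σ
        obtain ⟨f, rfl⟩ := exists_lift_simplex σ
        refine (edgeClass_decomp f).trans ?_
        refine congrArg₂ _ (congrArg _ (hφ' f).symm) ?_
        refine Eq.symm ((congrArg L (d_one_singChain _)).trans ?_)
        rw [map_sub, hL, hL]
        simp only [ContinuousMap.comp_apply, faceMap_vertex]
        rfl)
    exact fun z => DFunLike.congr_fun h z
  have hsurj : ∀ a, ∃ z, ((SingChain (OrbitSpace Γ)).d 1 0).hom z = 0 ∧ φ z = a := by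
    intro a
    obtain ⟨γ, rfl⟩ : ∃ γ : Γ, Additive.ofMul (Abelianization.of γ) = a := by
      obtain ⟨γ, hγ⟩ := QuotientGroup.mk_surjective a.toMul
      exact ⟨γ, congrArg Additive.ofMul hγ⟩
    refine ⟨singChain ((projC Γ).comp (affSimplex ![0, (γ : Isom n) 0])), ?_, ?_⟩
    · refine (d_one_singChain _).trans (sub_eq_zero.2 (congrArg singChain ?_))
      ext1 t
      have ht : t = stdSimplex.vertex 0 := Subsingleton.elim _ _
      rw [ht]
      simp only [ContinuousMap.comp_apply, faceMap_vertex, affSimplex_vertex]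
      exact proj_apply γ.2 0
    -- The shift of this loop is a conjugate of `γ`, hence has the same class.
    · rw [hφ', shiftClass, sheetShift, affSimplex_vertex, affSimplex_vertex]
      change Additive.ofMul (Abelianization.of ((orbitCoord Γ 0)⁻¹ *
        orbitCoord Γ ((γ : Isom n) 0))) = _
      rw [orbitCoord_apply]
      refine congrArg Additive.ofMul ?_
      rw [map_mul Abelianization.of, map_mul Abelianization.of, map_inv, mul_comm, mul_assoc,
        mul_inv_cancel, mul_one]
  have hinj : ∀ z, ((SingChain (OrbitSpace Γ)).d 1 0).hom z = 0 → φ z = 0 →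
      ∃ x, ((SingChain (OrbitSpace Γ)).d 2 1).hom x = z := by
    intro z hz hφz
    have h := hdecomp z
    rw [hφz, map_zero, zero_add, hz, map_zero] at h
    exact (Submodule.Quotient.mk_eq_zero _).1 h
  obtain ⟨iso⟩ := nonempty_homology_addEquiv ((SingChain (OrbitSpace Γ)).sc' 2 1 0) φ
    (fun x => LinearMap.congr_fun hd x) hsurj hinj
  exact ⟨((SingChain (OrbitSpace Γ)).homologyIsoSc' 2 1 0 (by simp)
    (by simp)).toLinearEquiv.toAddEquiv.trans iso⟩

end FirstHomology

/-! ### Half-integral isometries with diagonal signs -/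

section Groups

/-- The sign `(-1)^a`. -/
def par (a : ℤ) : ℤ := if Even a then 1 else -1

theorem par_eq_or (a : ℤ) : par a = 1 ∨ par a = -1 := by
  unfold par
  split_ifs <;> simp

theorem par_eq_one_iff (a : ℤ) : par a = 1 ↔ Even a := by
  unfold par
  split_ifs with h <;> simp [h]

theorem par_add (a b : ℤ) : par (a + b) = par a * par b := by
  unfold par
  by_cases ha : Even a <;> by_cases hb : Even b <;> simp [ha, hb, Int.even_add]

/-- The signs of the linear part of the isometry with parities `s` and `t`. -/
def signs (s t : ℤ) : Fin 4 → ℤ := ![1, par t, par s, par (s + t)]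

theorem signs_eq_or (s t : ℤ) (i : Fin 4) : signs s t i = 1 ∨ signs s t i = -1 := by
  fin_cases i
  · exact Or.inl rfl
  · exact par_eq_or t
  · exact par_eq_or s
  · exact par_eq_or (s + t)

theorem signs_mul_self (s t : ℤ) (i : Fin 4) : signs s t i * signs s t i = 1 := by
  rcases signs_eq_or s t i with h | h <;> simp [h]

theorem signs_add (s t s' t' : ℤ) (i : Fin 4) :
    signs (s + s') (t + t') i = signs s t i * signs s' t' i := by
  fin_cases i
  · rfl
  · exact par_add t t'
  · exact par_add s s'
  · change par (s + s' + (t + t')) = par (s + t) * par (s' + t')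
    rw [← par_add]
    congr 1
    ring

theorem par_congr {a b : ℤ} (h : Even (a - b)) : par a = par b := by
  have : a = b + (a - b) := by ring
  rw [this, par_add, (par_eq_one_iff _).2 h, mul_one]

theorem signs_congr {s t s' t' : ℤ} (hs : Even (s - s')) (ht : Even (t - t')) :
    signs s t = signs s' t' := by
  have : par (s + t) = par (s' + t') := by rw [par_add, par_add, par_congr hs, par_congr ht]
  simp only [signs, this, par_congr hs, par_congr ht]

/-- The isometry is `x ↦ D x + w / 2` where the diagonal matrix `D` has the signs determined by
the parities of `w 1` and `w j`. -/
def HasForm (j : Fin 4) (w : Fin 4 → ℤ) (γ : Isom 4) : Prop :=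
  ∀ x i, γ x i = (signs (w 1) (w j) i : ℝ) * x i + (w i : ℝ) / 2

/-- A condition on vectors that only depends on parities and is additive. -/
structure IsParityCondition (P : (Fin 4 → ℤ) → Prop) : Prop where
  zero : P 0
  add_sign_mul : ∀ w w' σ : Fin 4 → ℤ, (∀ i, σ i = 1 ∨ σ i = -1) → P w → P w' → P (w + σ * w')

theorem even_sign_mul_sub {σ a : ℤ} (h : σ = 1 ∨ σ = -1) : Even (σ * a - a) := by
  rcases h with rfl | rfl
  · simp
  · exact ⟨-a, by ring⟩

/-- Sign changes do not affect parities, so the signs of the product are still the ones read off its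
own translation vector. -/
theorem HasForm.mul {j : Fin 4} {w w' : Fin 4 → ℤ} {γ γ' : Isom 4} (h : HasForm j w γ)
    (h' : HasForm j w' γ') : HasForm j (w + signs (w 1) (w j) * w') (γ * γ') := by
  intro x i
  have e : (γ * γ') x = γ (γ' x) := rfl
  have hs : signs ((w + signs (w 1) (w j) * w') 1) ((w + signs (w 1) (w j) * w') j)
      = signs (w 1 + w' 1) (w j + w' j) := by
    have k : ∀ i, Even ((w + signs (w 1) (w j) * w') i - (w i + w' i)) := fun i => by
      have := even_sign_mul_sub (a := w' i) (signs_eq_or (w 1) (w j) i)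
      simpa using this
    exact signs_congr (k 1) (k j)
  rw [e, h, h', hs, signs_add]
  simp only [Pi.add_apply, Pi.mul_apply]
  push_cast
  ring

theorem HasForm.inv {j : Fin 4} {w : Fin 4 → ℤ} {γ : Isom 4} (h : HasForm j w γ) :
    HasForm j (0 + (-signs (w 1) (w j)) * w) γ⁻¹ := by
  intro x i
  have hx : γ (γ⁻¹ x) = x := γ.apply_symm_apply x
  have h1 := h (γ⁻¹ x) i
  rw [hx] at h1
  have hs : signs ((0 + (-signs (w 1) (w j)) * w) 1) ((0 + (-signs (w 1) (w j)) * w) j)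
      = signs (w 1) (w j) := by
    have k : ∀ i, Even ((0 + (-signs (w 1) (w j)) * w) i - w i) := fun i => by
      have := even_sign_mul_sub (σ := -signs (w 1) (w j) i) (a := w i) (by
        rcases signs_eq_or (w 1) (w j) i with h | h <;> simp [h])
      simpa using this
    exact signs_congr (k 1) (k j)
  rw [hs]
  have h2 : (signs (w 1) (w j) i : ℝ) * signs (w 1) (w j) i = 1 := by
    exact_mod_cast signs_mul_self (w 1) (w j) i
  simp only [Pi.add_apply, Pi.mul_apply, Pi.neg_apply, Pi.zero_apply]
  push_cast
  rw [h1]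
  linear_combination (-γ⁻¹ x i) * h2

theorem HasForm.one (j : Fin 4) : HasForm j 0 1 := by
  intro x i
  have : signs 0 0 i = 1 := by
    fin_cases i <;> simp [signs, par]
  simp [this]

/-- A group generated by isometries of the given form consists of such isometries. -/
theorem exists_hasForm_of_mem_closure {j : Fin 4} {P : (Fin 4 → ℤ) → Prop}
    (hP : IsParityCondition P) {S : Set (Isom 4)} (hS : ∀ γ ∈ S, ∃ w, P w ∧ HasForm j w γ)
    {γ : Isom 4} (hγ : γ ∈ Subgroup.closure S) : ∃ w, P w ∧ HasForm j w γ := by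
  induction hγ using Subgroup.closure_induction with
  | mem γ h => exact hS γ h
  | one => exact ⟨0, hP.zero, HasForm.one j⟩
  | mul γ γ' _ _ h h' =>
    obtain ⟨w, hw, h⟩ := h
    obtain ⟨w', hw', h'⟩ := h'
    exact ⟨_, hP.add_sign_mul _ _ _ (signs_eq_or _ _) hw hw', h.mul h'⟩
  | inv γ _ h =>
    obtain ⟨w, hw, h⟩ := h
    refine ⟨_, hP.add_sign_mul _ _ _ (fun i => ?_) hP.zero hw, h.inv⟩
    rcases signs_eq_or (w 1) (w j) i with h | h <;> simp [h]

/-- Twice the translation part. -/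
def halfCoord (γ : Isom 4) (i : Fin 4) : ℤ := ⌊2 * γ 0 i⌋

theorem HasForm.halfCoord_eq {j : Fin 4} {w : Fin 4 → ℤ} {γ : Isom 4} (h : HasForm j w γ) :
    halfCoord γ = w := by
  funext i
  have : 2 * γ 0 i = (w i : ℝ) := by
    rw [h 0 i]
    simp only [PiLp.zero_apply, mul_zero, zero_add]
    ring
  rw [halfCoord, this, Int.floor_intCast]

/-- The vector determines the linear part as well as the translation. Thus relations between group
elements reduce to equalities of integer vectors, settled by `decide`. -/
theorem HasForm.ext {j : Fin 4} {w : Fin 4 → ℤ} {γ γ' : Isom 4} (h : HasForm j w γ)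
    (h' : HasForm j w γ') : γ = γ' := by
  ext x i
  rw [h, h']

theorem HasForm.lin_apply {j : Fin 4} {w : Fin 4 → ℤ} {γ : Isom 4} (h : HasForm j w γ) (v : E 4)
    (i : Fin 4) : lin γ v i = (signs (w 1) (w j) i : ℝ) * v i := by
  have h1 : γ v = lin γ v + γ 0 := by
    have := γ.map_vadd 0 v
    simpa [lin] using this
  have h2 := h v i
  have h3 := h 0 i
  rw [h1] at h2
  simp only [PiLp.add_apply, PiLp.zero_apply, mul_zero, zero_add] at h2 h3
  linarith

theorem HasForm.isSignDiag {j : Fin 4} {w : Fin 4 → ℤ} {γ : Isom 4} (h : HasForm j w γ) :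
    IsSignDiag γ := by
  intro i
  refine ⟨signs (w 1) (w j) i, by exact_mod_cast signs_mul_self (w 1) (w j) i, ?_⟩
  ext k
  rw [h.lin_apply]
  by_cases hk : k = i
  · subst hk; simp [basisVec]
  · simp [basisVec, hk]

theorem HasForm.pow_apply {j : Fin 4} {w : Fin 4 → ℤ} {γ : Isom 4} (h : HasForm j w γ) {i : Fin 4}
    (hi : signs (w 1) (w j) i = 1) (m : ℕ) : (γ ^ m) 0 i = m * ((w i : ℝ) / 2) := by
  induction m with
  | zero => simp
  | succ m ih =>
    have e : (γ ^ (m + 1)) 0 = γ ((γ ^ m) 0) := by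
      rw [pow_succ']
      rfl
    rw [e, h, ih, hi]
    push_cast
    ring

/-- An unreflected coordinate advances by `w i / 2` at each iteration and can return only if that
step is zero. -/
theorem HasForm.eq_zero_of_isOfFinOrder {j : Fin 4} {w : Fin 4 → ℤ} {γ : Isom 4}
    (h : HasForm j w γ) (hγ : IsOfFinOrder γ) {i : Fin 4} (hi : signs (w 1) (w j) i = 1) :
    w i = 0 := by
  obtain ⟨m, hm, hm1⟩ := isOfFinOrder_iff_pow_eq_one.1 hγ
  have h1 := h.pow_apply hi m
  rw [hm1] at h1
  have h2 : (1 : Isom 4) 0 i = (0 : ℝ) := rfl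
  rw [h2] at h1
  have hm' : (m : ℝ) ≠ 0 := by exact_mod_cast hm.ne'
  have h3 : (w i : ℝ) = 0 := by
    have := mul_eq_zero.1 h1.symm
    rcases this with h | h
    · exact absurd h hm'
    · linarith
  exact_mod_cast h3

/-- The translation by an integral vector. -/
def intTrans (k : Fin 4 → ℤ) : Isom 4 :=
  AffineIsometryEquiv.constVAdd ℝ (E 4) (WithLp.toLp 2 fun i => (k i : ℝ))

theorem intTrans_apply (k : Fin 4 → ℤ) (x : E 4) (i : Fin 4) :
    intTrans k x i = (k i : ℝ) + x i := rfl

theorem hasForm_intTrans (j : Fin 4) (k : Fin 4 → ℤ) : HasForm j (2 • k) (intTrans k) := by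
  intro x i
  have : signs ((2 • k) 1) ((2 • k) j) = signs 0 0 :=
    signs_congr (by simp) (by simp)
  rw [this]
  have : signs 0 0 i = 1 := by
    fin_cases i <;> simp [signs, par]
  rw [this, intTrans_apply]
  simp
  ring

/-- A set of half-integral isometries containing the integral translations, acting without
fixed points, generates a Bieberbach group. -/
theorem isBieberbach_of_hasForm {j : Fin 4} {P : (Fin 4 → ℤ) → Prop} {Γ : Subgroup (Isom 4)}
    (hΓ : ∀ γ ∈ Γ, ∃ w, P w ∧ HasForm j w γ) (htr : ∀ k, intTrans k ∈ Γ)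
    (hfree : ∀ w, P w → (∀ i, signs (w 1) (w j) i = 1 → w i = 0) → w = 0) : IsBieberbach Γ where
  discrete := by
    rw [discreteTopology_iff_isOpen_singleton]
    intro γ
    have hc : Continuous fun γ' : Γ => (γ' : Isom 4) 0 :=
      (continuous_apply (0 : E 4)).comp (continuous_induced_dom.comp continuous_subtype_val)
    -- Half-integral vectors less than `1/2` apart coincide, and the image of the origin determines
    -- the element.
    have ho := (Metric.isOpen_ball (x := (γ : Isom 4) 0) (ε := 1 / 2)).preimage hc
    convert ho
    symm
    refine Set.eq_singleton_iff_unique_mem.2 ⟨by simp, fun γ' hγ' => ?_⟩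
    obtain ⟨w, -, h⟩ := hΓ γ γ.2
    obtain ⟨w', -, h'⟩ := hΓ γ' γ'.2
    have : w' = w := by
      funext i
      have h1 : dist ((γ' : Isom 4) 0) ((γ : Isom 4) 0) < 1 / 2 := hγ'
      have h2 := PiLp.norm_apply_le ((γ' : Isom 4) 0 - (γ : Isom 4) 0) i
      rw [dist_eq_norm] at h1
      have h3 := h2.trans_lt h1
      rw [PiLp.sub_apply, h, h'] at h3
      simp only [PiLp.zero_apply, mul_zero, zero_add, Real.norm_eq_abs] at h3
      have h4 : |((w' i - w i : ℤ) : ℝ)| < 1 := by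
        push_cast
        have : (w' i : ℝ) / 2 - w i / 2 = (w' i - w i) / 2 := by ring
        rw [this, abs_div, abs_two] at h3
        linarith
      have h5 : |w' i - w i| < 1 := by exact_mod_cast h4
      have := Int.abs_lt_one_iff.1 h5
      omega
    subst this
    exact Subtype.ext (h'.ext h)
  cocompact := by
    -- The unit cube meets every orbit, by subtracting integer parts.
    let K : Set (E 4) := (WithLp.toLp 2) '' (Set.univ.pi fun _ : Fin 4 => Icc (0 : ℝ) 1)
    have hK : IsCompact K :=
      (isCompact_univ_pi fun _ => isCompact_Icc).image (PiLp.continuous_toLp 2 _)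
    have h : proj Γ '' K = univ := by
      refine eq_univ_of_forall fun m => ?_
      obtain ⟨x, rfl⟩ := proj_surjective m
      refine ⟨intTrans (fun i => -⌊x i⌋) x, ⟨fun i => Int.fract (x i), fun i _ =>
        ⟨Int.fract_nonneg _, (Int.fract_lt_one _).le⟩, ?_⟩, proj_apply (htr _) x⟩
      ext i
      rw [intTrans_apply]
      push_cast
      change Int.fract (x i) = _
      rw [Int.fract]
      ring
    exact ⟨h ▸ hK.image continuous_proj⟩
  torsionFree := by
    intro γ hγ hfin
    obtain ⟨w, hw, h⟩ := hΓ γ hγ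
    have h0 := hfree w hw fun i hi => h.eq_zero_of_isOfFinOrder hfin hi
    subst h0
    exact h.ext (HasForm.one j)

variable {j : Fin 4} {P : (Fin 4 → ℤ) → Prop} {Γ : Subgroup (Isom 4)}

theorem halfCoord_mul (hΓ : ∀ γ ∈ Γ, ∃ w, P w ∧ HasForm j w γ) (γ γ' : Γ) :
    halfCoord ((γ * γ' : Γ) : Isom 4)
      = halfCoord γ + signs (halfCoord γ 1) (halfCoord γ j) * halfCoord γ' := by
  obtain ⟨w, -, h⟩ := hΓ γ γ.2
  obtain ⟨w', -, h'⟩ := hΓ γ' γ'.2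
  rw [h.halfCoord_eq, h'.halfCoord_eq]
  exact (h.mul h').halfCoord_eq

theorem hasForm_halfCoord (hΓ : ∀ γ ∈ Γ, ∃ w, P w ∧ HasForm j w γ) (γ : Γ) :
    P (halfCoord γ) ∧ HasForm j (halfCoord γ) γ := by
  obtain ⟨w, hw, h⟩ := hΓ γ γ.2
  rw [h.halfCoord_eq]
  exact ⟨hw, h⟩

/-- The parities of the translation part, a homomorphism. -/
def parityHom (hΓ : ∀ γ ∈ Γ, ∃ w, P w ∧ HasForm j w γ) :
    Γ →* Multiplicative (ZMod 2 × ZMod 2) :=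
  MonoidHom.mk' (fun γ => Multiplicative.ofAdd ((halfCoord γ 1 : ZMod 2), (halfCoord γ j : ZMod 2)))
    (by
      intro γ γ'
      have key : ∀ i, ((halfCoord ((γ * γ' : Γ) : Isom 4) i : ℤ) : ZMod 2)
          = (halfCoord γ i : ZMod 2) + (halfCoord γ' i : ZMod 2) := by
        intro i
        rw [halfCoord_mul hΓ, ← Int.cast_add, ZMod.intCast_eq_intCast_iff_dvd_sub]
        have := even_sign_mul_sub (a := halfCoord γ' i)
          (signs_eq_or (halfCoord γ 1) (halfCoord γ j) i)
        have h2 := even_iff_two_dvd.1 this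
        rw [← dvd_neg] at h2
        refine h2.trans (dvd_of_eq ?_)
        change _ = halfCoord γ i + halfCoord γ' i - (halfCoord γ i
          + signs (halfCoord γ 1) (halfCoord γ j) i * halfCoord γ' i)
        ring
      exact congrArg Multiplicative.ofAdd (Prod.ext (key 1) (key j)))

theorem parityHom_eq_one_iff (hΓ : ∀ γ ∈ Γ, ∃ w, P w ∧ HasForm j w γ) (γ : Γ) :
    parityHom hΓ γ = 1 ↔ ∀ v, lin (γ : Isom 4) v = v := by
  have h := (hasForm_halfCoord hΓ γ).2
  have h1 : parityHom hΓ γ = 1 ↔ Even (halfCoord γ 1) ∧ Even (halfCoord γ j) := by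
    change Multiplicative.ofAdd _ = Multiplicative.ofAdd (0 : ZMod 2 × ZMod 2) ↔ _
    rw [Multiplicative.ofAdd.apply_eq_iff_eq, Prod.mk_eq_zero, ZMod.intCast_eq_zero_iff_even,
      ZMod.intCast_eq_zero_iff_even]
  rw [h1]
  constructor
  · rintro ⟨h2, h3⟩ v
    ext i
    have h4 : signs (halfCoord γ 1) (halfCoord γ j) i = 1 := by
      rw [signs_congr (s' := 0) (t' := 0) (by simpa using h2) (by simpa using h3)]
      fin_cases i <;> simp [signs, par]
    rw [h.lin_apply, h4]
    simp
  · intro h2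
    have h3 : ∀ i, signs (halfCoord γ 1) (halfCoord γ j) i = 1 := by
      intro i
      have h4 := h.lin_apply (basisVec i) i
      have e : (basisVec i : E 4) i = 1 := by simp [basisVec]
      rw [h2, e, mul_one] at h4
      exact Int.cast_eq_one.1 h4.symm
    exact ⟨(par_eq_one_iff _).1 (h3 2), (par_eq_one_iff _).1 (h3 1)⟩

end Groups

/-! ### Abelianizations from generators and an explicit homomorphism -/

section Abelianizations

/-- The classes of the generators span the abelianization and map to the standard generators of the
target. An integer combination mapping to zero has coefficients divisible by the corresponding
orders, and the assumed relations kill it. -/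
theorem nonempty_abelianization_addEquiv_of_three {G : Type} [Group G] {m n : ℕ} (c a b : G)
    (hgen : Subgroup.closure {c, a, b} = (⊤ : Subgroup G))
    (f : G →* Multiplicative (ℤ × ZMod m × ZMod n))
    (hc : f c = Multiplicative.ofAdd (1, 0, 0)) (ha : f a = Multiplicative.ofAdd (0, 1, 0))
    (hb : f b = Multiplicative.ofAdd (0, 0, 1))
    (ham : Abelianization.of a ^ m = 1) (hbn : Abelianization.of b ^ n = 1) :
    Nonempty (Additive (Abelianization G) ≃+ ℤ × ZMod m × ZMod n) := by
  let F : Additive (Abelianization G) →+ ℤ × ZMod m × ZMod n :=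
    MonoidHom.toAdditiveLeft (Abelianization.lift f)
  let q : G → Additive (Abelianization G) := fun g => Additive.ofMul (Abelianization.of g)
  have hF : ∀ g, F (q g) = Multiplicative.toAdd (f g) := fun g => by
    change Multiplicative.toAdd (Abelianization.lift f (Abelianization.of g)) = _
    rw [Abelianization.lift_apply_of]
  have hFc : F (q c) = (1, 0, 0) := by rw [hF, hc]; rfl
  have hFa : F (q a) = (0, 1, 0) := by rw [hF, ha]; rfl
  have hFb : F (q b) = (0, 0, 1) := by rw [hF, hb]; rfl
  have hsum : ∀ x y z : ℤ, F (x • q c + y • q a + z • q b) = (x, (y : ZMod m), (z : ZMod n)) := by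
    intro x y z
    simp [hFc, hFa, hFb]
  have hspan : ∀ g : G, ∃ x y z : ℤ, q g = x • q c + y • q a + z • q b := by
    intro g
    have hg : g ∈ Subgroup.closure {c, a, b} := hgen ▸ Subgroup.mem_top g
    induction hg using Subgroup.closure_induction with
    | mem g h =>
      rcases h with rfl | rfl | rfl
      · exact ⟨1, 0, 0, by simp⟩
      · exact ⟨0, 1, 0, by simp⟩
      · exact ⟨0, 0, 1, by simp⟩
    | one => exact ⟨0, 0, 0, by simp [q]⟩
    | mul g g' _ _ h h' =>
      obtain ⟨x, y, z, h⟩ := h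
      obtain ⟨x', y', z', h'⟩ := h'
      refine ⟨x + x', y + y', z + z', ?_⟩
      have : q (g * g') = q g + q g' := by simp [q]
      rw [this, h, h']
      module
    | inv g _ h =>
      obtain ⟨x, y, z, h⟩ := h
      refine ⟨-x, -y, -z, ?_⟩
      have : q g⁻¹ = -q g := by simp [q]
      rw [this, h]
      module
  have hqa : m • q a = 0 := congrArg Additive.ofMul ham
  have hqb : n • q b = 0 := congrArg Additive.ofMul hbn
  refine ⟨AddEquiv.ofBijective F ⟨(injective_iff_map_eq_zero F).2 fun u hu => ?_, ?_⟩⟩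
  · obtain ⟨g, rfl⟩ : ∃ g, q g = u := QuotientGroup.mk_surjective u
    obtain ⟨x, y, z, h⟩ := hspan g
    rw [h, hsum, Prod.mk_eq_zero, Prod.mk_eq_zero, ZMod.intCast_zmod_eq_zero_iff_dvd,
      ZMod.intCast_zmod_eq_zero_iff_dvd] at hu
    obtain ⟨rfl, ⟨y, rfl⟩, ⟨z, rfl⟩⟩ := hu
    rw [h, mul_comm, mul_zsmul, mul_comm, mul_zsmul, natCast_zsmul, natCast_zsmul, hqa, hqb]
    simp
  · rintro ⟨x, y, z⟩
    obtain ⟨y, rfl⟩ := ZMod.intCast_surjective y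
    obtain ⟨z, rfl⟩ := ZMod.intCast_surjective z
    exact ⟨_, hsum x y z⟩

theorem nonempty_abelianization_addEquiv_of_four {G : Type} [Group G] {m n r : ℕ} (c a b d : G)
    (hgen : Subgroup.closure {c, a, b, d} = (⊤ : Subgroup G))
    (f : G →* Multiplicative (ℤ × ZMod m × ZMod n × ZMod r))
    (hc : f c = Multiplicative.ofAdd (1, 0, 0, 0)) (ha : f a = Multiplicative.ofAdd (0, 1, 0, 0))
    (hb : f b = Multiplicative.ofAdd (0, 0, 1, 0)) (hd : f d = Multiplicative.ofAdd (0, 0, 0, 1))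
    (ham : Abelianization.of a ^ m = 1) (hbn : Abelianization.of b ^ n = 1)
    (hdr : Abelianization.of d ^ r = 1) :
    Nonempty (Additive (Abelianization G) ≃+ ℤ × ZMod m × ZMod n × ZMod r) := by
  let F : Additive (Abelianization G) →+ ℤ × ZMod m × ZMod n × ZMod r :=
    MonoidHom.toAdditiveLeft (Abelianization.lift f)
  let q : G → Additive (Abelianization G) := fun g => Additive.ofMul (Abelianization.of g)
  have hF : ∀ g, F (q g) = Multiplicative.toAdd (f g) := fun g => by
    change Multiplicative.toAdd (Abelianization.lift f (Abelianization.of g)) = _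
    rw [Abelianization.lift_apply_of]
  have hFc : F (q c) = (1, 0, 0, 0) := by rw [hF, hc]; rfl
  have hFa : F (q a) = (0, 1, 0, 0) := by rw [hF, ha]; rfl
  have hFb : F (q b) = (0, 0, 1, 0) := by rw [hF, hb]; rfl
  have hFd : F (q d) = (0, 0, 0, 1) := by rw [hF, hd]; rfl
  have hsum : ∀ x y z t : ℤ, F (x • q c + y • q a + z • q b + t • q d)
      = (x, (y : ZMod m), (z : ZMod n), (t : ZMod r)) := by
    intro x y z t
    simp [hFc, hFa, hFb, hFd]
  have hspan : ∀ g : G, ∃ x y z t : ℤ, q g = x • q c + y • q a + z • q b + t • q d := by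
    intro g
    have hg : g ∈ Subgroup.closure {c, a, b, d} := hgen ▸ Subgroup.mem_top g
    induction hg using Subgroup.closure_induction with
    | mem g h =>
      rcases h with rfl | rfl | rfl | rfl
      · exact ⟨1, 0, 0, 0, by simp⟩
      · exact ⟨0, 1, 0, 0, by simp⟩
      · exact ⟨0, 0, 1, 0, by simp⟩
      · exact ⟨0, 0, 0, 1, by simp⟩
    | one => exact ⟨0, 0, 0, 0, by simp [q]⟩
    | mul g g' _ _ h h' =>
      obtain ⟨x, y, z, t, h⟩ := h
      obtain ⟨x', y', z', t', h'⟩ := h'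
      refine ⟨x + x', y + y', z + z', t + t', ?_⟩
      have : q (g * g') = q g + q g' := by simp [q]
      rw [this, h, h']
      module
    | inv g _ h =>
      obtain ⟨x, y, z, t, h⟩ := h
      refine ⟨-x, -y, -z, -t, ?_⟩
      have : q g⁻¹ = -q g := by simp [q]
      rw [this, h]
      module
  have hqa : m • q a = 0 := congrArg Additive.ofMul ham
  have hqb : n • q b = 0 := congrArg Additive.ofMul hbn
  have hqd : r • q d = 0 := congrArg Additive.ofMul hdr
  refine ⟨AddEquiv.ofBijective F ⟨(injective_iff_map_eq_zero F).2 fun u hu => ?_, ?_⟩⟩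
  · obtain ⟨g, rfl⟩ : ∃ g, q g = u := QuotientGroup.mk_surjective u
    obtain ⟨x, y, z, t, h⟩ := hspan g
    rw [h, hsum, Prod.mk_eq_zero, Prod.mk_eq_zero, Prod.mk_eq_zero,
      ZMod.intCast_zmod_eq_zero_iff_dvd, ZMod.intCast_zmod_eq_zero_iff_dvd,
      ZMod.intCast_zmod_eq_zero_iff_dvd] at hu
    obtain ⟨rfl, ⟨y, rfl⟩, ⟨z, rfl⟩, ⟨t, rfl⟩⟩ := hu
    rw [h, mul_comm, mul_zsmul, mul_comm, mul_zsmul, mul_comm, mul_zsmul, natCast_zsmul,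
      natCast_zsmul, natCast_zsmul, hqa, hqb, hqd]
    simp
  · rintro ⟨x, y, z, t⟩
    obtain ⟨y, rfl⟩ := ZMod.intCast_surjective y
    obtain ⟨z, rfl⟩ := ZMod.intCast_surjective z
    obtain ⟨t, rfl⟩ := ZMod.intCast_surjective t
    exact ⟨_, hsum x y z t⟩

/-- The hypothesis says that `y` conjugates `x` to its inverse; after abelianizing, `x` equals its
inverse. -/
theorem of_sq_eq_one {G : Type} [Group G] {x y : G} (h : x * y * x = y) :
    Abelianization.of x ^ 2 = 1 := by
  have h1 := congrArg Abelianization.of h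
  rw [map_mul, map_mul, mul_right_comm, ← pow_two] at h1
  exact mul_eq_right.1 h1

theorem intTrans_add (k k' : Fin 4 → ℤ) : intTrans (k + k') = intTrans k * intTrans k' := by
  ext x i
  change _ = intTrans k (intTrans k' x) i
  simp only [intTrans_apply, Pi.add_apply, Int.cast_add]
  ring

theorem intTrans_mem {H : Subgroup (Isom 4)} (h : ∀ i, intTrans (Pi.single i 1) ∈ H)
    (k : Fin 4 → ℤ) : intTrans k ∈ H := by
  let φ : (Fin 4 → ℤ) →+ Additive (Isom 4) :=
    AddMonoidHom.mk' (fun k => Additive.ofMul (intTrans k)) fun k k' =>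
      congrArg Additive.ofMul (intTrans_add k k')
  have hk : k ∈ (Subgroup.toAddSubgroup H).comap φ := by
    rw [← Finset.univ_sum_single k]
    refine sum_mem fun i _ => ?_
    have : (Pi.single i (k i) : Fin 4 → ℤ) = k i • Pi.single i (1 : ℤ) := by
      rw [← Pi.single_smul]
      simp
    rw [this]
    have hi : (Pi.single i 1 : Fin 4 → ℤ) ∈ (Subgroup.toAddSubgroup H).comap φ := h i
    exact zsmul_mem hi _
  exact hk

theorem affineIsom_diagSign_apply (S : Finset (Fin 4)) (b x : E 4) (i : Fin 4) :
    affineIsom (diagSign S) b x i = if i ∈ S then -(x i + b i) else x i + b i := by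
  rw [affineIsom_apply]
  change (if i ∈ S then LinearIsometryEquiv.neg ℝ else LinearIsometryEquiv.refl ℝ ℝ)
    ((x + b) i) = _
  split_ifs <;> simp

theorem HasForm.eq {j : Fin 4} {w w' : Fin 4 → ℤ} {γ γ' : Isom 4} (h : HasForm j w γ)
    (h' : HasForm j w' γ') (hw : w = w') : γ = γ' := by
  subst hw
  exact h.ext h'

/-- Parity ignores signs; stated for a sign in the shape given by `par_eq`, which suits linear
arithmetic. -/
theorem add_sign_mul_emod_two (a b s : ℤ) :
    (a + (1 - 2 * s) * b) % 2 = (a % 2 + b % 2) % 2 := by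
  rw [← Int.add_emod, show a + (1 - 2 * s) * b = a + b + 2 * (-(s * b)) by ring,
    Int.add_mul_emod_self_left]

theorem par_eq (a : ℤ) : par a = 1 - 2 * (a % 2) := by
  unfold par
  split_ifs with h
  · rw [Int.even_iff] at h; omega
  · rw [Int.not_even_iff] at h; omega

end Abelianizations

theorem surjective_of_generators {G : Type} [Group G]
    {f : G →* Multiplicative (ZMod 2 × ZMod 2)} {a b : G}
    (ha : f a = Multiplicative.ofAdd (1, 0)) (hb : f b = Multiplicative.ofAdd (0, 1)) :
    Function.Surjective f := by
  intro y
  have : ∀ y : Multiplicative (ZMod 2 × ZMod 2), y = 1 ∨ y = Multiplicative.ofAdd (1, 0) ∨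
      y = Multiplicative.ofAdd (0, 1) ∨
      y = Multiplicative.ofAdd (1, 0) * Multiplicative.ofAdd (0, 1) := by decide
  rcases this y with rfl | rfl | rfl | rfl
  · exact ⟨1, map_one f⟩
  · exact ⟨a, ha⟩
  · exact ⟨b, hb⟩
  · exact ⟨a * b, by rw [map_mul, ha, hb]⟩

/-! ### The group `Γ₁` -/

section FirstGroup

/-- The first generator of `Γ₁`. -/
def gen₁ : Isom 4 := affineIsom B₁ !₂[0, 1/2, 0, 1/2]

/-- The second generator of `Γ₁`. -/
def gen₁' : Isom 4 := affineIsom B₂ !₂[0, 0, 1/2, 0]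

/-- The translation acts before the linear part, so `B₁` negates the last half-step; hence the entry
`-1`. -/
theorem hasForm_gen₁ : HasForm 2 ![0, 1, 0, -1] gen₁ := by
  intro x i
  rw [gen₁, B₁, affineIsom_diagSign_apply]
  fin_cases i <;> (simp [signs, par]; try ring)

theorem hasForm_gen₁' : HasForm 2 ![0, 0, 1, 0] gen₁' := by
  intro x i
  rw [gen₁', B₂, affineIsom_diagSign_apply]
  fin_cases i <;> simp [signs, par]

theorem gen₁_mem : gen₁ ∈ Γ₁ := Subgroup.subset_closure (Or.inl (Or.inl rfl))

theorem gen₁'_mem : gen₁' ∈ Γ₁ := Subgroup.subset_closure (Or.inl (Or.inr rfl))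

theorem intTrans_mem_Γ₁ (k : Fin 4 → ℤ) : intTrans k ∈ Γ₁ :=
  Subgroup.subset_closure (Or.inr ⟨k, rfl⟩)

/-- The invariant records that coordinate `0` has no half-steps and that those in coordinates `1`
and `3` occur together, as in `b₁`. It is what excludes fixed points of elements with linear part
`B₁B₂`. -/
theorem hasForm_Γ₁ : ∀ γ ∈ Γ₁, ∃ w : Fin 4 → ℤ, (Even (w 0) ∧ Even (w 3 - w 1)) ∧
    HasForm 2 w γ := by
  intro γ hγ
  refine exists_hasForm_of_mem_closure (P := fun w => Even (w 0) ∧ Even (w 3 - w 1)) ⟨?_, ?_⟩ ?_ hγ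
  · simp
  · rintro w w' σ hσ ⟨h0, h1⟩ ⟨h0', h1'⟩
    have e0 := even_sign_mul_sub (a := w' 0) (hσ 0)
    have e1 := even_sign_mul_sub (a := w' 1) (hσ 1)
    have e3 := even_sign_mul_sub (a := w' 3) (hσ 3)
    simp only [Pi.add_apply, Pi.mul_apply, Int.even_iff] at *
    omega
  · rintro _ ((rfl | rfl) | ⟨k, rfl⟩)
    · exact ⟨_, by decide, hasForm_gen₁⟩
    · exact ⟨_, by decide, hasForm_gen₁'⟩
    · refine ⟨_, ?_, hasForm_intTrans 2 k⟩
      simp only [Pi.smul_apply, Int.even_iff]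
      simp

theorem isBieberbach_Γ₁ : IsBieberbach Γ₁ := by
  refine isBieberbach_of_hasForm hasForm_Γ₁ intTrans_mem_Γ₁ ?_
  rintro w ⟨h0, h1⟩ h
  have k0 := h 0 rfl
  have k1 := h 1
  have k2 := h 2
  have k3 := h 3
  -- For a nontrivial linear part, an odd entry sits in an unreflected coordinate: `w 1` for `B₁`,
  -- `w 2` for `B₂`, `w 3` (of the parity of `w 1`) for `B₁B₂`.
  simp only [signs, Matrix.cons_val, par_eq, Int.even_iff] at k1 k2 k3 h0 h1
  funext i
  fin_cases i <;> simp <;> omega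

theorem sq_gen₁ : gen₁ * gen₁ = intTrans (Pi.single 1 1) :=
  (hasForm_gen₁.mul hasForm_gen₁).eq (hasForm_intTrans 2 _) (by decide)

theorem sq_gen₁' : gen₁' * gen₁' = intTrans (Pi.single 2 1) :=
  (hasForm_gen₁'.mul hasForm_gen₁').eq (hasForm_intTrans 2 _) (by decide)

theorem closure_Γ₁ : Subgroup.closure {(⟨intTrans (Pi.single 0 1), intTrans_mem_Γ₁ _⟩ : Γ₁),
    ⟨gen₁, gen₁_mem⟩, ⟨gen₁', gen₁'_mem⟩} = ⊤ := by
  set H := Subgroup.closure {(⟨intTrans (Pi.single 0 1), intTrans_mem_Γ₁ _⟩ : Γ₁),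
    ⟨gen₁, gen₁_mem⟩, ⟨gen₁', gen₁'_mem⟩}
  have hT : intTrans (Pi.single 0 1) ∈ H.map Γ₁.subtype :=
    ⟨_, Subgroup.subset_closure (Or.inl rfl), rfl⟩
  have hA : gen₁ ∈ H.map Γ₁.subtype :=
    ⟨_, Subgroup.subset_closure (Or.inr (Or.inl rfl)), rfl⟩
  have hB : gen₁' ∈ H.map Γ₁.subtype :=
    ⟨_, Subgroup.subset_closure (Or.inr (Or.inr rfl)), rfl⟩
  have hle : Γ₁ ≤ H.map Γ₁.subtype := by
    refine (Subgroup.closure_le _).2 ?_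
    rintro _ ((rfl | rfl) | ⟨k, rfl⟩)
    · exact hA
    · exact hB
    · refine intTrans_mem (fun i => ?_) k
      fin_cases i
      · exact hT
      · exact sq_gen₁ ▸ mul_mem hA hA
      · exact sq_gen₁' ▸ mul_mem hB hB
      -- The linear part of `gen₁ * gen₁'` fixes coordinates `0` and `3`; its square is translation
      -- by minus the last basis vector.
      · have h : intTrans (Pi.single 3 1) = (gen₁ * gen₁' * (gen₁ * gen₁'))⁻¹ :=
          (hasForm_intTrans 2 _).eq ((hasForm_gen₁.mul hasForm_gen₁').mul
            (hasForm_gen₁.mul hasForm_gen₁')).inv (by decide)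
        exact h ▸ inv_mem (mul_mem (mul_mem hA hB) (mul_mem hA hB))
  refine (Subgroup.eq_top_iff' _).2 fun γ => ?_
  obtain ⟨γ', h, h'⟩ := hle γ.2
  rwa [← Subtype.ext h']

/-- The abelianization homomorphism of `Γ₁`. -/
def abelHom₁ : Γ₁ →* Multiplicative (ℤ × ZMod 4 × ZMod 4) :=
  -- On the lattice the last basis vector must go to `(0, 2, 2)`, being the square of `(gen₁
  -- gen₁')⁻¹`; this forces `w 3` into both finite components. The term `w 1 % 2` sends `gen₁` to
  -- `(0, 1, 0)`. The product of parities corrects the sign of `w 2` when the linear part is `B₁B₂`.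
  MonoidHom.mk' (fun γ => Multiplicative.ofAdd (halfCoord γ 0 / 2,
      ((halfCoord γ 1 + halfCoord γ 3 + halfCoord γ 1 % 2 : ℤ) : ZMod 4),
      ((halfCoord γ 2 + halfCoord γ 3 + halfCoord γ 1 % 2
        + 2 * ((halfCoord γ 1 % 2) * (halfCoord γ 2 % 2)) : ℤ) : ZMod 4)))
    (by
      intro γ γ'
      rw [halfCoord_mul hasForm_Γ₁, ← ofAdd_add]
      obtain ⟨h0, h1⟩ := (hasForm_halfCoord hasForm_Γ₁ γ).1
      obtain ⟨h0', h1'⟩ := (hasForm_halfCoord hasForm_Γ₁ γ').1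
      generalize halfCoord γ = w at *
      generalize halfCoord γ' = w' at *
      simp only [Int.even_iff] at h0 h1 h0' h1'
      refine congrArg Multiplicative.ofAdd (Prod.ext ?_ (Prod.ext ?_ ?_))
      · simp [signs]
        omega
      all_goals
        change ((_ : ℤ) : ZMod 4) = ((_ : ℤ) : ZMod 4) + ((_ : ℤ) : ZMod 4)
        rw [← Int.cast_add, ← sub_eq_zero, ← Int.cast_sub, ZMod.intCast_zmod_eq_zero_iff_dvd]
        simp only [Pi.add_apply, Pi.mul_apply, signs, Matrix.cons_val, par_eq]
        rw [Int.add_emod (w 1) (w 2)]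
        simp only [add_sign_mul_emod_two]
        -- Once the four relevant parities are fixed, all signs are constants and the claim is
        -- linear modulo `4`.
        obtain h | h := Int.emod_two_eq_zero_or_one (w 1) <;>
        obtain k | k := Int.emod_two_eq_zero_or_one (w 2) <;>
        obtain h' | h' := Int.emod_two_eq_zero_or_one (w' 1) <;>
        obtain k' | k' := Int.emod_two_eq_zero_or_one (w' 2) <;>
        simp [h, k, h', k'] <;> omega)

theorem abelHom₁_apply {w : Fin 4 → ℤ} {γ : Γ₁} (h : HasForm 2 w γ) :
    abelHom₁ γ = Multiplicative.ofAdd (w 0 / 2, ((w 1 + w 3 + w 1 % 2 : ℤ) : ZMod 4),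
      ((w 2 + w 3 + w 1 % 2 + 2 * ((w 1 % 2) * (w 2 % 2)) : ℤ) : ZMod 4)) := by
  rw [← h.halfCoord_eq]
  rfl

theorem nonempty_abelianization_Γ₁ :
    Nonempty (Additive (Abelianization Γ₁) ≃+ ℤ × ZMod 4 × ZMod 4) := by
  -- Each generator inverts the translation that is the square of the other, so both squares have
  -- order dividing `2` in the abelianization and both generators order dividing `4`.
  have e1 : intTrans (Pi.single 1 1) * gen₁' * intTrans (Pi.single 1 1) = gen₁' :=
    (((hasForm_intTrans 2 _).mul hasForm_gen₁').mul (hasForm_intTrans 2 _)).eq hasForm_gen₁'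
      (by decide)
  have e2 : intTrans (Pi.single 2 1) * gen₁ * intTrans (Pi.single 2 1) = gen₁ :=
    (((hasForm_intTrans 2 _).mul hasForm_gen₁).mul (hasForm_intTrans 2 _)).eq hasForm_gen₁
      (by decide)
  refine nonempty_abelianization_addEquiv_of_three _ _ _ closure_Γ₁ abelHom₁
    ((abelHom₁_apply (hasForm_intTrans 2 (Pi.single 0 1))).trans (by decide))
    ((abelHom₁_apply hasForm_gen₁).trans (by decide))
    ((abelHom₁_apply hasForm_gen₁').trans (by decide)) ?_ ?_
  · have h : (⟨intTrans (Pi.single 1 1), intTrans_mem_Γ₁ _⟩ : Γ₁) = ⟨gen₁, gen₁_mem⟩ ^ 2 :=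
      Subtype.ext (sq_gen₁.symm.trans (pow_two _).symm)
    have := of_sq_eq_one (x := (⟨_, intTrans_mem_Γ₁ (Pi.single 1 1)⟩ : Γ₁))
      (y := ⟨gen₁', gen₁'_mem⟩) (Subtype.ext e1)
    rwa [h, map_pow, ← pow_mul] at this
  · have h : (⟨intTrans (Pi.single 2 1), intTrans_mem_Γ₁ _⟩ : Γ₁) = ⟨gen₁', gen₁'_mem⟩ ^ 2 :=
      Subtype.ext (sq_gen₁'.symm.trans (pow_two _).symm)
    have := of_sq_eq_one (x := (⟨_, intTrans_mem_Γ₁ (Pi.single 2 1)⟩ : Γ₁))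
      (y := ⟨gen₁, gen₁_mem⟩) (Subtype.ext e2)
    rwa [h, map_pow, ← pow_mul] at this

theorem parityHom_Γ₁_surjective : Function.Surjective (parityHom hasForm_Γ₁) := by
  have hA : parityHom hasForm_Γ₁ ⟨gen₁, gen₁_mem⟩ = Multiplicative.ofAdd (1, 0) := by
    change Multiplicative.ofAdd (((halfCoord gen₁ 1 : ℤ) : ZMod 2),
      ((halfCoord gen₁ 2 : ℤ) : ZMod 2)) = _
    rw [hasForm_gen₁.halfCoord_eq]
    decide
  have hB : parityHom hasForm_Γ₁ ⟨gen₁', gen₁'_mem⟩ = Multiplicative.ofAdd (0, 1) := by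
    change Multiplicative.ofAdd (((halfCoord gen₁' 1 : ℤ) : ZMod 2),
      ((halfCoord gen₁' 2 : ℤ) : ZMod 2)) = _
    rw [hasForm_gen₁'.halfCoord_eq]
    decide
  exact surjective_of_generators hA hB

theorem isSignDiag_Γ₁ : ∀ γ ∈ Γ₁, IsSignDiag γ := fun γ hγ => by
  obtain ⟨w, -, h⟩ := hasForm_Γ₁ γ hγ
  exact h.isSignDiag

end FirstGroup

/-! ### The group `Γ₂` -/

section SecondGroup

/-- The first generator of `Γ₂`. -/
def gen₂ : Isom 4 := affineIsom B₁ !₂[0, 1/2, 0, 0]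

/-- The second generator of `Γ₂`. -/
def gen₂' : Isom 4 := affineIsom B₂ !₂[1/2, 0, 0, 0]

theorem hasForm_gen₂ : HasForm 0 ![0, 1, 0, 0] gen₂ := by
  intro x i
  rw [gen₂, B₁, affineIsom_diagSign_apply]
  fin_cases i <;> simp [signs, par]

theorem hasForm_gen₂' : HasForm 0 ![1, 0, 0, 0] gen₂' := by
  intro x i
  rw [gen₂', B₂, affineIsom_diagSign_apply]
  fin_cases i <;> simp [signs, par]

theorem gen₂_mem : gen₂ ∈ Γ₂ := Subgroup.subset_closure (Or.inl (Or.inl rfl))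

theorem gen₂'_mem : gen₂' ∈ Γ₂ := Subgroup.subset_closure (Or.inl (Or.inr rfl))

theorem intTrans_mem_Γ₂ (k : Fin 4 → ℤ) : intTrans k ∈ Γ₂ :=
  Subgroup.subset_closure (Or.inr ⟨k, rfl⟩)

/-- All half-steps occur in coordinates `0` and `1`, so here the parities of `w 1` and `w 0` carry
the signs. -/
theorem hasForm_Γ₂ : ∀ γ ∈ Γ₂, ∃ w : Fin 4 → ℤ, (Even (w 2) ∧ Even (w 3)) ∧
    HasForm 0 w γ := by
  intro γ hγ
  refine exists_hasForm_of_mem_closure (P := fun w => Even (w 2) ∧ Even (w 3)) ⟨?_, ?_⟩ ?_ hγ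
  · simp
  · rintro w w' σ hσ ⟨h2, h3⟩ ⟨h2', h3'⟩
    have e2 := even_sign_mul_sub (a := w' 2) (hσ 2)
    have e3 := even_sign_mul_sub (a := w' 3) (hσ 3)
    simp only [Pi.add_apply, Pi.mul_apply, Int.even_iff] at *
    omega
  · rintro _ ((rfl | rfl) | ⟨k, rfl⟩)
    · exact ⟨_, by decide, hasForm_gen₂⟩
    · exact ⟨_, by decide, hasForm_gen₂'⟩
    · refine ⟨_, ?_, hasForm_intTrans 0 k⟩
      simp only [Pi.smul_apply, Int.even_iff]
      simp

theorem isBieberbach_Γ₂ : IsBieberbach Γ₂ := by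
  refine isBieberbach_of_hasForm hasForm_Γ₂ intTrans_mem_Γ₂ ?_
  rintro w ⟨h0, h1⟩ h
  have k0 := h 0 rfl
  have k1 := h 1
  have k2 := h 2
  have k3 := h 3
  -- If `w 0` is odd, the never reflected coordinate `0` is displaced; otherwise an odd `w 1` means
  -- linear part `B₁`, which leaves coordinate `1` unreflected.
  simp only [signs, Matrix.cons_val, par_eq, Int.even_iff] at k1 k2 k3 h0 h1
  funext i
  fin_cases i <;> simp <;> omega

theorem sq_gen₂ : gen₂ * gen₂ = intTrans (Pi.single 1 1) :=
  (hasForm_gen₂.mul hasForm_gen₂).eq (hasForm_intTrans 0 _) (by decide)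

theorem sq_gen₂' : gen₂' * gen₂' = intTrans (Pi.single 0 1) :=
  (hasForm_gen₂'.mul hasForm_gen₂').eq (hasForm_intTrans 0 _) (by decide)

theorem closure_Γ₂ : Subgroup.closure {(⟨gen₂', gen₂'_mem⟩ : Γ₂), ⟨gen₂, gen₂_mem⟩,
    ⟨intTrans (Pi.single 2 1), intTrans_mem_Γ₂ _⟩,
    ⟨intTrans (Pi.single 3 1), intTrans_mem_Γ₂ _⟩} = ⊤ := by
  set H := Subgroup.closure {(⟨gen₂', gen₂'_mem⟩ : Γ₂), ⟨gen₂, gen₂_mem⟩,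
    ⟨intTrans (Pi.single 2 1), intTrans_mem_Γ₂ _⟩, ⟨intTrans (Pi.single 3 1), intTrans_mem_Γ₂ _⟩}
  have hB : gen₂' ∈ H.map Γ₂.subtype :=
    ⟨_, Subgroup.subset_closure (Or.inl rfl), rfl⟩
  have hA : gen₂ ∈ H.map Γ₂.subtype :=
    ⟨_, Subgroup.subset_closure (Or.inr (Or.inl rfl)), rfl⟩
  have hle : Γ₂ ≤ H.map Γ₂.subtype := by
    refine (Subgroup.closure_le _).2 ?_
    rintro _ ((rfl | rfl) | ⟨k, rfl⟩)
    · exact hA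
    · exact hB
    · refine intTrans_mem (fun i => ?_) k
      fin_cases i
      · exact sq_gen₂' ▸ mul_mem hB hB
      · exact sq_gen₂ ▸ mul_mem hA hA
      · exact ⟨_, Subgroup.subset_closure (Or.inr (Or.inr (Or.inl rfl))), rfl⟩
      · exact ⟨_, Subgroup.subset_closure (Or.inr (Or.inr (Or.inr rfl))), rfl⟩
  refine (Subgroup.eq_top_iff' _).2 fun γ => ?_
  obtain ⟨γ', h, h'⟩ := hle γ.2
  rwa [← Subtype.ext h']

/-- The abelianization homomorphism of `Γ₂`. -/
def abelHom₂ : Γ₂ →* Multiplicative (ℤ × ZMod 2 × ZMod 2 × ZMod 2) :=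
  -- Coordinate `0` is never reflected, so `w 0` is additive over `ℤ`. The others are additive only
  -- up to sign, which disappears modulo `2`.
  MonoidHom.mk' (fun γ => Multiplicative.ofAdd (halfCoord γ 0, ((halfCoord γ 1 : ℤ) : ZMod 2),
      ((halfCoord γ 2 / 2 : ℤ) : ZMod 2), ((halfCoord γ 3 / 2 : ℤ) : ZMod 2)))
    (by
      intro γ γ'
      rw [halfCoord_mul hasForm_Γ₂, ← ofAdd_add]
      obtain ⟨h0, h1⟩ := (hasForm_halfCoord hasForm_Γ₂ γ).1
      obtain ⟨h0', h1'⟩ := (hasForm_halfCoord hasForm_Γ₂ γ').1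
      generalize halfCoord γ = w at *
      generalize halfCoord γ' = w' at *
      simp only [Int.even_iff] at h0 h1 h0' h1'
      refine congrArg Multiplicative.ofAdd (Prod.ext ?_ (Prod.ext ?_ (Prod.ext ?_ ?_)))
      · simp [signs]
      all_goals
        change ((_ : ℤ) : ZMod 2) = ((_ : ℤ) : ZMod 2) + ((_ : ℤ) : ZMod 2)
        rw [← Int.cast_add, ← sub_eq_zero, ← Int.cast_sub, ZMod.intCast_zmod_eq_zero_iff_dvd]
        simp only [Pi.add_apply, Pi.mul_apply, signs, Matrix.cons_val, par_eq]
        try rw [Int.add_emod (w 1) (w 0)]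
        obtain h | h := Int.emod_two_eq_zero_or_one (w 1) <;>
        obtain k | k := Int.emod_two_eq_zero_or_one (w 0) <;>
        simp [h, k] <;> omega)

theorem abelHom₂_apply {w : Fin 4 → ℤ} {γ : Γ₂} (h : HasForm 0 w γ) :
    abelHom₂ γ = Multiplicative.ofAdd (w 0, ((w 1 : ℤ) : ZMod 2), ((w 2 / 2 : ℤ) : ZMod 2),
      ((w 3 / 2 : ℤ) : ZMod 2)) := by
  rw [← h.halfCoord_eq]
  rfl

theorem nonempty_abelianization_Γ₂ :
    Nonempty (Additive (Abelianization Γ₂) ≃+ ℤ × ZMod 2 × ZMod 2 × ZMod 2) := by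
  -- In each of the three relations the outer element is inverted by conjugation, so its class has
  -- order dividing `2`. No such relation limits `gen₂'`, which maps to the generator of `ℤ`.
  have e1 : gen₂ * gen₂' * gen₂ = gen₂' :=
    ((hasForm_gen₂.mul hasForm_gen₂').mul hasForm_gen₂).eq hasForm_gen₂' (by decide)
  have e2 : intTrans (Pi.single 2 1) * gen₂ * intTrans (Pi.single 2 1) = gen₂ :=
    (((hasForm_intTrans 0 _).mul hasForm_gen₂).mul (hasForm_intTrans 0 _)).eq hasForm_gen₂
      (by decide)
  have e3 : intTrans (Pi.single 3 1) * gen₂ * intTrans (Pi.single 3 1) = gen₂ :=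
    (((hasForm_intTrans 0 _).mul hasForm_gen₂).mul (hasForm_intTrans 0 _)).eq hasForm_gen₂
      (by decide)
  exact nonempty_abelianization_addEquiv_of_four _ _ _ _ closure_Γ₂ abelHom₂
    ((abelHom₂_apply hasForm_gen₂').trans (by decide))
    ((abelHom₂_apply hasForm_gen₂).trans (by decide))
    ((abelHom₂_apply (hasForm_intTrans 0 (Pi.single 2 1))).trans (by decide))
    ((abelHom₂_apply (hasForm_intTrans 0 (Pi.single 3 1))).trans (by decide))
    (of_sq_eq_one (y := ⟨gen₂', gen₂'_mem⟩) (Subtype.ext e1))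
    (of_sq_eq_one (y := ⟨gen₂, gen₂_mem⟩) (Subtype.ext e2))
    (of_sq_eq_one (y := ⟨gen₂, gen₂_mem⟩) (Subtype.ext e3))

theorem parityHom_Γ₂_surjective : Function.Surjective (parityHom hasForm_Γ₂) := by
  have hA : parityHom hasForm_Γ₂ ⟨gen₂, gen₂_mem⟩ = Multiplicative.ofAdd (1, 0) := by
    change Multiplicative.ofAdd (((halfCoord gen₂ 1 : ℤ) : ZMod 2),
      ((halfCoord gen₂ 0 : ℤ) : ZMod 2)) = _
    rw [hasForm_gen₂.halfCoord_eq]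
    decide
  have hB : parityHom hasForm_Γ₂ ⟨gen₂', gen₂'_mem⟩ = Multiplicative.ofAdd (0, 1) := by
    change Multiplicative.ofAdd (((halfCoord gen₂' 1 : ℤ) : ZMod 2),
      ((halfCoord gen₂' 0 : ℤ) : ZMod 2)) = _
    rw [hasForm_gen₂'.halfCoord_eq]
    decide
  exact surjective_of_generators hA hB

theorem isSignDiag_Γ₂ : ∀ γ ∈ Γ₂, IsSignDiag γ := fun γ hγ => by
  obtain ⟨w, -, h⟩ := hasForm_Γ₂ γ hγ
  exact h.isSignDiag

end SecondGroup

/-! ### Distinguishing the homology groups -/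

section Comparison

/-- The groups `ℤ × ℤ₄²` and `ℤ × ℤ₂³` are not isomorphic. -/
theorem isEmpty_addEquiv :
    IsEmpty ((ℤ × ZMod 4 × ZMod 4) ≃+ (ℤ × ZMod 2 × ZMod 2 × ZMod 2)) := by
  refine ⟨fun e => ?_⟩
  have h1 : (4 : ℕ) • e (0, 1, 0) = 0 := by
    rw [← map_nsmul]
    exact (congrArg e (by decide)).trans (map_zero e)
  -- In the target, an element killed by `4` has zero integer component and is already killed by
  -- `2`; `(0, 1, 0)` in the source is not.
  have h2 : (2 : ℕ) • e (0, 1, 0) = 0 := by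
    generalize e (0, 1, 0) = u at h1 ⊢
    obtain ⟨a, b, c, d⟩ := u
    have ha : (4 : ℕ) • a = 0 := congrArg Prod.fst h1
    have ha' : a = 0 := by simpa using ha
    subst ha'
    have : ∀ t : ZMod 2, (2 : ℕ) • t = 0 := by decide
    simp [this]
  rw [← map_nsmul] at h2
  have h3 := e.injective (h2.trans (map_zero e).symm)
  exact absurd h3 (by decide)

theorem nonempty_H1_addEquiv_of_homeomorph {X Y : Type} [TopologicalSpace X] [TopologicalSpace Y]
    (e : X ≃ₜ Y) : Nonempty (H1 X ≃+ H1 Y) :=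
  ⟨(((AlgebraicTopology.singularHomologyFunctor (ModuleCat.{0} ℤ) 1).obj
    (ModuleCat.of ℤ ℤ)).mapIso (TopCat.isoOfHomeo (X := TopCat.of X) (Y := TopCat.of Y)
      e)).toLinearEquiv.toAddEquiv⟩

end Comparison

/-! ### Weighted means along segments -/

section Smearing

open MeasureTheory intervalIntegral

variable {n p : ℕ} {F G : Type} [NormedAddCommGroup F] [NormedSpace ℝ F]
  [NormedAddCommGroup G] [NormedSpace ℝ G]

/-- The weighted mean of a function along the segment from `x + a e` to `x + b e`. -/
def smear (k : ℝ → ℝ) (a b : ℝ) (e : E n) (f : E n → F) : E n → F :=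
  fun x => ∫ u in a..b, k u • f (x + u • e)

variable {k : ℝ → ℝ} {a b : ℝ} {e : E n} {f : E n → F}

theorem continuous_smear_integrand (hk : Continuous k) (hf : Continuous f) (x e : E n) :
    Continuous fun u : ℝ => k u • f (x + u • e) := by fun_prop

/-- Differentiation under the integral sign, dominated by the bound of the continuous derivative on
a compact ball times the segment. -/
theorem hasFDerivAt_smear (hk : Continuous k) (hf : ContDiff ℝ 1 f) (x : E n) :
    HasFDerivAt (smear k a b e f) (smear k a b e (fderiv ℝ f) x) x := by
  have hf' : Continuous (fderiv ℝ f) := hf.continuous_fderiv one_ne_zero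
  have hc : Continuous fun q : E n × ℝ => k q.2 • fderiv ℝ f (q.1 + q.2 • e) := by fun_prop
  obtain ⟨C, hC⟩ := ((isCompact_closedBall x 1).prod (isCompact_uIcc (a := a) (b := b))).exists_bound_of_continuousOn
      hc.continuousOn
  refine (hasFDerivAt_integral_of_dominated_of_fderiv_le (μ := volume) (bound := fun _ => C)
    (F := fun x u => k u • f (x + u • e)) (F' := fun x u => k u • fderiv ℝ f (x + u • e))
    (Metric.ball_mem_nhds x one_pos) ?_ ?_ ?_ ?_ ?_ ?_)
  · exact Eventually.of_forall fun y =>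
      (continuous_smear_integrand hk hf.continuous y e).aestronglyMeasurable
  · exact (continuous_smear_integrand hk hf.continuous x e).intervalIntegrable _ _
  · exact (continuous_smear_integrand hk hf' x e).aestronglyMeasurable
  · exact Eventually.of_forall fun u hu y hy =>
      hC (y, u) ⟨Metric.ball_subset_closedBall hy, uIoc_subset_uIcc hu⟩
  · exact intervalIntegrable_const
  · refine Eventually.of_forall fun u _ y _ => ?_
    exact ((hf.differentiable one_ne_zero _).hasFDerivAt.comp y
      ((hasFDerivAt_id y).add_const (u • e))).const_smul (k u)

theorem fderiv_smear (hk : Continuous k) (hf : ContDiff ℝ 1 f) :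
    fderiv ℝ (smear k a b e f) = smear k a b e (fderiv ℝ f) :=
  funext fun x => (hasFDerivAt_smear hk hf x).fderiv

theorem contDiff_smear [CompleteSpace F] (hk : Continuous k) (hf : ContDiff ℝ ∞ f) :
    ContDiff ℝ ∞ (smear k a b e f) := by
  -- The codomain varies in the induction because the derivative takes values in another space.
  have key : ∀ (m : ℕ) {H : Type} [NormedAddCommGroup H] [NormedSpace ℝ H] [CompleteSpace H]
      {g : E n → H}, ContDiff ℝ ∞ g → ContDiff ℝ m (smear k a b e g) := by
    intro m
    induction m with
    | zero =>
      intro H _ _ _ g hg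
      refine contDiff_zero.2 (continuous_iff_continuousAt.2 fun x => ?_)
      exact (hasFDerivAt_smear hk (hg.of_le (by simp)) x).continuousAt
    | succ m ih =>
      intro H _ _ _ g hg
      have h1 : ContDiff ℝ 1 g := hg.of_le (by simp)
      rw [show ((m + 1 : ℕ) : WithTop ℕ∞) = (m : WithTop ℕ∞) + 1 by simp,
        contDiff_succ_iff_fderiv]
      refine ⟨fun x => (hasFDerivAt_smear hk h1 x).differentiableAt, by simp, ?_⟩
      rw [fderiv_smear hk h1]
      exact ih (hg.fderiv_right (m := ∞) (by simp))
  exact contDiff_infty.2 fun m => key m hf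

theorem smear_clm_comp [CompleteSpace F] [CompleteSpace G] (hk : Continuous k) (hf : Continuous f) (L : F →L[ℝ] G) :
    smear k a b e (fun x => L (f x)) = fun x => L (smear k a b e f x) := by
  funext x
  have h := L.intervalIntegral_comp_comm (μ := volume)
    ((continuous_smear_integrand hk hf x e).intervalIntegrable a b)
  simp only [map_smul] at h
  exact h

theorem pderiv_smear [CompleteSpace F] (hk : Continuous k) (hf : ContDiff ℝ ∞ f) (i : Fin n) :
    pderiv i (smear k a b e f) = smear k a b e (pderiv i f) := by
  have h1 : ContDiff ℝ 1 f := hf.of_le (by simp)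
  have h2 := smear_clm_comp (a := a) (b := b) (e := e) hk (h1.continuous_fderiv one_ne_zero)
    (ContinuousLinearMap.apply ℝ F (basisVec i))
  funext x
  have h3 := congrFun h2 x
  simp only [ContinuousLinearMap.apply_apply] at h3
  rw [pderiv, fderiv_smear hk h1]
  exact h3.symm

theorem extDeriv_smear (hk : Continuous k) {η : E n → E n [⋀^Fin p]→L[ℝ] ℝ}
    (hη : ContDiff ℝ ∞ η) :
    extDeriv (smear k a b e η) = smear k a b e (extDeriv η) := by
  have h1 : ContDiff ℝ 1 η := hη.of_le (by simp)
  have h2 := smear_clm_comp (a := a) (b := b) (e := e) hk (h1.continuous_fderiv one_ne_zero)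
    (ContinuousAlternatingMap.alternatizeUncurryFinCLM ℝ (E n) ℝ (n := p))
  funext x
  rw [extDeriv, fderiv_smear hk h1]
  exact (congrFun h2 x).symm

theorem smear_add (hk : Continuous k) {g : E n → F} (hf : Continuous f) (hg : Continuous g) :
    smear k a b e (f + g) = smear k a b e f + smear k a b e g := by
  funext x
  simp only [smear, Pi.add_apply, smul_add]
  exact integral_add ((continuous_smear_integrand hk hf x e).intervalIntegrable _ _)
    ((continuous_smear_integrand hk hg x e).intervalIntegrable _ _)

theorem smear_smul (c : ℝ) : smear k a b e (c • f) = c • smear k a b e f := by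
  funext x
  simp only [smear, Pi.smul_apply, smul_comm _ c]
  exact integral_smul c _

theorem smear_zero : smear k a b e (0 : E n → F) = 0 := by
  funext x
  simp [smear]

theorem smear_smul_kernel (c : ℝ) : smear (c • k) a b e f = c • smear k a b e f := by
  funext x
  simp only [smear, Pi.smul_apply, smul_assoc]
  exact integral_smul c _

theorem coordLaplacian_smear [CompleteSpace F] (hk : Continuous k) (hf : ContDiff ℝ ∞ f) :
    coordLaplacian (smear k a b e f) = smear k a b e (coordLaplacian f) := by
  have h : ∀ g : E n → F, coordLaplacian g = ∑ i, pderiv i (pderiv i g) := fun g => by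
    funext x
    simp [coordLaplacian]
  have hsum : ∀ s : Finset (Fin n), smear k a b e (∑ i ∈ s, pderiv i (pderiv i f))
      = ∑ i ∈ s, smear k a b e (pderiv i (pderiv i f)) := by
    intro s
    induction s using Finset.induction_on with
    | empty => simpa using smear_zero
    | insert i s hi ih =>
      rw [Finset.sum_insert hi, Finset.sum_insert hi, ← ih, smear_add hk]
      · exact (contDiff_pderiv (contDiff_pderiv hf i) i).continuous
      · rw [Finset.sum_fn]
        exact continuous_finsetSum _ fun i _ => (contDiff_pderiv (contDiff_pderiv hf i) i).continuous
  rw [h, h, hsum]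
  refine Finset.sum_congr rfl fun i _ => ?_
  rw [pderiv_smear hk hf, pderiv_smear hk (contDiff_pderiv hf i)]

/-- Integration by parts. -/
theorem pderiv_smear_self [CompleteSpace F] {k' : ℝ → ℝ} (hk : ∀ u, HasDerivAt k (k' u) u) (hk' : Continuous k')
    (hf : ContDiff ℝ ∞ f) (c : ℝ) (i : Fin n) (x : E n) :
    c • pderiv i (smear k a b (c • basisVec i) f) x
      = k b • f (x + b • c • basisVec i) - k a • f (x + a • c • basisVec i)
        - smear k' a b (c • basisVec i) f x := by
  have hkc : Continuous k := continuous_iff_continuousAt.2 fun u => (hk u).continuousAt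
  have hd : ∀ u : ℝ, HasDerivAt (fun u : ℝ => f (x + u • c • basisVec i))
      (c • pderiv i f (x + u • c • basisVec i)) u := by
    intro u
    have h1 : HasDerivAt (fun u : ℝ => x + u • c • (basisVec i : E n)) (c • basisVec i) u := by
      simpa using ((hasDerivAt_id u).smul_const (c • (basisVec i : E n))).const_add x
    have h2 := (hf.differentiableAt_infty (x + u • c • basisVec i)).hasFDerivAt.comp_hasDerivAt u h1
    rw [map_smul] at h2
    exact h2
  have hpc := (contDiff_pderiv hf i).continuous
  have h := integral_smul_deriv_eq_deriv_smul (a := a) (b := b) (fun u _ => hk u) (fun u _ => hd u)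
    (hk'.intervalIntegrable _ _) (Continuous.intervalIntegrable (by fun_prop) _ _)
  rw [pderiv_smear hkc hf]
  refine Eq.trans ?_ h
  simp only [smear]
  rw [← intervalIntegral.integral_smul]
  simp only [smul_comm c]

theorem smear_comp_isom (γ : Isom n) (x : E n) :
    smear k a b e (fun x => f (γ x)) x = smear k a b (lin γ e) f (γ x) := by
  simp only [smear]
  congr 1
  funext u
  have : γ (x + u • e) = γ x + u • lin γ e := by
    have h1 := γ.map_vadd x (u • e)
    simp only [vadd_eq_add, map_smul] at h1
    rw [add_comm x, h1, add_comm]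
    rfl
  rw [this]

end Smearing

/-! ### Averaging over periods and its homotopy to the identity -/

section Averaging

variable {n p : ℕ} {F : Type} [NormedAddCommGroup F] [NormedSpace ℝ F]

/-- The mean of a function over a unit segment centred at the point, in the `i`-th direction. -/
def mean (i : Fin n) (f : E n → F) : E n → F :=
  -- Two half-segments in opposite directions: a reflection of the `i`-th coordinate swaps them,
  -- which keeps means of invariant forms invariant.
  smear 1 0 (1 / 2) ((1 : ℝ) • basisVec i) f + smear 1 0 (1 / 2) ((-1 : ℝ) • basisVec i) f

variable {f : E n → F}

theorem contDiff_mean [CompleteSpace F] (hf : ContDiff ℝ ∞ f) (i : Fin n) : ContDiff ℝ ∞ (mean i f) :=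
  (contDiff_smear continuous_one hf).add (contDiff_smear continuous_one hf)

theorem pderiv_mean [CompleteSpace F] (hf : ContDiff ℝ ∞ f) (i j : Fin n) :
    pderiv j (mean i f) = mean i (pderiv j f) := by
  have h : ∀ e, ContDiff ℝ ∞ (smear 1 0 (1 / 2) e f) := fun e => contDiff_smear continuous_one hf
  rw [mean, pderiv_add (h _) (h _), pderiv_smear continuous_one hf,
    pderiv_smear continuous_one hf]
  rfl

theorem extDeriv_mean {η : E n → E n [⋀^Fin p]→L[ℝ] ℝ} (hη : ContDiff ℝ ∞ η) (i : Fin n) :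
    extDeriv (mean i η) = mean i (extDeriv η) := by
  have h : ∀ e, ContDiff ℝ ∞ (smear 1 0 (1 / 2) e η) := fun e => contDiff_smear continuous_one hη
  rw [mean, mean, ← extDeriv_smear continuous_one hη, ← extDeriv_smear continuous_one hη]
  funext x
  exact extDeriv_add ((h _).differentiableAt_infty x) ((h _).differentiableAt_infty x)

theorem smear_const [CompleteSpace F] (k : ℝ → ℝ) (a b : ℝ) (e : E n) (c : F) :
    smear k a b e (fun _ => c) = fun _ => (∫ u in a..b, k u) • c := by
  funext x
  exact intervalIntegral.integral_smul_const _ _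

theorem mean_const [CompleteSpace F] (i : Fin n) (c : F) : mean i (fun _ : E n => c) = fun _ => c := by
  rw [mean, smear_const, smear_const]
  funext x
  simp only [Pi.add_apply, Pi.one_apply, intervalIntegral.integral_const, ← add_smul]
  norm_num

/-- The derivative of the mean is the difference of values at the two ends of a unit segment, which
periodicity makes zero. -/
theorem pderiv_mean_self [CompleteSpace F] (hf : ContDiff ℝ ∞ f) {i : Fin n} (hper : ∀ x, f (x + basisVec i) = f x) :
    pderiv i (mean i f) = 0 := by
  have h : ∀ e, ContDiff ℝ ∞ (smear 1 0 (1 / 2) e f) := fun e => contDiff_smear continuous_one hf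
  have h1 : ∀ u : ℝ, HasDerivAt (1 : ℝ → ℝ) ((0 : ℝ → ℝ) u) u := fun u => hasDerivAt_const u (1 : ℝ)
  have hz : ∀ (e x : E n), smear (0 : ℝ → ℝ) 0 (1 / 2) e f x = 0 := fun e x => by simp [smear]
  funext x
  have hp := pderiv_smear_self (a := 0) (b := 1 / 2) h1 continuous_const hf 1 i x
  have hm := pderiv_smear_self (a := 0) (b := 1 / 2) h1 continuous_const hf (-1) i x
  rw [mean, pderiv_add (h _) (h _), Pi.add_apply]
  rw [hz] at hp hm
  have e1 : x + (1 / 2 : ℝ) • (1 : ℝ) • (basisVec i : E n)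
      = x + (1 / 2 : ℝ) • (-1 : ℝ) • basisVec i + basisVec i := by module
  rw [e1, hper] at hp
  have hp' := congrArg₂ (· - ·) hp hm
  simp only [Pi.one_apply, one_smul, zero_smul, add_zero, sub_zero] at hp' ⊢
  rw [Pi.zero_apply, ← sub_self (f (x + (1 / 2 : ℝ) • (-1 : ℝ) • basisVec i) - f x), ← hp']
  module

theorem fderiv_eq_zero_of_pderiv {f : E n → F} (h : ∀ i, pderiv i f = 0) : fderiv ℝ f = 0 := by
  funext x
  refine ContinuousLinearMap.coe_injective ((EuclideanSpace.basisFun (Fin n) ℝ).toBasis.ext fun i => ?_)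
  simpa [basisVec, pderiv] using congrFun (h i) x

theorem eq_const_of_pderiv {f : E n → F} (hf : ContDiff ℝ ∞ f) (h : ∀ i, pderiv i f = 0) :
    f = fun _ => f 0 := by
  funext x
  exact is_const_of_fderiv_eq_zero (𝕜 := ℝ) (hf.differentiable (by simp))
    (fun x => congrFun (fderiv_eq_zero_of_pderiv h) x) x 0

variable {k : ℝ → ℝ} {a b : ℝ} {γ : Isom n}

theorem pullIsom_smear (hk : Continuous k) (e : E n) {η : E n → E n [⋀^Fin p]→L[ℝ] ℝ}
    (hη : ContDiff ℝ ∞ η) :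
    pullIsom γ (smear k a b (lin γ e) η) = smear k a b e (pullIsom γ η) := by
  funext x
  have h := smear_clm_comp (a := a) (b := b) (e := lin γ e) hk hη.continuous
    (altPull (p := p) (lin γ : E n →L[ℝ] E n))
  refine (congrFun h (γ x)).symm.trans ?_
  exact (smear_comp_isom (k := k) (a := a) (b := b) (e := e)
    (f := fun y => altPull (lin γ : E n →L[ℝ] E n) (η y)) γ x).symm

theorem pullIsom_add (η η' : E n → E n [⋀^Fin p]→L[ℝ] ℝ) :
    pullIsom γ (η + η') = pullIsom γ η + pullIsom γ η' :=
  funext fun _ => map_add (altPull (lin γ : E n →L[ℝ] E n)) _ _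

theorem pullIsom_contract (e : E n) (η : E n → E n [⋀^Fin (p + 1)]→L[ℝ] ℝ) :
    pullIsom γ (fun x => contract (lin γ e) (η x)) = fun x => contract e (pullIsom γ η x) := by
  funext x
  ext v
  change η (γ x) (Matrix.vecCons (lin γ e) fun i => lin γ (v i))
    = η (γ x) fun i => lin γ (Matrix.vecCons e v i)
  congr 1
  funext i
  refine Fin.cases rfl (fun j => rfl) i

/-- An equivariant family of forms summed over `± e_i` is invariant. -/
theorem pullIsom_symmetric_sum (h : IsSignDiag γ) {U : E n → E n → E n [⋀^Fin p]→L[ℝ] ℝ}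
    (hU : ∀ e, pullIsom γ (U (lin γ e)) = U e) (i : Fin n) :
    pullIsom γ (U ((1 : ℝ) • basisVec i) + U ((-1 : ℝ) • basisVec i))
      = U ((1 : ℝ) • basisVec i) + U ((-1 : ℝ) • basisVec i) := by
  obtain ⟨ε, hε, h1⟩ := h i
  have h2 : ∀ c : ℝ, lin γ ((c * ε) • basisVec i) = c • basisVec i := fun c => by
    rw [map_smul, h1, smul_smul, mul_assoc, hε, mul_one]
  rw [pullIsom_add]
  conv_lhs => rw [← h2 1, ← h2 (-1), hU, hU]
  rcases mul_self_eq_one_iff.1 hε with rfl | rfl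
  · norm_num
  · norm_num [add_comm]

variable {Γ : Subgroup (Isom n)}

theorem mean_mem_invForms (hΓ : ∀ γ ∈ Γ, IsSignDiag γ) {η : E n → E n [⋀^Fin p]→L[ℝ] ℝ}
    (hη : η ∈ invForms Γ p) (i : Fin n) : mean i η ∈ invForms Γ p := by
  refine ⟨contDiff_mean hη.1 i, fun γ hγ => ?_⟩
  refine pullIsom_symmetric_sum (U := fun e => smear 1 0 (1 / 2) e η) (hΓ γ hγ) (fun e => ?_) i
  rw [pullIsom_smear continuous_one e hη.1, hη.2 γ hγ]

/-- The homotopy operator comparing a form with its mean in the `i`-th direction. -/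
def meanHomotopy (i : Fin n) (η : E n → E n [⋀^Fin (p + 1)]→L[ℝ] ℝ) : E n → E n [⋀^Fin p]→L[ℝ] ℝ :=
  -- The weight `1/2 - u` vanishes at the outer end, equals `1/2` at the centre and has slope `-1`;
  -- integration by parts thus yields the half-mean minus half the form.
  (fun x => contract ((1 : ℝ) • basisVec i)
      (smear (fun u => 1 / 2 - u) 0 (1 / 2) ((1 : ℝ) • basisVec i) η x))
    + fun x => contract ((-1 : ℝ) • basisVec i)
      (smear (fun u => 1 / 2 - u) 0 (1 / 2) ((-1 : ℝ) • basisVec i) η x)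

theorem continuous_half_sub : Continuous fun u : ℝ => 1 / 2 - u := by fun_prop

theorem meanHomotopy_mem_invForms (hΓ : ∀ γ ∈ Γ, IsSignDiag γ)
    {η : E n → E n [⋀^Fin (p + 1)]→L[ℝ] ℝ} (hη : η ∈ invForms Γ (p + 1)) (i : Fin n) :
    meanHomotopy i η ∈ invForms Γ p := by
  have hs : ∀ e, ContDiff ℝ ∞ (smear (fun u => 1 / 2 - u) 0 (1 / 2) e η) :=
    fun e => contDiff_smear continuous_half_sub hη.1
  refine ⟨((contract _).contDiff.comp (hs _)).add ((contract _).contDiff.comp (hs _)),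
    fun γ hγ => ?_⟩
  refine pullIsom_symmetric_sum
    (U := fun e x => contract e (smear (fun u => 1 / 2 - u) 0 (1 / 2) e η x))
    (hΓ γ hγ) (fun e => ?_) i
  rw [pullIsom_contract, pullIsom_smear continuous_half_sub e hη.1, hη.2 γ hγ]

theorem extDeriv_contract {η : E n → E n [⋀^Fin (p + 1)]→L[ℝ] ℝ} (hη : ContDiff ℝ ∞ η) (e x : E n) :
    extDeriv (fun x => contract e (η x)) x = fderiv ℝ η x e - contract e (extDeriv η x) := by
  rw [extDeriv, extDeriv, contract_alternatizeUncurryFin, sub_sub_cancel,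
    (hasFDerivAt_clm_comp (contract e) (hη.differentiableAt_infty x).hasFDerivAt).fderiv]

/-- For a closed form, Cartan's formula leaves only the derivative in direction `± e_i` of the
weighted mean, computed by `pderiv_smear_self`. -/
theorem extDeriv_meanHomotopy {η : E n → E n [⋀^Fin (p + 1)]→L[ℝ] ℝ} (hη : ContDiff ℝ ∞ η)
    (hd : extDeriv η = 0) (i : Fin n) : extDeriv (meanHomotopy i η) = mean i η - η := by
  have hs : ∀ e, ContDiff ℝ ∞ (smear (fun u => 1 / 2 - u) 0 (1 / 2) e η) :=
    fun e => contDiff_smear continuous_half_sub hη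
  have hc : ∀ e e', ContDiff ℝ ∞
      (fun x => contract e (smear (fun u => 1 / 2 - u) 0 (1 / 2) e' η x)) :=
    fun e e' => (contract e).contDiff.comp (hs _)
  have key : ∀ (c : ℝ) (x : E n), extDeriv (fun x => contract (c • basisVec i)
      (smear (fun u => 1 / 2 - u) 0 (1 / 2) (c • basisVec i) η x)) x
      = smear 1 0 (1 / 2) (c • basisVec i) η x - (1 / 2 : ℝ) • η x := by
    intro c x
    have hk : ∀ u : ℝ, HasDerivAt (fun u : ℝ => 1 / 2 - u) (((-1 : ℝ) • (1 : ℝ → ℝ)) u) u :=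
      fun u => by simpa using (hasDerivAt_id u).const_sub (2⁻¹ : ℝ)
    have h := pderiv_smear_self (a := 0) (b := 1 / 2) hk (continuous_one.const_smul _) hη c i x
    rw [extDeriv_contract (hs _), extDeriv_smear continuous_half_sub hη, hd, smear_zero, map_smul]
    refine (congrArg₂ _ h (map_zero _)).trans ?_
    rw [smear_smul_kernel]
    simp only [Pi.smul_apply]
    norm_num
    abel
  funext x
  refine (extDeriv_add ((hc _ _).differentiableAt_infty x) ((hc _ _).differentiableAt_infty x)).trans ?_
  rw [key, key, mean, Pi.sub_apply, Pi.add_apply]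
  module

theorem extDeriv_eq_zero_of_pderiv {η : E n → E n [⋀^Fin p]→L[ℝ] ℝ} (h : ∀ i, pderiv i η = 0) :
    extDeriv η = 0 := by
  funext x
  rw [extDeriv, fderiv_eq_zero_of_pderiv h]
  exact map_zero (ContinuousAlternatingMap.alternatizeUncurryFinCLM ℝ (E n) ℝ)

theorem extDeriv_extDeriv_eq_zero {η : E n → E n [⋀^Fin p]→L[ℝ] ℝ} (hη : ContDiff ℝ ∞ η) :
    extDeriv (extDeriv η) = 0 :=
  extDeriv_extDeriv hη (by simpa using two_le_infty)

theorem extDeriv_mem_invForms {η : E n → E n [⋀^Fin p]→L[ℝ] ℝ} (hη : η ∈ invForms Γ p) :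
    extDeriv η ∈ invForms Γ (p + 1) :=
  ⟨contDiff_extDeriv hη.1, fun γ hγ => by rw [← extDeriv_pullIsom γ hη.1, hη.2 γ hγ]⟩

/-- The periodicity of invariant forms. -/
def HasPeriods (Γ : Subgroup (Isom n)) : Prop :=
  ∀ i : Fin n, AffineIsometryEquiv.constVAdd ℝ (E n) (basisVec i) ∈ Γ

theorem invForms_periodic (hT : HasPeriods Γ) {η : E n → E n [⋀^Fin p]→L[ℝ] ℝ}
    (hη : η ∈ invForms Γ p) (i : Fin n) (x : E n) : η (x + basisVec i) = η x := by
  have h := congrFun (hη.2 _ (hT i)) x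
  conv_rhs => rw [← h]
  rw [add_comm]
  rfl

/-- Average in one direction after another. Each average changes the form by an exact invariant
form, and it commutes with the other derivatives, so directions already made constant remain so. -/
theorem exists_const_add_exact (hΓ : ∀ γ ∈ Γ, IsSignDiag γ) (hT : HasPeriods Γ)
    {η : E n → E n [⋀^Fin (p + 1)]→L[ℝ] ℝ} (hη : η ∈ invForms Γ (p + 1)) (hd : extDeriv η = 0) :
    ∃ c, ∃ θ ∈ invForms Γ p, η + extDeriv θ = fun _ => c := by
  have key : ∀ s : Finset (Fin n), ∃ θ ∈ invForms Γ p, ∀ i ∈ s, pderiv i (η + extDeriv θ) = 0 := by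
    intro s
    induction s using Finset.induction_on with
    | empty => exact ⟨0, zero_mem _, by simp⟩
    | insert i s hi ih =>
      obtain ⟨θ, hθ, h⟩ := ih
      have hm : η + extDeriv θ ∈ invForms Γ (p + 1) := add_mem hη (extDeriv_mem_invForms hθ)
      have hd' : extDeriv (η + extDeriv θ) = 0 := by
        funext x
        rw [extDeriv_add (hη.1.differentiableAt_infty x)
          ((contDiff_extDeriv hθ.1).differentiableAt_infty x), hd, extDeriv_extDeriv_eq_zero hθ.1]
        simp
      have hH := meanHomotopy_mem_invForms hΓ hm i
      have he : η + extDeriv (θ + meanHomotopy i (η + extDeriv θ)) = mean i (η + extDeriv θ) := by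
        have : extDeriv (θ + meanHomotopy i (η + extDeriv θ))
            = extDeriv θ + extDeriv (meanHomotopy i (η + extDeriv θ)) := funext fun x =>
          extDeriv_add (hθ.1.differentiableAt_infty x) (hH.1.differentiableAt_infty x)
        rw [this, extDeriv_meanHomotopy hm.1 hd']
        abel
      refine ⟨θ + meanHomotopy i (η + extDeriv θ), add_mem hθ hH, fun j hj => ?_⟩
      rw [he]
      rcases Finset.mem_insert.1 hj with rfl | hj
      · exact pderiv_mean_self hm.1 (invForms_periodic hT hm j)
      · rw [pderiv_mean hm.1, h j hj]
        exact mean_const i 0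
  obtain ⟨θ, hθ, h⟩ := key Finset.univ
  exact ⟨_, θ, hθ, eq_const_of_pderiv (hη.1.add (contDiff_extDeriv hθ.1)) fun i =>
    h i (Finset.mem_univ i)⟩

/-- Averaging the primitive in all directions leaves its constant exterior derivative unchanged, but
makes the primitive constant. -/
theorem eq_zero_of_const_exact (hΓ : ∀ γ ∈ Γ, IsSignDiag γ) (hT : HasPeriods Γ)
    {η : E n → E n [⋀^Fin p]→L[ℝ] ℝ} (hη : η ∈ invForms Γ p)
    {c : E n [⋀^Fin (p + 1)]→L[ℝ] ℝ} (hd : extDeriv η = fun _ => c) : c = 0 := by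
  have key : ∀ s : Finset (Fin n), ∃ θ ∈ invForms Γ p, extDeriv θ = (fun _ => c) ∧
      ∀ i ∈ s, pderiv i θ = 0 := by
    intro s
    induction s using Finset.induction_on with
    | empty => exact ⟨η, hη, hd, by simp⟩
    | insert i s hi ih =>
      obtain ⟨θ, hθ, h, h'⟩ := ih
      refine ⟨mean i θ, mean_mem_invForms hΓ hθ i, by rw [extDeriv_mean hθ.1, h, mean_const],
        fun j hj => ?_⟩
      rcases Finset.mem_insert.1 hj with rfl | hj
      · exact pderiv_mean_self hθ.1 (invForms_periodic hT hθ j)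
      · rw [pderiv_mean hθ.1, h' j hj]
        exact mean_const i 0
  obtain ⟨θ, hθ, h, h'⟩ := key Finset.univ
  have := extDeriv_eq_zero_of_pderiv fun i => h' i (Finset.mem_univ i)
  rw [h] at this
  exact congrFun this 0

end Averaging

/-! ### De Rham cohomology as invariant constant forms -/

section Betti

variable {n p : ℕ} {Γ : Subgroup (Isom n)}

/-- The alternating forms that are invariant under the linear parts of the elements of `Γ`. -/
def constInvariants (Γ : Subgroup (Isom n)) (p : ℕ) : Submodule ℝ (E n [⋀^Fin p]→L[ℝ] ℝ) where
  carrier := {c | ∀ γ ∈ Γ, altPull (lin γ : E n →L[ℝ] E n) c = c}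
  zero_mem' := fun _ _ => map_zero _
  add_mem' := fun ha hb γ hγ => by rw [map_add, ha γ hγ, hb γ hγ]
  smul_mem' := fun r c hc γ hγ => by rw [map_smul, hc γ hγ]

theorem const_mem_invForms_iff {c : E n [⋀^Fin p]→L[ℝ] ℝ} :
    (fun _ => c) ∈ invForms Γ p ↔ c ∈ constInvariants Γ p :=
  ⟨fun h γ hγ => congrFun (h.2 γ hγ) 0, fun h => ⟨contDiff_const, fun γ hγ => funext fun _ => h γ hγ⟩⟩

theorem extDeriv_const (c : E n [⋀^Fin p]→L[ℝ] ℝ) : extDeriv (fun _ : E n => c) = 0 :=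
  extDeriv_eq_zero_of_pderiv fun i => by
    funext x
    simp [pderiv]

variable [IsBieberbach Γ]

/-- The parallel form on the quotient defined by an invariant alternating form. -/
def parallelForm (Γ : Subgroup (Isom n)) [IsBieberbach Γ] (p : ℕ) :
    constInvariants Γ p →ₗ[ℝ] closedForms n (OrbitSpace Γ) p where
  toFun c := ⟨(exists_pullForm_eq (const_mem_invForms_iff.2 c.2)).choose, by
    have h := (exists_pullForm_eq (const_mem_invForms_iff.2 c.2)).choose_spec
    refine ⟨h.1, pullForm_injective ?_⟩
    rw [pullForm_d h.1, h.2, extDeriv_const, map_zero]⟩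
  map_add' c c' := by
    refine Subtype.ext (pullForm_injective ?_)
    have h := fun c : constInvariants Γ p =>
      (exists_pullForm_eq (const_mem_invForms_iff.2 c.2)).choose_spec.2
    change pullForm Γ p _ = pullForm Γ p (_ + _)
    rw [map_add, h, h, h]
    rfl
  map_smul' r c := by
    refine Subtype.ext (pullForm_injective ?_)
    have h := fun c : constInvariants Γ p =>
      (exists_pullForm_eq (const_mem_invForms_iff.2 c.2)).choose_spec.2
    change pullForm Γ p _ = pullForm Γ p (r • _)
    rw [map_smul, h, h]
    rfl

theorem pullForm_parallelForm (c : constInvariants Γ p) :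
    pullForm Γ p (parallelForm Γ p c : Form n (OrbitSpace Γ) p) = fun _ =>
      (c : E n [⋀^Fin p]→L[ℝ] ℝ) :=
  (exists_pullForm_eq (const_mem_invForms_iff.2 c.2)).choose_spec.2

/-- Invariant constant forms map to cohomology: injectively by `eq_zero_of_const_exact`,
surjectively by `exists_const_add_exact`. Degree `0` is separate: nothing nonzero is exact, and
closed functions are constant. -/
theorem bettiNumber_eq (hΓ : ∀ γ ∈ Γ, IsSignDiag γ) (hT : HasPeriods Γ) (p : ℕ) :
    bettiNumber n (OrbitSpace Γ) p = Module.rank ℝ (constInvariants Γ p) := by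
  let Q := (exactForms n (OrbitSpace Γ) p).submoduleOf (closedForms n (OrbitSpace Γ) p)
  let Ψ : constInvariants Γ p →ₗ[ℝ] DeRham n (OrbitSpace Γ) p := Q.mkQ ∘ₗ parallelForm Γ p
  have hbij : Function.Bijective Ψ := by
    constructor
    · suffices h : ∀ c, Ψ c = 0 → c = 0 by
        intro c c' hc
        exact sub_eq_zero.1 (h _ (by rw [map_sub, hc, sub_self]))
      intro c hc
      have h : (parallelForm Γ p c : Form n (OrbitSpace Γ) p) ∈ exactForms n (OrbitSpace Γ) p :=
        (Submodule.Quotient.mk_eq_zero Q).1 hc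
      refine Subtype.ext ?_
      cases p with
      | zero =>
        have h0 : (parallelForm Γ 0 c : Form n (OrbitSpace Γ) 0) = 0 := h
        have := pullForm_parallelForm c
        rw [h0, map_zero] at this
        exact (congrFun this 0).symm
      | succ p =>
        obtain ⟨θ, hθ, h⟩ := h
        refine eq_zero_of_const_exact hΓ hT (pullForm_mem_invForms hθ) ?_
        rw [← pullForm_d hθ, h, pullForm_parallelForm]
    · intro q
      obtain ⟨⟨α, hα⟩, rfl⟩ := Q.mkQ_surjective q
      have hη := pullForm_mem_invForms hα.1
      have hd : extDeriv (pullForm Γ p α) = 0 := by rw [← pullForm_d hα.1, hα.2, map_zero]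
      cases p with
      | zero =>
        have hp : ∀ i, pderiv i (pullForm Γ 0 α) = 0 := fun i => funext fun x => by
          have h1 := contract_alternatizeUncurryFin_zero (basisVec i) (fderiv ℝ (pullForm Γ 0 α) x)
          have h2 : ContinuousAlternatingMap.alternatizeUncurryFin (fderiv ℝ (pullForm Γ 0 α) x)
            = 0 := congrFun hd x
          rw [h2, map_zero] at h1
          exact h1.symm
        have hc := eq_const_of_pderiv hη.1 hp
        have hm := hη
        rw [hc] at hm
        refine ⟨⟨_, const_mem_invForms_iff.1 hm⟩, ?_⟩
        refine congrArg Q.mkQ (Subtype.ext (pullForm_injective ?_))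
        rw [pullForm_parallelForm]
        exact hc.symm
      | succ p =>
        obtain ⟨c, θ, hθ, h⟩ := exists_const_add_exact hΓ hT hη hd
        have hm : (fun _ => c) ∈ invForms Γ (p + 1) := h ▸ add_mem hη (extDeriv_mem_invForms hθ)
        refine ⟨⟨c, const_mem_invForms_iff.1 hm⟩, ?_⟩
        obtain ⟨β, hβ, rfl⟩ := exists_pullForm_eq hθ
        refine (Submodule.Quotient.eq Q).2 ⟨β, hβ, pullForm_injective ?_⟩
        change _ = pullForm Γ (p + 1) (_ - _)
        rw [map_sub, pullForm_parallelForm, pullForm_d hβ, ← h]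
        change _ = _ + _ - pullForm Γ (p + 1) α
        abel
  exact (LinearEquiv.ofBijective _ hbij).rank_eq.symm

end Betti

/-! ### Alternating forms fixed by the sign changes -/

section Invariants

variable {p : ℕ} {Γ : Subgroup (Isom 4)}

/-- The linear parts of the elements of `Γ` are the diagonal matrices with signs `signs s t`. -/
structure HasSignHolonomy (Γ : Subgroup (Isom 4)) : Prop where
  exists_signs : ∀ γ ∈ Γ, ∃ s t : ℤ, ∀ v i, lin γ v i = (signs s t i : ℝ) * v i
  exists_one_zero : ∃ γ ∈ Γ, ∀ v i, lin γ v i = (signs 1 0 i : ℝ) * v i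
  exists_zero_one : ∃ γ ∈ Γ, ∀ v i, lin γ v i = (signs 0 1 i : ℝ) * v i

/-- Invariance equates the value on these basis vectors with its product by their signs, which is
minus itself. -/
theorem apply_eq_zero_of_signs {c : E 4 [⋀^Fin p]→L[ℝ] ℝ} (hc : c ∈ constInvariants Γ p) {s t : ℤ}
    (h : ∃ γ ∈ Γ, ∀ v i, lin γ v i = (signs s t i : ℝ) * v i) {I : Fin p → Fin 4}
    (hI : ∏ k, signs s t (I k) = -1) : c (fun k => basisVec (I k)) = 0 := by
  obtain ⟨γ, hγ, h⟩ := h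
  have h1 : ∀ i, lin γ (basisVec i) = (signs s t i : ℝ) • basisVec i := fun i => by
    ext l
    rw [h]
    by_cases hl : l = i
    · subst hl
      rfl
    · simp [basisVec, hl]
  have h2 : c (fun k => lin γ (basisVec (I k))) = c fun k => basisVec (I k) :=
    congrArg (fun f : E 4 [⋀^Fin p]→L[ℝ] ℝ => f fun k => basisVec (I k)) (hc γ hγ)
  simp only [h1] at h2
  have h3 := c.toMultilinearMap.map_smul_univ (fun k => (signs s t (I k) : ℝ))
    fun k => basisVec (I k)
  have h4 : ∏ k, (signs s t (I k) : ℝ) = -1 := by exact_mod_cast hI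
  rw [h4] at h3
  have h5 := h2.symm.trans h3
  simp only [smul_eq_mul] at h5
  change c _ = -1 * c _ at h5
  linarith

theorem eq_zero_of_apply_basisVec {c : E 4 [⋀^Fin p]→L[ℝ] ℝ}
    (h : ∀ I : Fin p → Fin 4, Function.Injective I → c (fun k => basisVec (I k)) = 0) : c = 0 := by
  refine ContinuousAlternatingMap.toAlternatingMap_injective ?_
  refine (EuclideanSpace.basisFun (Fin 4) ℝ).toBasis.ext_alternating fun I hI => ?_
  simpa [basisVec] using h I hI

/-- The minor with column indices `I`, an alternating form. -/
def minorForm (I : Fin p → Fin 4) : E 4 [⋀^Fin p]→L[ℝ] ℝ :=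
  { Matrix.detRowAlternating.compLinearMap
      (LinearMap.pi fun l =>
      ((EuclideanSpace.proj (I l) : E 4 →L[ℝ] ℝ) : E 4 →ₗ[ℝ] ℝ)) with
    cont := by
      change Continuous fun v : Fin p → E 4 => Matrix.det (fun k l => v k (I l))
      refine Continuous.matrix_det ?_
      fun_prop }

theorem minorForm_apply (I : Fin p → Fin 4) (v : Fin p → E 4) :
    minorForm I v = Matrix.det (Matrix.of fun k l => v k (I l)) := rfl

/-- The minor on `I` is invariant, and an invariant form is determined by its value on `I`: other
index sets change sign under one of the two generating sign patterns, and reorderings of `I` only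
alter the sign of the value. -/
theorem rank_constInvariants_eq_one (hΓ : HasSignHolonomy Γ) (I : Fin p → Fin 4)
    (hI : Function.Injective I) (h1 : ∀ s t, ∏ k, signs s t (I k) = 1)
    (h : ∀ J : Fin p → Fin 4, Function.Injective J → ∏ k, signs 1 0 (J k) = -1 ∨
      ∏ k, signs 0 1 (J k) = -1 ∨ ∃ σ : Equiv.Perm (Fin p), J = I ∘ σ) :
    Module.rank ℝ (constInvariants Γ p) = 1 := by
  have hm : minorForm I ∈ constInvariants Γ p := by
    intro γ hγ
    obtain ⟨s, t, hst⟩ := hΓ.exists_signs γ hγ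
    ext v
    change minorForm I (fun k => lin γ (v k)) = _
    rw [minorForm_apply, minorForm_apply]
    simp only [hst]
    have := Matrix.det_mul_row (fun l => (signs s t (I l) : ℝ)) (Matrix.of fun k l => v k (I l))
    have h2 : ∏ k, (signs s t (I k) : ℝ) = 1 := by exact_mod_cast h1 s t
    rw [h2, one_mul] at this
    exact this
  have hm1 : minorForm I (fun k => basisVec (I k)) = 1 := by
    rw [minorForm_apply]
    convert Matrix.det_one (n := Fin p) (R := ℝ)
    ext k l
    simp [basisVec, Matrix.one_apply, hI.eq_iff, eq_comm]
  have huniq : ∀ c ∈ constInvariants Γ p, c (fun k => basisVec (I k)) = 0 → c = 0 := by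
    intro c hc h0
    refine eq_zero_of_apply_basisVec fun J hJ => ?_
    rcases h J hJ with h | h | ⟨σ, rfl⟩
    · exact apply_eq_zero_of_signs hc hΓ.exists_one_zero h
    · exact apply_eq_zero_of_signs hc hΓ.exists_zero_one h
    · have := c.toAlternatingMap.map_perm (fun k => basisVec (I k)) σ
      refine this.trans ?_
      change _ • c _ = _
      rw [h0, smul_zero]
  refine Module.rank_eq_one_iff_finrank_eq_one.2 (finrank_eq_one (⟨minorForm I, hm⟩ : constInvariants Γ p) ?_ ?_)
  · intro h0
    have : minorForm I = 0 := congrArg Subtype.val h0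
    rw [this] at hm1
    exact zero_ne_one hm1
  · rintro ⟨c, hc⟩
    refine ⟨c fun k => basisVec (I k), Subtype.ext ?_⟩
    refine sub_eq_zero.1 (huniq _ (sub_mem (Submodule.smul_mem _ _ hm) hc) ?_)
    change c _ • minorForm I _ - c _ = 0
    rw [hm1]
    simp

/-- The index sets whose signs always multiply to `1` are the empty set, `{0}`, `{1, 2, 3}` and `{0,
1, 2, 3}`; none has two elements. -/
theorem rank_constInvariants (hΓ : HasSignHolonomy Γ) {p : ℕ} (hp : p ≤ 4) :
    Module.rank ℝ (constInvariants Γ p) = if p = 2 then 0 else 1 := by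
  interval_cases p
  · refine rank_constInvariants_eq_one hΓ ![] (by decide) (by simp) fun J _ =>
      Or.inr (Or.inr ⟨1, Subsingleton.elim _ _⟩)
  · refine rank_constInvariants_eq_one hΓ ![0] (by decide) (by simp [signs]) (by decide)
  · rw [if_pos rfl]
    refine (rank_zero_iff (R := ℝ) (M := constInvariants Γ 2)).2 ⟨fun c c' => ?_⟩
    have key : ∀ c ∈ constInvariants Γ 2, c = 0 := fun c hc => by
      refine eq_zero_of_apply_basisVec fun J hJ => ?_
      have : ∀ J : Fin 2 → Fin 4, Function.Injective J → ∏ k, signs 1 0 (J k) = -1 ∨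
        ∏ k, signs 0 1 (J k) = -1 := by decide
      rcases this J hJ with h | h
      · exact apply_eq_zero_of_signs hc hΓ.exists_one_zero h
      · exact apply_eq_zero_of_signs hc hΓ.exists_zero_one h
    exact Subtype.ext ((key _ c.2).trans (key _ c'.2).symm)
  · refine rank_constInvariants_eq_one hΓ ![1, 2, 3] (by decide) (fun s t => ?_) (by decide)
    simp only [Fin.prod_univ_three]
    change par t * par s * par (s + t) = 1
    rw [par_add]
    rcases par_eq_or s with h | h <;> rcases par_eq_or t with h' | h' <;> simp [h, h']
  · refine rank_constInvariants_eq_one hΓ id Function.injective_id (fun s t => ?_) fun J hJ => ?_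
    · simp only [Fin.prod_univ_four]
      change 1 * par t * par s * par (s + t) = 1
      rw [par_add]
      rcases par_eq_or s with h | h <;> rcases par_eq_or t with h' | h' <;> simp [h, h']
    · exact Or.inr (Or.inr ⟨Equiv.ofBijective J (Finite.injective_iff_bijective.1 hJ), rfl⟩)

theorem hasSignHolonomy_Γ₁ : HasSignHolonomy Γ₁ where
  exists_signs γ hγ := by
    obtain ⟨w, -, h⟩ := hasForm_Γ₁ γ hγ
    exact ⟨_, _, h.lin_apply⟩
  exists_one_zero := ⟨gen₁, gen₁_mem, hasForm_gen₁.lin_apply⟩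
  exists_zero_one := ⟨gen₁', gen₁'_mem, hasForm_gen₁'.lin_apply⟩

theorem hasSignHolonomy_Γ₂ : HasSignHolonomy Γ₂ where
  exists_signs γ hγ := by
    obtain ⟨w, -, h⟩ := hasForm_Γ₂ γ hγ
    exact ⟨_, _, h.lin_apply⟩
  exists_one_zero := ⟨gen₂, gen₂_mem, hasForm_gen₂.lin_apply⟩
  exists_zero_one := ⟨gen₂', gen₂'_mem, hasForm_gen₂'.lin_apply⟩

theorem hasPeriods_of_intTrans_mem (h : ∀ k, intTrans k ∈ Γ) : HasPeriods Γ := by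
  intro i
  have : AffineIsometryEquiv.constVAdd ℝ (E 4) (basisVec i) = intTrans (Pi.single i 1) := by
    ext x l
    rw [intTrans_apply]
    change (basisVec i : E 4) l + x l = _
    by_cases hl : l = i
    · subst hl
      simp [basisVec]
    · simp [basisVec, hl]
  exact this ▸ h _

end Invariants

/-! ### Fourier coefficients and finite-dimensional eigenspaces -/

section Fourier

open MeasureTheory

variable {n : ℕ} {F : Type} [NormedAddCommGroup F] [NormedSpace ℝ F]

/-- The functions `cos (2 π m u)` and `sin (2 π m u)`. -/
def trig (κ : ℕ × Bool) (u : ℝ) : ℝ :=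
  if κ.2 then Real.cos (2 * Real.pi * κ.1 * u) else Real.sin (2 * Real.pi * κ.1 * u)

/-- The derivative of `trig`. -/
def trig' (κ : ℕ × Bool) (u : ℝ) : ℝ :=
  if κ.2 then -Real.sin (2 * Real.pi * κ.1 * u) * (2 * Real.pi * κ.1)
  else Real.cos (2 * Real.pi * κ.1 * u) * (2 * Real.pi * κ.1)

theorem hasDerivAt_two_pi_mul (m : ℕ) (u : ℝ) :
    HasDerivAt (fun u : ℝ => 2 * Real.pi * m * u) (2 * Real.pi * m) u := by
  simpa using (hasDerivAt_id u).const_mul (2 * Real.pi * m)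

theorem hasDerivAt_trig (κ : ℕ × Bool) (u : ℝ) : HasDerivAt (trig κ) (trig' κ u) u := by
  obtain ⟨m, _ | _⟩ := κ
  · exact (hasDerivAt_two_pi_mul m u).sin
  · exact (hasDerivAt_two_pi_mul m u).cos

theorem hasDerivAt_trig' (κ : ℕ × Bool) (u : ℝ) :
    HasDerivAt (trig' κ) ((-(2 * Real.pi * κ.1) ^ 2 • trig κ) u) u := by
  obtain ⟨m, _ | _⟩ := κ
  · refine ((hasDerivAt_two_pi_mul m u).cos.mul_const (2 * Real.pi * m)).congr_deriv ?_
    simp [trig]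
    ring
  · refine ((hasDerivAt_two_pi_mul m u).sin.neg.mul_const (2 * Real.pi * m)).congr_deriv ?_
    simp [trig]
    ring

theorem continuous_trig (κ : ℕ × Bool) : Continuous (trig κ) :=
  continuous_iff_continuousAt.2 fun u => (hasDerivAt_trig κ u).continuousAt

theorem continuous_trig' (κ : ℕ × Bool) : Continuous (trig' κ) :=
  continuous_iff_continuousAt.2 fun u => (hasDerivAt_trig' κ u).continuousAt

theorem trig_one (κ : ℕ × Bool) : trig κ 1 = trig κ 0 := by
  have h1 : Real.cos (2 * Real.pi * κ.1) = 1 := by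
    rw [mul_comm]; exact Real.cos_nat_mul_two_pi κ.1
  have h2 : Real.sin (2 * Real.pi * κ.1) = 0 := by
    have := Real.sin_nat_mul_pi (2 * κ.1)
    rw [← this]
    push_cast
    ring_nf
  simp [trig, h1, h2]

theorem trig'_one (κ : ℕ × Bool) : trig' κ 1 = trig' κ 0 := by
  have h1 : Real.cos (2 * Real.pi * κ.1) = 1 := by
    rw [mul_comm]; exact Real.cos_nat_mul_two_pi κ.1
  have h2 : Real.sin (2 * Real.pi * κ.1) = 0 := by
    have := Real.sin_nat_mul_pi (2 * κ.1)
    rw [← this]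
    push_cast
    ring_nf
  simp [trig', h1, h2]

/-- A periodic continuous function whose Fourier coefficients vanish is zero. -/
theorem eq_zero_of_integral_trig_real {g : ℝ → ℝ} (hg : Continuous g) (hper : ∀ u, g (u + 1) = g u)
    (h : ∀ κ, ∫ u in (0 : ℝ)..1, trig κ u * g u = 0) : g = 0 := by
  have hper' : Function.Periodic (fun u => (g u : ℂ)) 1 := fun u => by simp [hper u]
  have hfact : Fact ((0 : ℝ) < 1) := ⟨one_pos⟩
  let G : C(AddCircle (1 : ℝ), ℂ) := ⟨hper'.lift, by
    refine (QuotientAddGroup.isQuotientMap_mk _).continuous_iff.2 ?_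
    exact Complex.continuous_ofReal.comp hg⟩
  have hG : ∀ u : ℝ, G (u : AddCircle (1 : ℝ)) = (g u : ℂ) := fun u => rfl
  have hcos : ∀ m : ℤ, ∫ u in (0 : ℝ)..1, Real.cos (2 * Real.pi * m * u) * g u = 0 := by
    intro m
    obtain ⟨m, rfl | rfl⟩ := m.eq_nat_or_neg
    · simpa [trig] using h (m, true)
    · simpa [trig] using h (m, true)
  have hsin : ∀ m : ℤ, ∫ u in (0 : ℝ)..1, Real.sin (2 * Real.pi * m * u) * g u = 0 := by
    intro m
    obtain ⟨m, rfl | rfl⟩ := m.eq_nat_or_neg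
    · simpa [trig] using h (m, false)
    · simpa [trig] using h (m, false)
  have hc : fourierCoeff G = 0 := by
    funext m
    rw [fourierCoeff_eq_intervalIntegral _ _ 0]
    have : ∀ u : ℝ, fourier (-m) (u : AddCircle (1 : ℝ)) • G (u : AddCircle (1 : ℝ))
        = ((Real.cos (2 * Real.pi * m * u) * g u : ℝ) : ℂ)
          - Complex.I * ((Real.sin (2 * Real.pi * m * u) * g u : ℝ) : ℂ) := by
      intro u
      rw [fourier_coe_apply, hG, smul_eq_mul]
      have : 2 * (Real.pi : ℂ) * Complex.I * ((-m : ℤ) : ℂ) * (u : ℂ) / ((1 : ℝ) : ℂ)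
          = ((-(2 * Real.pi * m * u) : ℝ) : ℂ) * Complex.I := by
        push_cast
        ring
      rw [this, Complex.exp_mul_I, ← Complex.ofReal_cos, ← Complex.ofReal_sin, Real.cos_neg,
        Real.sin_neg]
      push_cast
      ring
    simp only [this]
    have c1 : Continuous fun u : ℝ => ((Real.cos (2 * Real.pi * m * u) * g u : ℝ) : ℂ) := by
      fun_prop
    have c2 : Continuous fun u : ℝ =>
        Complex.I * ((Real.sin (2 * Real.pi * m * u) * g u : ℝ) : ℂ) := by
      fun_prop
    rw [zero_add, intervalIntegral.integral_sub (c1.intervalIntegrable _ _)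
      (c2.intervalIntegrable _ _), intervalIntegral.integral_const_mul,
      intervalIntegral.integral_ofReal, intervalIntegral.integral_ofReal, hcos, hsin]
    simp
  funext u
  -- With all coefficients zero the Fourier series is trivially summable, so it converges pointwise
  -- to the function.
  have hs := has_pointwise_sum_fourier_series_of_summable (f := G) (by rw [hc]; exact summable_zero)
    (u : AddCircle (1 : ℝ))
  rw [hc] at hs
  simp only [Pi.zero_apply, zero_smul] at hs
  have := hs.unique hasSum_zero
  rw [hG] at this
  exact_mod_cast this

theorem eq_zero_of_integral_trig [CompleteSpace F] {g : ℝ → F} (hg : Continuous g)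
    (hper : ∀ u, g (u + 1) = g u)
    (h : ∀ κ, ∫ u in (0 : ℝ)..1, trig κ u • g u = 0) (u : ℝ) : g u = 0 := by
  refine SeparatingDual.eq_zero_of_forall_dual_eq_zero (R := ℝ) fun φ => ?_
  refine congrFun (eq_zero_of_integral_trig_real (g := fun u => φ (g u)) (φ.continuous.comp hg)
    (fun u => by rw [hper]) fun κ => ?_) u
  have := φ.intervalIntegral_comp_comm (μ := volume) (a := 0) (b := 1)
    (f := fun u => trig κ u • g u) (((continuous_trig κ).smul hg).intervalIntegrable _ _)
  rw [h, map_zero] at this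
  simpa using this

/-- The partial Fourier coefficient in the `i`-th direction. -/
def fourierOp (i : Fin n) (κ : ℕ × Bool) (f : E n → F) : E n → F :=
  smear (trig κ) 0 1 ((1 : ℝ) • basisVec i) f

/-- Periodicity with respect to the standard lattice. -/
def IsLatticePeriodic (f : E n → F) : Prop := ∀ (i : Fin n) (x : E n), f (x + basisVec i) = f x

theorem IsLatticePeriodic.fourierOp {f : E n → F} (hf : IsLatticePeriodic f) (i : Fin n)
    (κ : ℕ × Bool) : IsLatticePeriodic (fourierOp i κ f) := by
  intro j x
  have : ∀ v : E n, f (x + basisVec j + v) = f (x + v) := fun v => by rw [add_right_comm, hf]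
  simp only [FlatMfd.fourierOp, smear, this]

/-- The values at `x` are the Fourier coefficients of the restriction to the line through `x` in
direction `i`. -/
theorem apply_add_eq_zero_of_fourierOp [CompleteSpace F] {f : E n → F} (hf : Continuous f)
    (hper : IsLatticePeriodic f) {i : Fin n} {x : E n} (h : ∀ κ, fourierOp i κ f x = 0) (u : ℝ) :
    f (x + u • basisVec i) = 0 := by
  refine eq_zero_of_integral_trig (g := fun u => f (x + u • basisVec i)) (by fun_prop) (fun u => ?_)
    (fun κ => ?_) u
  · simp only [add_smul, one_smul, ← add_assoc, hper i]
  · simpa [fourierOp, smear] using h κ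

variable [CompleteSpace F]

theorem contDiff_fourierOp {f : E n → F} (hf : ContDiff ℝ ∞ f) (i : Fin n) (κ : ℕ × Bool) :
    ContDiff ℝ ∞ (fourierOp i κ f) := contDiff_smear (continuous_trig κ) hf

/-- Two integrations by parts move the derivatives onto the weight; periodicity cancels the boundary
terms. -/
theorem pderiv_pderiv_fourierOp_self {f : E n → F} (hf : ContDiff ℝ ∞ f)
    (hper : IsLatticePeriodic f) (i : Fin n) (κ : ℕ × Bool) :
    pderiv i (pderiv i (fourierOp i κ f)) = -(2 * Real.pi * κ.1) ^ 2 • fourierOp i κ f := by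
  have h1 : pderiv i (fourierOp i κ f)
      = (-1 : ℝ) • smear (trig' κ) 0 1 ((1 : ℝ) • basisVec i) f := by
    funext x
    have := pderiv_smear_self (a := 0) (b := 1) (hasDerivAt_trig κ) (continuous_trig' κ) hf 1 i x
    rw [one_smul, one_smul, one_smul, hper, trig_one, zero_smul, add_zero, sub_self,
      zero_sub] at this
    rw [fourierOp, one_smul, this]
    simp
  have h2 : pderiv i (smear (trig' κ) 0 1 ((1 : ℝ) • basisVec i) f)
      = (-1 : ℝ) • -(2 * Real.pi * κ.1) ^ 2 • fourierOp i κ f := by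
    funext x
    have := pderiv_smear_self (a := 0) (b := 1) (hasDerivAt_trig' κ)
      ((continuous_trig κ).const_smul _) hf 1 i x
    rw [one_smul, one_smul, one_smul, hper, trig'_one, zero_smul, add_zero, sub_self,
      zero_sub, smear_smul_kernel] at this
    rw [fourierOp, one_smul, this]
    simp
  rw [h1, pderiv_smul _ (contDiff_smear (continuous_trig' κ) hf), h2, smul_smul]
  norm_num

theorem pderiv_pderiv_fourierOp {f : E n → F} (hf : ContDiff ℝ ∞ f) {i : Fin n} {c : ℝ}
    (h : pderiv i (pderiv i f) = c • f) (j : Fin n) (κ : ℕ × Bool) :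
    pderiv i (pderiv i (fourierOp j κ f)) = c • fourierOp j κ f := by
  have hκ := continuous_trig κ
  rw [fourierOp, pderiv_smear hκ hf, pderiv_smear hκ (contDiff_pderiv hf i), h, smear_smul]

/-- The smooth periodic functions that are eigenfunctions of the Laplacian. -/
def periodicEigenspace (n : ℕ) (F : Type) [NormedAddCommGroup F] [NormedSpace ℝ F] (lam : ℝ) :
    Submodule ℝ (E n → F) where
  carrier := {f | ContDiff ℝ ∞ f ∧ IsLatticePeriodic f ∧ -coordLaplacian f = lam • f}
  zero_mem' := ⟨contDiff_const, fun _ _ => rfl, by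
    have := coordLaplacian_smul (0 : ℝ) (f := (0 : E n → F)) contDiff_const
    simpa using this⟩
  add_mem' := fun {f g} hf hg => ⟨hf.1.add hg.1, fun i x => by
    simp only [Pi.add_apply, hf.2.1 i x, hg.2.1 i x], by
    rw [coordLaplacian_add hf.1 hg.1, neg_add, hf.2.2, hg.2.2, smul_add]⟩
  smul_mem' := fun c f hf => ⟨hf.1.const_smul c, fun i x => by
    simp only [Pi.smul_apply, hf.2.1 i x], by
    rw [coordLaplacian_smul c hf.1, smul_comm lam c f, ← hf.2.2]
    exact (smul_neg c _).symm⟩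

/-- The joint Fourier coefficient functions in four variables. -/
def fourierOp₄ (κ : Fin 4 → ℕ × Bool) (f : E 4 → F) : E 4 → F :=
  fourierOp 3 (κ 3) (fourierOp 2 (κ 2) (fourierOp 1 (κ 1) (fourierOp 0 (κ 0) f)))

/-- The joint coefficient function is an eigenfunction for `lam`, and also for the sum of the
squared frequencies; it vanishes if the two differ. -/
theorem fourierOp₄_eq_zero {lam : ℝ} {f : E 4 → F} (hf : f ∈ periodicEigenspace 4 F lam)
    {κ : Fin 4 → ℕ × Bool} (hκ : ∑ i, (2 * Real.pi * (κ i).1) ^ 2 ≠ lam) : fourierOp₄ κ f = 0 := by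
  obtain ⟨h, hp, hl⟩ := hf
  have h0 := contDiff_fourierOp h 0 (κ 0)
  have h1 := contDiff_fourierOp h0 1 (κ 1)
  have h2 := contDiff_fourierOp h1 2 (κ 2)
  have h3 := contDiff_fourierOp h2 3 (κ 3)
  have p0 := hp.fourierOp 0 (κ 0)
  have p1 := p0.fourierOp 1 (κ 1)
  have p2 := p1.fourierOp 2 (κ 2)
  have e0 := pderiv_pderiv_fourierOp h2 (pderiv_pderiv_fourierOp h1 (pderiv_pderiv_fourierOp h0
    (pderiv_pderiv_fourierOp_self h hp 0 (κ 0)) 1 (κ 1)) 2 (κ 2)) 3 (κ 3)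
  have e1 := pderiv_pderiv_fourierOp h2 (pderiv_pderiv_fourierOp h1
    (pderiv_pderiv_fourierOp_self h0 p0 1 (κ 1)) 2 (κ 2)) 3 (κ 3)
  have e2 := pderiv_pderiv_fourierOp h2
    (pderiv_pderiv_fourierOp_self h1 p1 2 (κ 2)) 3 (κ 3)
  have e3 := pderiv_pderiv_fourierOp_self h2 p2 3 (κ 3)
  have hl' : coordLaplacian f = (-lam) • f := by rw [neg_smul, ← hl, neg_neg]
  have hlap : coordLaplacian (fourierOp₄ κ f) = (-lam) • fourierOp₄ κ f := by
    simp only [fourierOp₄, fourierOp] at h0 h1 h2 ⊢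
    rw [coordLaplacian_smear (continuous_trig _) h2, coordLaplacian_smear (continuous_trig _) h1,
      coordLaplacian_smear (continuous_trig _) h0, coordLaplacian_smear (continuous_trig _) h, hl',
      smear_smul, smear_smul, smear_smul, smear_smul]
  funext x
  have hx := congrFun hlap x
  simp only [coordLaplacian, Fin.sum_univ_four] at hx
  rw [fourierOp₄, e0, e1, e2, e3] at hx
  rw [Fin.sum_univ_four] at hκ
  simp only [Pi.smul_apply, ← add_smul] at hx
  have hz : (lam - ((2 * Real.pi * (κ 0).1) ^ 2 + (2 * Real.pi * (κ 1).1) ^ 2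
      + (2 * Real.pi * (κ 2).1) ^ 2 + (2 * Real.pi * (κ 3).1) ^ 2)) • fourierOp₄ κ f x = 0 := by
    rw [← sub_eq_zero, ← sub_smul] at hx
    rw [← hx]
    congr 1
    ring
  exact (smul_eq_zero.1 hz).resolve_left (sub_ne_zero.2 hκ.symm)

/-- Fourier uniqueness is applied one variable at a time, recovering the function on all of `ℝ⁴`
from coefficients at the origin. -/
theorem eq_zero_of_fourierOp₄ {f : E 4 → F} (hf : ContDiff ℝ ∞ f) (hp : IsLatticePeriodic f)
    (h : ∀ κ, fourierOp₄ κ f 0 = 0) : f = 0 := by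
  have key : ∀ u : Fin 4 → ℝ, f (0 + u 3 • basisVec 3 + u 2 • basisVec 2 + u 1 • basisVec 1
      + u 0 • basisVec 0) = 0 := by
    intro u
    refine apply_add_eq_zero_of_fourierOp hf.continuous hp (fun κ0 => ?_) (u 0)
    have h0 := contDiff_fourierOp hf 0 κ0
    have p0 := hp.fourierOp 0 κ0
    refine apply_add_eq_zero_of_fourierOp h0.continuous p0 (fun κ1 => ?_) (u 1)
    have h1 := contDiff_fourierOp h0 1 κ1
    have p1 := p0.fourierOp 1 κ1
    refine apply_add_eq_zero_of_fourierOp h1.continuous p1 (fun κ2 => ?_) (u 2)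
    have h2 := contDiff_fourierOp h1 2 κ2
    have p2 := p1.fourierOp 2 κ2
    exact apply_add_eq_zero_of_fourierOp h2.continuous p2 (fun κ3 => h ![κ0, κ1, κ2, κ3]) (u 3)
  funext x
  refine Eq.trans (congrArg f ?_) (key fun i => x i)
  ext i
  fin_cases i <;> simp [basisVec]

/-- Only frequencies at most `N`, for some `N > lam`, can have a nonzero coefficient. So finitely
many coefficients, with values in a finite-dimensional space, determine an eigenfunction. -/
instance finiteDimensional_periodicEigenspace [FiniteDimensional ℝ F] (lam : ℝ) :
    FiniteDimensional ℝ (periodicEigenspace 4 F lam) := by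
  obtain ⟨N, hN⟩ := exists_nat_gt lam
  let ι := Fin 4 → Fin (N + 1) × Bool
  let κ : ι → Fin 4 → ℕ × Bool := fun s i => ((s i).1, (s i).2)
  let Φ : periodicEigenspace 4 F lam →ₗ[ℝ] ι → F :=
    { toFun := fun f s => fourierOp₄ (κ s) f.1 0
      map_add' := fun f g => by
        funext s
        have key : ∀ {f g : E 4 → F} (i : Fin 4) (κ : ℕ × Bool), ContDiff ℝ ∞ f → ContDiff ℝ ∞ g →
            fourierOp i κ (f + g) = fourierOp i κ f + fourierOp i κ g := fun i κ hf hg =>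
          smear_add (continuous_trig κ) hf.continuous hg.continuous
        have c := fun {f : E 4 → F} (hf : ContDiff ℝ ∞ f) i κ => contDiff_fourierOp hf i κ
        have h1 := f.2.1
        have h2 := g.2.1
        change fourierOp₄ (κ s) (f.1 + g.1) 0 = fourierOp₄ (κ s) f.1 0 + fourierOp₄ (κ s) g.1 0
        simp only [fourierOp₄]
        rw [key _ _ h1 h2, key _ _ (c h1 _ _) (c h2 _ _),
          key _ _ (c (c h1 _ _) _ _) (c (c h2 _ _) _ _),
          key _ _ (c (c (c h1 _ _) _ _) _ _) (c (c (c h2 _ _) _ _) _ _)]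
        rfl
      map_smul' := fun r f => by
        funext s
        change fourierOp₄ (κ s) (r • f.1) 0 = r • fourierOp₄ (κ s) f.1 0
        simp only [fourierOp₄, fourierOp, smear_smul]
        rfl }
  refine FiniteDimensional.of_injective Φ fun f g hfg => ?_
  refine sub_eq_zero.1 (Subtype.ext (eq_zero_of_fourierOp₄ (f - g).2.1 (f - g).2.2.1 fun κ' => ?_))
  by_cases h : ∀ i, (κ' i).1 < N + 1
  · have := congrFun (sub_eq_zero.2 hfg) fun i => (⟨(κ' i).1, h i⟩, (κ' i).2)
    rw [← map_sub] at this
    exact this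
  · push Not at h
    obtain ⟨i, hi⟩ := h
    refine congrFun (fourierOp₄_eq_zero (f - g).2 (ne_of_gt ?_)) 0
    have h1 : (2 * Real.pi * (κ' i).1) ^ 2 ≤ ∑ i, (2 * Real.pi * (κ' i).1) ^ 2 :=
      Finset.single_le_sum (f := fun i => (2 * Real.pi * ((κ' i).1 : ℝ)) ^ 2)
        (fun i _ => sq_nonneg _) (Finset.mem_univ i)
    have h2 : (N : ℝ) + 1 ≤ (κ' i).1 := by exact_mod_cast hi
    have h3 : (0 : ℝ) ≤ N := Nat.cast_nonneg N
    have h4 := Real.pi_gt_three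
    nlinarith [mul_le_mul_of_nonneg_right h4.le (by linarith : (0 : ℝ) ≤ (κ' i).1)]

end Fourier

/-! ### Operators on periodic eigenfunctions and their traces -/

section PeriodicOperators

variable {F : Type} [NormedAddCommGroup F] [NormedSpace ℝ F]

/-- The linear part of the isometry permutes the coordinate axes. -/
def IsSignPerm (φ : Isom 4) : Prop :=
  ∃ σ : Equiv.Perm (Fin 4), ∀ i, ∃ ε : ℝ, ε * ε = 1 ∧ lin φ (basisVec i) = ε • basisVec (σ i)

theorem IsSignDiag.isSignPerm {φ : Isom 4} (h : IsSignDiag φ) : IsSignPerm φ := ⟨1, h⟩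

theorem pderiv_comp_isom_of_eq {φ : Isom 4} {i j : Fin 4} {ε : ℝ}
    (h : lin φ (basisVec i) = ε • basisVec j) {f : E 4 → F} (hf : ContDiff ℝ ∞ f) :
    pderiv i (fun x => f (φ x)) = ε • fun x => pderiv j f (φ x) := by
  funext x
  have := ((hf.differentiableAt_infty (φ x)).hasFDerivAt.comp x (hasFDerivAt_isom φ x)).fderiv
  simp only [pderiv, Pi.smul_apply]
  rw [show (fun x => f (φ x)) = f ∘ φ from rfl, this, ContinuousLinearMap.comp_apply]
  change (fderiv ℝ f (φ x)) (lin φ (basisVec i)) = _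
  rw [h, map_smul]

theorem coordLaplacian_comp_signPerm {φ : Isom 4} (h : IsSignPerm φ) {f : E 4 → F}
    (hf : ContDiff ℝ ∞ f) :
    coordLaplacian (fun x => f (φ x)) = fun x => coordLaplacian f (φ x) := by
  obtain ⟨σ, h⟩ := h
  funext x
  simp only [coordLaplacian]
  rw [← Equiv.sum_comp σ fun i => pderiv i (pderiv i f) (φ x)]
  refine Finset.sum_congr rfl fun i _ => ?_
  obtain ⟨ε, hε, h1⟩ := h i
  have h2 := contDiff_pderiv hf (σ i)
  have h3 : ContDiff ℝ ∞ fun x => pderiv (σ i) f (φ x) := h2.comp (contDiff_isom φ)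
  rw [pderiv_comp_isom_of_eq h1 hf, pderiv_smul ε h3, Pi.smul_apply,
    pderiv_comp_isom_of_eq h1 h2, Pi.smul_apply, smul_smul, hε, one_smul]

theorem isom_add (φ : Isom 4) (x v : E 4) : φ (x + v) = φ x + lin φ v := by
  have h1 := φ.map_vadd x v
  simp only [vadd_eq_add] at h1
  rw [add_comm x, h1, add_comm]
  rfl

/-- The linear part sends each basis vector to plus or minus a basis vector, hence periods to
periods. -/
theorem IsLatticePeriodic.comp_signPerm {X : Type} {φ : Isom 4} (h : IsSignPerm φ) {f : E 4 → X}
    (hf : IsLatticePeriodic f) : IsLatticePeriodic fun x => f (φ x) := by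
  obtain ⟨σ, h⟩ := h
  intro i x
  obtain ⟨ε, hε, h1⟩ := h i
  simp only [isom_add, h1]
  rcases mul_self_eq_one_iff.1 hε with rfl | rfl
  · rw [one_smul, hf]
  · have := hf (σ i) (φ x + (-1 : ℝ) • basisVec (σ i))
    rw [← this]
    congr 1
    module

theorem IsLatticePeriodic.intTrans {X : Type} {f : E 4 → X} (hf : IsLatticePeriodic f) (k : Fin 4 → ℤ)
    (x : E 4) : f (intTrans k x) = f x := by
  let H : Subgroup (Isom 4) :=
    { carrier := {γ | ∀ x, f (γ x) = f x}
      one_mem' := fun _ => rfl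
      mul_mem' := fun {γ γ'} h h' x => (h (γ' x)).trans (h' x)
      inv_mem' := fun {γ} h x => by
        have := h (γ⁻¹ x)
        rw [show γ (γ⁻¹ x) = x from γ.apply_symm_apply x] at this
        exact this.symm }
  refine intTrans_mem (H := H) (fun i x => ?_) k x
  rw [← hf i x]
  congr 1
  ext l
  rw [intTrans_apply, add_comm]
  by_cases hl : l = i
  · subst hl
    simp [basisVec]
  · simp [basisVec, hl]

/-- The operator on periodic eigenfunctions given by an isometry of the domain and a linear map of
the values. -/
def composeOp {lam : ℝ} {φ : Isom 4} (hφ : IsSignPerm φ) (L : F →L[ℝ] F) :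
    Module.End ℝ (periodicEigenspace 4 F lam) where
  toFun f := ⟨fun x => L (f.1 (φ x)), by
    obtain ⟨f, h1, h2, h3⟩ := f
    have hc := h1.comp (contDiff_isom φ)
    refine ⟨L.contDiff.comp hc, fun i x => congrArg L (h2.comp_signPerm hφ i x), ?_⟩
    have e := coordLaplacian_clm_comp L hc
    have e' := coordLaplacian_comp_signPerm hφ h1
    funext x
    have e1 := congrFun e x
    have e2 := congrFun e' x
    have e3 := congrFun h3 (φ x)
    change -coordLaplacian (fun x => L ((f ∘ φ) x)) x = lam • L (f (φ x))
    rw [e1]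
    change -L (coordLaplacian (fun x => f (φ x)) x) = _
    rw [e2, ← map_neg, ← map_smul]
    exact congrArg L e3⟩
  map_add' f g := Subtype.ext (funext fun x => map_add L _ _)
  map_smul' c f := Subtype.ext (funext fun x => map_smul L _ _)

theorem composeOp_apply {lam : ℝ} {φ : Isom 4} (hφ : IsSignPerm φ) (L : F →L[ℝ] F)
    (f : periodicEigenspace 4 F lam) (x : E 4) : (composeOp hφ L f).1 x = L (f.1 (φ x)) := rfl

/-- Conjugate isometries define operators of the same trace. -/
theorem trace_composeOp_eq [FiniteDimensional ℝ F] {lam : ℝ} {φ φ' ψ : Isom 4} (hφ : IsSignPerm φ)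
    (hφ' : IsSignPerm φ') (hψ : IsSignPerm ψ) (h : ∀ x, φ (ψ x) = ψ (φ' x)) (L : F →L[ℝ] F) :
    LinearMap.trace ℝ (periodicEigenspace 4 F lam) (composeOp hφ L)
      = LinearMap.trace ℝ (periodicEigenspace 4 F lam) (composeOp hφ' L) := by
  have : CompleteSpace F := FiniteDimensional.complete ℝ F
  let q : Module.End ℝ (periodicEigenspace 4 F lam) := composeOp hψ (ContinuousLinearMap.id ℝ F)
  have hq : Function.Injective q := fun f g hfg => by
    refine Subtype.ext (funext fun x => ?_)
    -- Composition with the bijection `ψ` is injective, hence invertible in finite dimension; it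
    -- conjugates one operator to the other and does not touch `L`.
    have := congrArg (fun f => f.1 (ψ.symm x)) hfg
    have e := ψ.apply_symm_apply x
    simp only [q, composeOp_apply, e] at this
    exact this
  let e := LinearEquiv.ofInjectiveEndo q hq
  rw [← LinearMap.trace_conj' (composeOp hφ L) e]
  congr 1
  refine LinearMap.ext fun f => ?_
  obtain ⟨g, rfl⟩ := e.surjective f
  rw [LinearEquiv.conj_apply_apply, e.symm_apply_apply]
  refine Subtype.ext (funext fun x => ?_)
  change L (g.1 (φ (ψ x))) = L (g.1 (ψ (φ' x)))
  rw [h]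

/-- The common fixed space of two commuting involutions has the dimension given by the average of
the traces. -/
theorem finrank_fixed_eq_trace {V : Type} [AddCommGroup V] [Module ℝ V] [FiniteDimensional ℝ V]
    {a b : Module.End ℝ V} (ha : a * a = 1) (hb : b * b = 1) (hab : a * b = b * a)
    {W : Submodule ℝ V} (hW : ∀ v, v ∈ W ↔ a v = v ∧ b v = v) :
    (Module.finrank ℝ W : ℝ) = (1 / 4 : ℝ) * (LinearMap.trace ℝ V 1 + LinearMap.trace ℝ V a
      + LinearMap.trace ℝ V b + LinearMap.trace ℝ V (a * b)) := by
  have ha' : ∀ v, a (a v) = v := fun v => LinearMap.congr_fun ha v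
  have hb' : ∀ v, b (b v) = v := fun v => LinearMap.congr_fun hb v
  have hab' : ∀ v, a (b v) = b (a v) := fun v => LinearMap.congr_fun hab v
  -- The average over the group of order four generated by the involutions projects onto the fixed
  -- space, and the trace of a projection is its rank.
  have hproj : LinearMap.IsProj W ((1 / 4 : ℝ) • (1 + a + b + a * b)) := by
    refine ⟨fun v => (hW _).2 ⟨?_, ?_⟩, fun v hv => ?_⟩
    · simp only [LinearMap.smul_apply, LinearMap.add_apply, Module.End.one_apply,
        Module.End.mul_apply, map_smul, map_add, ha']
      congr 1
      abel
    · simp only [LinearMap.smul_apply, LinearMap.add_apply, Module.End.one_apply,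
        Module.End.mul_apply, map_smul, map_add, hab', hb']
      congr 1
      abel
    · obtain ⟨h1, h2⟩ := (hW v).1 hv
      simp only [LinearMap.smul_apply, LinearMap.add_apply, Module.End.one_apply,
        Module.End.mul_apply, h1, h2]
      module
  rw [← hproj.trace]
  simp only [map_smul, map_add, smul_eq_mul]

theorem rank_eq_finrank_comap {X : Type} [AddCommGroup X] [Module ℝ X] {U V : Submodule ℝ X}
    [FiniteDimensional ℝ V] (h : U ≤ V) :
    Module.rank ℝ U = Module.finrank ℝ (U.comap V.subtype) := by
  rw [Module.finrank_eq_rank]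
  exact (Submodule.comapSubtypeEquivOfLe h).rank_eq.symm

end PeriodicOperators

/-! ### Isospectrality by comparing traces -/

section Isospectrality

variable {p : ℕ}

instance finiteDimensional_alternating : FiniteDimensional ℝ (E 4 [⋀^Fin p]→L[ℝ] ℝ) := by
  let Φ : (E 4 [⋀^Fin p]→L[ℝ] ℝ) →ₗ[ℝ] (Fin p → Fin 4) → ℝ :=
    { toFun := fun c I => c fun k => basisVec (I k)
      map_add' := fun _ _ => rfl
      map_smul' := fun _ _ => rfl }
  refine FiniteDimensional.of_injective Φ fun c c' h => ?_
  refine sub_eq_zero.1 (eq_zero_of_apply_basisVec fun I _ => ?_)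
  exact sub_eq_zero.2 (congrFun h I)

theorem pullIsom_mul (γ γ' : Isom 4) (η : E 4 → E 4 [⋀^Fin p]→L[ℝ] ℝ) :
    pullIsom (γ * γ') η = pullIsom γ' (pullIsom γ η) := rfl

theorem pullIsom_intTrans {η : E 4 → E 4 [⋀^Fin p]→L[ℝ] ℝ} (hη : IsLatticePeriodic η)
    (k : Fin 4 → ℤ) : pullIsom (intTrans k) η = η :=
  funext fun x => hη.intTrans k x

/-- The pull-back operator on periodic eigenforms. -/
abbrev pullOp (p : ℕ) (lam : ℝ) {φ : Isom 4} (hφ : IsSignDiag φ) :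
    Module.End ℝ (periodicEigenspace 4 (E 4 [⋀^Fin p]→L[ℝ] ℝ) lam) :=
  composeOp hφ.isSignPerm (altPull (lin φ : E 4 →L[ℝ] E 4))

/-- The multiplicity of an eigenvalue as an average of traces. -/
theorem rank_invEigenforms {a b : Isom 4} {k l m : Fin 4 → ℤ} (ha : IsSignDiag a)
    (hb : IsSignDiag b) (hba : IsSignDiag (b * a)) (haa : a * a = intTrans k)
    (hbb : b * b = intTrans l) (hab : a * b = intTrans m * (b * a)) (p : ℕ) (lam : ℝ) :
    ∃ d : ℕ, Module.rank ℝ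
        (invEigenforms (Subgroup.closure ({a, b} ∪ integerTranslations 4)) p lam) = d ∧
      (d : ℝ) = (1 / 4 : ℝ) * (LinearMap.trace ℝ _ (1 : Module.End ℝ
          (periodicEigenspace 4 (E 4 [⋀^Fin p]→L[ℝ] ℝ) lam))
        + LinearMap.trace ℝ _ (pullOp p lam ha)
        + LinearMap.trace ℝ _ (pullOp p lam hb) + LinearMap.trace ℝ _ (pullOp p lam hba)) := by
  set Γ := Subgroup.closure ({a, b} ∪ integerTranslations 4)
  -- Pull-back reverses products, so the fourth trace belongs to `b * a`.
  have hmul : pullOp p lam ha * pullOp p lam hb = pullOp p lam hba := rfl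
  let V := periodicEigenspace 4 (E 4 [⋀^Fin p]→L[ℝ] ℝ) lam
  have hle : invEigenforms Γ p lam ≤ V := fun η hη => ⟨hη.1.1, invForms_periodic
    (hasPeriods_of_intTrans_mem fun k => Subgroup.subset_closure (Or.inr ⟨k, rfl⟩)) hη.1, hη.2⟩
  let W := (invEigenforms Γ p lam).comap V.subtype
  have hW : ∀ v : V, v ∈ W ↔ pullOp p lam ha v = v ∧ pullOp p lam hb v = v := by
    intro v
    constructor
    · intro hv
      exact ⟨Subtype.ext (hv.1.2 a (Subgroup.subset_closure (Or.inl (Or.inl rfl)))),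
        Subtype.ext (hv.1.2 b (Subgroup.subset_closure (Or.inl (Or.inr rfl))))⟩
    · rintro ⟨h1, h2⟩
      refine ⟨⟨v.2.1, fun γ hγ => ?_⟩, v.2.2.2⟩
      change pullIsom γ v.1 = v.1
      induction hγ using Subgroup.closure_induction with
      | mem γ h =>
        rcases h with (rfl | rfl) | ⟨k, rfl⟩
        · exact congrArg Subtype.val h1
        · exact congrArg Subtype.val h2
        · exact pullIsom_intTrans v.2.2.1 k
      | one => rfl
      | mul γ γ' _ _ h h' => rw [pullIsom_mul, h, h']
      | inv γ _ h =>
        conv_lhs => rw [← h]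
        rw [← pullIsom_mul, mul_inv_cancel]
        rfl
  -- Modulo the lattice, which acts trivially on periodic forms, `a` and `b` are commuting
  -- involutions.
  have htr := finrank_fixed_eq_trace (V := V) (a := pullOp p lam ha) (b := pullOp p lam hb)
    (LinearMap.ext fun v => Subtype.ext ?_) (LinearMap.ext fun v => Subtype.ext ?_)
    (LinearMap.ext fun v => Subtype.ext ?_) hW
  · refine ⟨Module.finrank ℝ W, ?_, htr⟩
    exact rank_eq_finrank_comap hle
  · change pullIsom (a * a) v.1 = v.1
    rw [haa, pullIsom_intTrans v.2.2.1]
  · change pullIsom (b * b) v.1 = v.1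
    rw [hbb, pullIsom_intTrans v.2.2.1]
  · change pullIsom (b * a) v.1 = pullIsom (a * b) v.1
    rw [hab, pullIsom_mul (intTrans m), pullIsom_intTrans v.2.2.1]

/-- The isometry permuting the coordinates and translating. -/
def permIsom (σ : Equiv.Perm (Fin 4)) (c : E 4) : Isom 4 :=
  (LinearIsometryEquiv.piLpCongrLeft 2 ℝ ℝ σ).toAffineIsometryEquiv.trans
    (AffineIsometryEquiv.constVAdd ℝ (E 4) c)

theorem permIsom_apply (σ : Equiv.Perm (Fin 4)) (c x : E 4) (i : Fin 4) :
    permIsom σ c x i = c i + x (σ.symm i) := rfl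

theorem isSignPerm_permIsom (σ : Equiv.Perm (Fin 4)) (c : E 4) : IsSignPerm (permIsom σ c) := by
  refine ⟨σ, fun i => ⟨1, one_mul 1, ?_⟩⟩
  rw [one_smul]
  exact LinearIsometryEquiv.piLpCongrLeft_single σ i 1

/-- Equal linear parts give the same action on values, so conjugacy as maps of the domain suffices;
`ψ` need not act on the values of the forms. -/
theorem trace_pullOp_eq {lam : ℝ} {φ φ' ψ : Isom 4} (hφ : IsSignDiag φ)
    (hφ' : IsSignDiag φ') (hψ : IsSignPerm ψ) (h : ∀ x i, φ (ψ x) i = ψ (φ' x) i)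
    (hl : ∀ v i, lin φ v i = lin φ' v i) :
    LinearMap.trace ℝ _ (pullOp p lam hφ) = LinearMap.trace ℝ _ (pullOp p lam hφ') := by
  have e : (lin φ : E 4 →L[ℝ] E 4) = lin φ' := by
    ext v i
    exact hl v i
  rw [pullOp, pullOp, ← e]
  exact trace_composeOp_eq _ _ hψ (fun x => by ext i; exact h x i) _

theorem pIsospectral_Γ [IsBieberbach Γ₁] [IsBieberbach Γ₂] (p : ℕ) :
    PIsospectral 4 p (OrbitSpace Γ₁) (OrbitSpace Γ₂) := by
  funext lam
  rw [pSpectrum_eq isSignDiag_Γ₁, pSpectrum_eq isSignDiag_Γ₂]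
  have h₁ := hasForm_gen₁'.mul hasForm_gen₁
  have h₂ := hasForm_gen₂'.mul hasForm_gen₂
  obtain ⟨d, hd, hd'⟩ := rank_invEigenforms (m := Pi.single 1 1 - Pi.single 2 1 - Pi.single 3 1)
    hasForm_gen₁.isSignDiag hasForm_gen₁'.isSignDiag
    h₁.isSignDiag sq_gen₁ sq_gen₁' ((hasForm_gen₁.mul hasForm_gen₁').eq
      ((hasForm_intTrans 2 _).mul h₁) (by decide)) p lam
  obtain ⟨e, he, he'⟩ := rank_invEigenforms (m := Pi.single 1 1)
    hasForm_gen₂.isSignDiag hasForm_gen₂'.isSignDiag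
    h₂.isSignDiag sq_gen₂ sq_gen₂' ((hasForm_gen₂.mul hasForm_gen₂').eq
      ((hasForm_intTrans 0 _).mul h₂) (by decide)) p lam
  refine hd.trans (Eq.trans ?_ he.symm)
  refine congrArg _ ((Nat.cast_inj (R := ℝ)).1 (hd'.trans (Eq.trans ?_ he'.symm)))
  -- For `B₁`, a shift by `-1/4` removes the half-step from the reflected coordinate `3`. For `B₂`,
  -- swapping coordinates `0` and `2`, both unreflected, exchanges the half-steps `e₃/2` and `e₁/2`.
  -- For `B₁B₂`, coordinates `0` and `3` are swapped and a shift by `1/4` absorbs the half-step in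
  -- the reflected coordinate `2`.
  rw [trace_pullOp_eq hasForm_gen₁.isSignDiag hasForm_gen₂.isSignDiag
      (isSignPerm_permIsom (Equiv.refl _) !₂[0, 0, 0, -1 / 4]) ?_ ?_,
    trace_pullOp_eq hasForm_gen₁'.isSignDiag hasForm_gen₂'.isSignDiag
      (isSignPerm_permIsom (Equiv.swap 0 2) 0) ?_ ?_,
    trace_pullOp_eq h₁.isSignDiag h₂.isSignDiag
      (isSignPerm_permIsom (Equiv.swap 0 3) !₂[0, 0, 1 / 4, 0]) ?_ ?_]
  · intro x i
    rw [h₁, permIsom_apply, permIsom_apply, h₂]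
    fin_cases i <;> (simp [signs, par, Equiv.swap_apply_def]; try ring)
  · intro v i
    rw [h₁.lin_apply, h₂.lin_apply]
    fin_cases i <;> rfl
  · intro x i
    rw [hasForm_gen₁', permIsom_apply, permIsom_apply, hasForm_gen₂']
    fin_cases i <;> simp [signs, par, Equiv.swap_apply_def]
  · intro v i
    rw [hasForm_gen₁'.lin_apply, hasForm_gen₂'.lin_apply]
    fin_cases i <;> rfl
  · intro x i
    rw [hasForm_gen₁, permIsom_apply, permIsom_apply, hasForm_gen₂]
    fin_cases i <;> (simp [signs, par]; try ring)
  · intro v i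
    rw [hasForm_gen₁.lin_apply, hasForm_gen₂.lin_apply]
    fin_cases i <;> rfl

end Isospectrality



end FlatMfd

end

/-! ### Assembly of the main theorem -/

theorem mainTheorem10 :
    ∃ (_ : IsBieberbach Γ₁) (_ : IsBieberbach Γ₂),
      -- both quotients are compact flat 4-manifolds
      IsCompactFlatManifold 4 (OrbitSpace Γ₁) ∧ IsCompactFlatManifold 4 (OrbitSpace Γ₂) ∧
      -- with holonomy group `ℤ₂²`
      (∀ x : OrbitSpace Γ₁, Nonempty (holonomyGroup 4 x ≃* Multiplicative (ZMod 2 × ZMod 2))) ∧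
      (∀ x : OrbitSpace Γ₂, Nonempty (holonomyGroup 4 x ≃* Multiplicative (ZMod 2 × ZMod 2))) ∧
      -- they are `p`-isospectral for all `p`
      (∀ p : ℕ, PIsospectral 4 p (OrbitSpace Γ₁) (OrbitSpace Γ₂)) ∧
      -- first integral homology
      Nonempty (H1 (OrbitSpace Γ₁) ≃+ Additive (Abelianization Γ₁)) ∧
      Nonempty (H1 (OrbitSpace Γ₁) ≃+ ℤ × ZMod 4 × ZMod 4) ∧
      Nonempty (H1 (OrbitSpace Γ₂) ≃+ Additive (Abelianization Γ₂)) ∧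
      Nonempty (H1 (OrbitSpace Γ₂) ≃+ ℤ × ZMod 2 × ZMod 2 × ZMod 2) ∧
      -- hence the homology groups differ, and the manifolds are not homeomorphic
      IsEmpty (H1 (OrbitSpace Γ₁) ≃+ H1 (OrbitSpace Γ₂)) ∧
      IsEmpty (OrbitSpace Γ₁ ≃ₜ OrbitSpace Γ₂) ∧
      -- Betti numbers
      (∀ j : ℕ, j ≤ 4 → bettiNumber 4 (OrbitSpace Γ₁) j = if j = 2 then 0 else 1) ∧
      (∀ j : ℕ, j ≤ 4 → bettiNumber 4 (OrbitSpace Γ₂) j = if j = 2 then 0 else 1) := by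
  have : IsBieberbach Γ₁ := isBieberbach_Γ₁
  have : IsBieberbach Γ₂ := isBieberbach_Γ₂
  obtain ⟨u₁⟩ := nonempty_H1_addEquiv Γ₁
  obtain ⟨u₂⟩ := nonempty_H1_addEquiv Γ₂
  obtain ⟨v₁⟩ := nonempty_abelianization_Γ₁
  obtain ⟨v₂⟩ := nonempty_abelianization_Γ₂
  have hne : IsEmpty (H1 (OrbitSpace Γ₁) ≃+ H1 (OrbitSpace Γ₂)) :=
    ⟨fun e => isEmpty_addEquiv.false ((u₁.trans v₁).symm.trans (e.trans (u₂.trans v₂)))⟩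
  refine ⟨isBieberbach_Γ₁, isBieberbach_Γ₂, isCompactFlatManifold_orbitSpace,
    isCompactFlatManifold_orbitSpace, fun x => ?_, fun x => ?_, pIsospectral_Γ, ⟨u₁⟩,
    ⟨u₁.trans v₁⟩, ⟨u₂⟩, ⟨u₂.trans v₂⟩, hne, ⟨fun e => ?_⟩, fun j hj => ?_, fun j hj => ?_⟩
  · exact nonempty_holonomyGroup_mulEquiv (parityHom hasForm_Γ₁) parityHom_Γ₁_surjective
      (parityHom_eq_one_iff hasForm_Γ₁) x
  · exact nonempty_holonomyGroup_mulEquiv (parityHom hasForm_Γ₂) parityHom_Γ₂_surjective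
      (parityHom_eq_one_iff hasForm_Γ₂) x
  · obtain ⟨e'⟩ := nonempty_H1_addEquiv_of_homeomorph e
    exact hne.false e'
  · rw [bettiNumber_eq isSignDiag_Γ₁ (hasPeriods_of_intTrans_mem intTrans_mem_Γ₁),
      rank_constInvariants hasSignHolonomy_Γ₁ hj]
  · rw [bettiNumber_eq isSignDiag_Γ₂ (hasPeriods_of_intTrans_mem intTrans_mem_Γ₂),
      rank_constInvariants hasSignHolonomy_Γ₂ hj]
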